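/- Let $\mathbb F$ be a field of characteristic zero and $m\ge 1$ an integer. For $n\ge 0$ let $V(n)$ be the irreducible $\mathfrak{sl}(2)$-module of highest weight $n$ (dimension $n+1$), realized as the homogeneous polynomials of degree $n$ in $x,y$ over $\mathbb F$, with $e=x\partial_y$, $f=y\partial_x$, $h=x\partial_x-y\partial_y$. Let $\mathfrak g_m=\mathfrak{sl}(2)\ltimes V(m)$, where $\mathfrak r=V(m)$ is regarded as an abelian Lie algebra. For integers $\alpha,\ell\ge 0$ let $Z(\alpha,\ell)$ be the $\mathfrak g_m$-module which as an $\mathfrak{sl}(2)$-module is $V(\alpha)\oplus V(\alpha+m)\oplus\cdots\oplus V(\alpha+\ell m)$ and on which $\mathfrak r$ annihilates $V(\alpha)$ and maps $V(\alpha+im)$ to $V(\alpha+(i-1)m)$, $1\le i\le \ell$, through the nonzero (unique up to a scalar) $\mathfrak{sl}(2)$-homomorphism $V(m)\to\mathrm{Hom}(V(\alpha+im),V(\alpha+(i-1)m))$, $u\mapsto u(\partial_y,-\partial_x)$. A $\mathfrak g_m$-module is of type $Z$ if it is isomorphic to some $Z(\alpha,\ell)$ or to its dual $Z(\alpha,\ell)^*$.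 The socle $\mathrm{soc}(M)$ of a $\mathfrak g_m$-module $M$ is the sum of its irreducible submodules; $\mathrm{soc}^0(M)=0$ and $\mathrm{soc}^{i+1}(M)/\mathrm{soc}^i(M)=\mathrm{soc}(M/\mathrm{soc}^i(M))$. A socle decomposition of $M$ is a vector space decomposition $M=M_0\oplus\cdots\oplus M_\ell$ into irreducible $\mathfrak{sl}(2)$-submodules such that $M_i\simeq \mathrm{soc}^{i+1}(M)/\mathrm{soc}^i(M)$ as $\mathfrak{sl}(2)$-modules and $\mathfrak r M_i\subseteq M_0\oplus\cdots\oplus M_i$ for all $i$. **Theorem.** Let $V$ and $W$ be $\mathfrak g_m$-modules of type $Z$, let $V=V_0\oplus\cdots\oplus V_\ell$ and $W=W_0\oplus\cdots\oplus W_{\ell'}$ be socle decompositions, and let $V_i\simeq V(a_i)$, $W_j\simeq V(b_j)$ as $\mathfrak{sl}(2)$-modules. For $t\ge 0$ put $$S_t=\Big(\bigoplus_{i+j=t}V_i\otimes W_j\Big)^{\mathfrak r}=\Big\{u\in \bigoplus_{i+j=t}V_i\otimes W_j:\ \mathfrak r u=0\Big\}.$$ Then $$\mathrm{soc}(V\otimes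 W)=\mathrm{soc}(V)\otimes\mathrm{soc}(W)\ \oplus\ \bigoplus_{t=1}^{\min\{\ell,\ell'\}}S_t ,$$ and the following isomorphisms of $\mathfrak{sl}(2)$-modules hold. (i) If $V\simeq Z(a_0,\ell)$ and $W\simeq Z(b_0,\ell')$, then $S_t\simeq V(a_0+b_0+mt)$ for $1\le t\le\min\{\ell,\ell'\}$, and $$\mathrm{soc}(V\otimes W)\simeq\bigoplus_{k=0}^{\min\{a_0,b_0\}}V(a_0+b_0-2k)\ \oplus\bigoplus_{t=1}^{\min\{\ell,\ell'\}}V(a_0+b_0+mt).$$ (ii) If $V\simeq Z(a_0,\ell)$ and $W\simeq Z(b_{\ell'},\ell')^*$, then for $1\le t\le\min\{\ell,\ell'\}$ one has $S_t=0$ if $a_0>b_t$, and $S_t\simeq V(b_0-a_0-tm)$ if $a_0\le b_t$. Moreover, if $a_0>b_0$ then $\mathrm{soc}(V\otimes W)\simeq\bigoplus_{k=0}^{b_0}V(a_0-b_0+2k)$, and if $a_0\le b_0$ then $$\mathrm{soc}(V\otimes W)\simeq\bigoplus_{k=0}^{a_0}V(b_0-a_0+2k)\ \oplus\bigoplus_{t=1}^{T}V(b_0-a_0-tm),\qquad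 T=\min\Big\{\ell,\ell',\Big\lfloor\frac{b_0-a_0}{m}\Big\rfloor\Big\}.$$ (iii) If $V\simeq Z(a_\ell,\ell)^*$ and $W\simeq Z(b_{\ell'},\ell')^*$, then $S_t=0$ for all $t\ge1$, and $$\mathrm{soc}(V\otimes W)\simeq\bigoplus_{k=0}^{\min\{a_0,b_0\}}V(|a_0-b_0|+2k).$$ In particular, for all $V,W$ of type $Z$, $\mathrm{soc}(V\otimes W)$ is multiplicity free as an $\mathfrak{sl}(2)$-module, that is, a direct sum of pairwise non-isomorphic irreducible submodules. -/

import Mathlib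

open scoped TensorProduct DirectSum

namespace GM

noncomputable section

/-! ### The irreducible `sl(2)`-modules `V(n)` as binary forms of degree `n` -/

/-- The Lie algebra `sl(2)` over `F`: traceless `2 × 2` matrices. -/
abbrev sl2 (F : Type*) [Field F] := LieAlgebra.SpecialLinear.sl (Fin 2) F

/-- Polynomials in the two variables `x = X 0` and `y = X 1`. -/
abbrev BinPoly (F : Type*) [Field F] := MvPolynomial (Fin 2) F

/-- The derivation of `F[x, y]` extending the linear action of a matrix `A` on the span of
`x, y`: `X j ↦ ∑ i, A i j • X i`. Thus `e`, `f`, `h` act as `x ∂_y`, `y ∂_x`, `x ∂_x - y ∂_y`. -/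
def der {F : Type*} [Field F] (A : Matrix (Fin 2) (Fin 2) F) : Derivation F (BinPoly F) (BinPoly F) :=
  MvPolynomial.mkDerivation F fun j => ∑ i, A i j • MvPolynomial.X i

/-- `V(n)`: homogeneous polynomials of degree `n` in `x, y`; a space of dimension `n + 1`, with
basis `x ^ (n - k) * y ^ k`, `0 ≤ k ≤ n`, the vector of index `k` having `h`-weight `n - 2 k`. -/
def V (F : Type*) [Field F] (n : ℕ) : Type _ := ↥(MvPolynomial.homogeneousSubmodule (Fin 2) F n)

section

variable {F : Type*} [Field F] {n : ℕ}

instance : AddCommGroup (V F n) :=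
  inferInstanceAs (AddCommGroup ↥(MvPolynomial.homogeneousSubmodule (Fin 2) F n))

instance : Module F (V F n) :=
  inferInstanceAs (Module F ↥(MvPolynomial.homogeneousSubmodule (Fin 2) F n))

/-- The inclusion of `V(n)` into `F[x, y]`. -/
def V.incl (F : Type*) [Field F] (n : ℕ) : V F n →ₗ[F] BinPoly F :=
  (MvPolynomial.homogeneousSubmodule (Fin 2) F n).subtype

lemma V.incl_injective : Function.Injective (V.incl F n) := Subtype.val_injective

lemma V.isHomogeneous (p : V F n) : (V.incl F n p).IsHomogeneous n := p.2

lemma der_X (A : Matrix (Fin 2) (Fin 2) F) (j : Fin 2) :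
    der A (MvPolynomial.X j) = ∑ i, A i j • MvPolynomial.X i := by
  simp [der]

lemma der_add (A B : Matrix (Fin 2) (Fin 2) F) : der (A + B) = der A + der B := by
  apply MvPolynomial.derivation_ext
  intro j
  simp [der_X, add_smul, Finset.sum_add_distrib]
  try abel

lemma der_smul (c : F) (A : Matrix (Fin 2) (Fin 2) F) : der (c • A) = c • der A := by
  apply MvPolynomial.derivation_ext
  intro j
  simp [der_X, mul_smul, smul_add]

lemma der_comm (A B : Matrix (Fin 2) (Fin 2) F) : der (A * B - B * A) = ⁅der A, der B⁆ := by
  apply MvPolynomial.derivation_ext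
  intro j
  rw [Derivation.commutator_apply]
  have h : ∀ (C D : Matrix (Fin 2) (Fin 2) F), der C (der D (MvPolynomial.X j)) =
      ∑ i, D i j • ∑ k, C k i • MvPolynomial.X k := by
    intro C D
    rw [der_X, map_sum]
    exact Finset.sum_congr rfl fun i _ => by rw [Derivation.map_smul, der_X]
  rw [h, h, der_X]
  simp only [Fin.sum_univ_two, Matrix.sub_apply, Matrix.mul_apply, MvPolynomial.smul_eq_C_mul,
    map_add, map_sub, map_mul]
  ring

lemma der_eq_sum (A : Matrix (Fin 2) (Fin 2) F) (p : BinPoly F) :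
    der A p = ∑ j, (∑ i, A i j • MvPolynomial.X i) * MvPolynomial.pderiv j p := by
  have h : der A = ∑ j, (∑ i, A i j • (MvPolynomial.X i : BinPoly F)) • MvPolynomial.pderiv j := by
    apply MvPolynomial.derivation_ext
    intro k
    rw [der_X]
    fin_cases k <;> simp [MvPolynomial.pderiv_X]
  rw [h]
  simp

lemma der_isHomogeneous (A : Matrix (Fin 2) (Fin 2) F) {p : BinPoly F} (hp : p.IsHomogeneous n) :
    (der A p).IsHomogeneous n := by
  rcases Nat.eq_zero_or_pos n with rfl | hn
  · have h := MvPolynomial.totalDegree_zero_iff_isHomogeneous (Fin 2) |>.2 hp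
    rw [MvPolynomial.totalDegree_eq_zero_iff_eq_C.1 h, MvPolynomial.derivation_C]
    exact MvPolynomial.isHomogeneous_zero _ _ _
  · rw [der_eq_sum]
    refine MvPolynomial.IsHomogeneous.sum _ _ _ fun j _ => ?_
    have h1 : (∑ i, A i j • (MvPolynomial.X i : BinPoly F)).IsHomogeneous 1 := by
      refine MvPolynomial.IsHomogeneous.sum _ _ _ fun i _ => ?_
      rw [MvPolynomial.smul_eq_C_mul]
      exact (MvPolynomial.isHomogeneous_X F i).C_mul _
    have h2 := h1.mul (hp.pderiv (i := j))
    rwa [Nat.add_sub_cancel' hn] at h2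

lemma V.ext {p q : V F n} (h : V.incl F n p = V.incl F n q) : p = q := V.incl_injective h

instance : Bracket (sl2 F) (V F n) where
  bracket A p := ⟨der A.val (V.incl F n p), der_isHomogeneous A.val p.2⟩

@[simp] lemma V.incl_lie (A : sl2 F) (p : V F n) :
    V.incl F n ⁅A, p⁆ = der A.val (V.incl F n p) := rfl

instance : LieRingModule (sl2 F) (V F n) where
  add_lie A B p := by
    apply V.ext
    rw [map_add, V.incl_lie, V.incl_lie, V.incl_lie]
    change der (A.val + B.val) _ = _
    rw [der_add]; rfl
  lie_add A p q := by
    apply V.ext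
    simp only [map_add, V.incl_lie]
  leibniz_lie A B p := by
    apply V.ext
    rw [map_add, V.incl_lie, V.incl_lie, V.incl_lie, V.incl_lie, V.incl_lie,
      LieAlgebra.SpecialLinear.sl_bracket, der_comm, Derivation.commutator_apply]
    abel

instance : LieModule F (sl2 F) (V F n) where
  smul_lie c A p := by
    apply V.ext
    rw [map_smul, V.incl_lie, V.incl_lie]
    change der (c • A.val) _ = _
    rw [der_smul]; rfl
  lie_smul c A p := by
    apply V.ext
    simp only [map_smul, V.incl_lie, Derivation.map_smul]

end

/-! ### The Lie algebra `𝔤ₘ = sl(2) ⋉ V(m)` -/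

section

variable {F : Type*} [Field F] {n : ℕ}

/-- `V(n)` viewed as an abelian Lie algebra. -/
instance : LieRing (V F n) where
  bracket _ _ := 0
  add_lie _ _ _ := (add_zero 0).symm
  lie_add _ _ _ := (add_zero 0).symm
  lie_self _ := rfl
  leibniz_lie _ _ _ := (add_zero 0).symm

lemma V.abelian (p q : V F n) : ⁅p, q⁆ = 0 := rfl

instance : LieAlgebra F (V F n) where
  lie_smul c _ _ := (smul_zero c).symm

/-- The action of `sl(2)` on the abelian Lie algebra `V(n)` by derivations. -/
def actDer (F : Type*) [Field F] (n : ℕ) : sl2 F →ₗ⁅F⁆ LieDerivation F (V F n) (V F n) where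
  toFun A :=
    { toLinearMap := LieModule.toEnd F (sl2 F) (V F n) A
      leibniz' := fun p q => by simp [V.abelian] }
  map_add' A B := by ext p; simp
  map_smul' c A := by ext p; simp
  map_lie' := by intro A B; ext p; simp

end

/-- `𝔤ₘ = sl(2) ⋉ V(m)`. -/
abbrev 𝔤 (F : Type*) [Field F] (m : ℕ) := LieAlgebra.SemiDirectSum (V F m) (sl2 F) (actDer F m)

/-- The inclusion of the radical `𝔯 = V(m)` into `𝔤ₘ`. -/
abbrev radIncl (F : Type*) [Field F] (m : ℕ) : V F m →ₗ⁅F⁆ 𝔤 F m :=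
  LieAlgebra.SemiDirectSum.inl (actDer F m)

/-- The Levi factor `𝔰 = sl(2)` of `𝔤ₘ`, as a Lie subalgebra. -/
abbrev levi (F : Type*) [Field F] (m : ℕ) : LieSubalgebra F (𝔤 F m) :=
  (LieAlgebra.SemiDirectSum.inr (actDer F m)).range

section

variable {F : Type*} [Field F] {m n : ℕ}

/-- `V(n)` as a `𝔤ₘ`-module on which `𝔯` acts trivially. Restricted to `𝔰` this is the irreducible
`sl(2)`-module with highest weight `n`. -/
instance : LieRingModule (𝔤 F m) (V F n) :=
  LieRingModule.compLieHom (V F n) (LieAlgebra.SemiDirectSum.projr (actDer F m))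

instance : LieModule F (𝔤 F m) (V F n) :=
  LieModule.compLieHom (V F n) (LieAlgebra.SemiDirectSum.projr (actDer F m))

end

/-! ### The modules `Z(α, ℓ)` -/

section

variable {F : Type*} [Field F]

/-- The operators `∂_y` (for `0`) and `-∂_x` (for `1`). Under a traceless matrix they transform as
the variables `x` and `y`. -/
def dOp (i : Fin 2) : Module.End F (BinPoly F) :=
  if i = 0 then (MvPolynomial.pderiv (1 : Fin 2)).toLinearMap
  else -(MvPolynomial.pderiv (0 : Fin 2)).toLinearMap

/-- `contract u` is the constant coefficient differential operator `u(∂_y, -∂_x)`: linear in `u`,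
it takes `x ^ i * y ^ j` to `(∂_y) ^ i * (-∂_x) ^ j`. -/
def contract : BinPoly F →ₗ[F] Module.End F (BinPoly F) :=
  (MvPolynomial.basisMonomials (Fin 2) F).constr F fun s => dOp 0 ^ s 0 * dOp 1 ^ s 1

lemma contract_monomial (s : Fin 2 →₀ ℕ) (c : F) :
    contract (MvPolynomial.monomial s c) = c • (dOp 0 ^ s 0 * dOp 1 ^ s 1) := by
  have h : (MvPolynomial.monomial s c : BinPoly F) = c • MvPolynomial.basisMonomials (Fin 2) F s := by
    simp [MvPolynomial.smul_monomial]
  rw [h, map_smul, contract, Module.Basis.constr_basis]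

lemma dOp_commute : Commute (dOp 0 : Module.End F (BinPoly F)) (dOp 1) := by
  have h : ⁅(MvPolynomial.pderiv 1 : Derivation F (BinPoly F) (BinPoly F)),
      (MvPolynomial.pderiv 0 : Derivation F (BinPoly F) (BinPoly F))⁆ = 0 := by
    apply MvPolynomial.derivation_ext
    intro k
    rw [Derivation.commutator_apply]
    fin_cases k <;> simp [MvPolynomial.pderiv_X]
  refine LinearMap.ext fun p => ?_
  have h' := congrArg (fun D : Derivation F (BinPoly F) (BinPoly F) => D p) h
  simp only [Derivation.commutator_apply, Derivation.coe_zero, Pi.zero_apply] at h'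
  simp [dOp, sub_eq_zero.1 h']

lemma contract_mul_X (p : BinPoly F) (i : Fin 2) :
    contract (p * MvPolynomial.X i) = dOp i * contract p := by
  induction p using MvPolynomial.induction_on' with
  | add p q hp hq => rw [add_mul, map_add, map_add, hp, hq, mul_add]
  | monomial s c =>
    rw [MvPolynomial.X, MvPolynomial.monomial_mul, contract_monomial, contract_monomial, mul_one,
      mul_smul_comm]
    congr 1
    fin_cases i
    · simp [pow_succ', mul_assoc]
    · simp only [Fin.mk_one, Finsupp.add_apply, Finsupp.single_apply]
      simp only [one_ne_zero, if_false, if_true, add_zero, pow_succ', ← mul_assoc]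
      rw [(dOp_commute.pow_left (s 0)).eq]

lemma contract_commute (p q : BinPoly F) : Commute (contract p) (contract q) := by
  induction p using MvPolynomial.induction_on' with
  | add p q hp hq => rw [map_add]; exact hp.add_left hq
  | monomial s c =>
    induction q using MvPolynomial.induction_on' with
    | add p q hp hq => rw [map_add]; exact hp.add_right hq
    | monomial t d =>
      rw [contract_monomial, contract_monomial]
      have h00 : Commute (dOp 0 : Module.End F (BinPoly F)) (dOp 0) := Commute.refl _
      have h11 : Commute (dOp 1 : Module.End F (BinPoly F)) (dOp 1) := Commute.refl _
      refine Commute.smul_left (Commute.smul_right ?_ _) _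
      exact (((h00.pow_pow _ _).mul_right (dOp_commute.pow_pow _ _)).mul_left
        ((dOp_commute.symm.pow_pow _ _).mul_right (h11.pow_pow _ _)))

lemma dOp_isHomogeneous (i : Fin 2) {n : ℕ} {p : BinPoly F} (hp : p.IsHomogeneous n) :
    (dOp i p).IsHomogeneous (n - 1) := by
  unfold dOp
  split_ifs
  · exact hp.pderiv
  · exact hp.pderiv.neg

lemma dOp_pow_isHomogeneous (i : Fin 2) (k : ℕ) {n : ℕ} {p : BinPoly F} (hp : p.IsHomogeneous n) :
    ((dOp i ^ k) p).IsHomogeneous (n - k) := by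
  induction k with
  | zero => simpa using hp
  | succ k ih =>
    rw [pow_succ']
    exact dOp_isHomogeneous i ih

lemma contract_isHomogeneous {m a b : ℕ} (h : b = a + m) {u p : BinPoly F} (hu : u.IsHomogeneous m)
    (hp : p.IsHomogeneous b) : (contract u p).IsHomogeneous a := by
  rw [u.as_sum, map_sum, LinearMap.sum_apply]
  refine MvPolynomial.IsHomogeneous.sum _ _ _ fun s hs => ?_
  have hd : s.degree = m := (hu.degree_eq_sum_deg_support hs).symm
  rw [Finsupp.degree_eq_sum, Fin.sum_univ_two] at hd
  rw [contract_monomial, LinearMap.smul_apply, MvPolynomial.smul_eq_C_mul]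
  have h1 := dOp_pow_isHomogeneous (0 : Fin 2) (s 0) (dOp_pow_isHomogeneous (1 : Fin 2) (s 1) hp)
  have h2 : b - s 1 - s 0 = a := by omega
  rw [h2] at h1
  exact h1.C_mul _

lemma der_pderiv (A : Matrix (Fin 2) (Fin 2) F) (k : Fin 2) (p : BinPoly F) :
    der A (MvPolynomial.pderiv k p) =
      MvPolynomial.pderiv k (der A p) - ∑ j, A k j • MvPolynomial.pderiv j p := by
  have h : ⁅der A, (MvPolynomial.pderiv k : Derivation F (BinPoly F) (BinPoly F))⁆ =
      -∑ j, A k j • (MvPolynomial.pderiv j : Derivation F (BinPoly F) (BinPoly F)) := by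
    apply MvPolynomial.derivation_ext
    intro i
    rw [Derivation.commutator_apply, der_X]
    fin_cases k <;> fin_cases i <;> simp [MvPolynomial.pderiv_X, MvPolynomial.smul_eq_C_mul]
  have h' := congrArg (fun D : Derivation F (BinPoly F) (BinPoly F) => D p) h
  simp only [Derivation.commutator_apply, Derivation.coe_neg, Pi.neg_apply, Fin.sum_univ_two,
    Derivation.add_apply, Derivation.smul_apply] at h'
  rw [Fin.sum_univ_two]
  rw [sub_eq_iff_eq_add] at h'
  rw [h']
  abel

lemma der_dOp (A : sl2 F) (i : Fin 2) (p : BinPoly F) :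
    der A.val (dOp i p) = dOp i (der A.val p) + ∑ k, A.val k i • dOp k p := by
  have ht : A.val 0 0 + A.val 1 1 = 0 := by
    have := LinearMap.mem_ker.1 A.2
    simpa [Matrix.trace, Fin.sum_univ_two] using this
  have ht' : A.val 1 1 = -A.val 0 0 := by linear_combination ht
  fin_cases i
  · simp [dOp, der_pderiv, Fin.sum_univ_two, ht']
    abel
  · simp [dOp, der_pderiv, Fin.sum_univ_two, ht']
    try abel

/-- Equivariance of the contraction under traceless matrices. -/
lemma der_contract (A : sl2 F) (u p : BinPoly F) :
    der A.val (contract u p) = contract (der A.val u) p + contract u (der A.val p) := by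
  induction u using MvPolynomial.induction_on generalizing p with
  | C c =>
    rw [MvPolynomial.derivation_C, MvPolynomial.C_apply, contract_monomial]
    simp
  | add u v hu hv =>
    simp only [map_add, LinearMap.add_apply, hu, hv]
    abel
  | mul_X u i hu =>
    rw [Derivation.leibniz, der_X, smul_eq_mul, smul_eq_mul, mul_comm (MvPolynomial.X i),
      Finset.mul_sum, map_add, map_sum, contract_mul_X, contract_mul_X, Module.End.mul_apply,
      Module.End.mul_apply, der_dOp, hu]
    simp only [mul_smul_comm, map_smul, contract_mul_X, LinearMap.add_apply, LinearMap.sum_apply,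
      LinearMap.smul_apply, Module.End.mul_apply, map_add]
    abel

/-- The (unique up to a scalar) nonzero `sl(2)`-homomorphism `V(m) → Hom(V(a + m), V(a))`,
`u ↦ u(∂_y, -∂_x)`. -/
def lower {m a b : ℕ} (h : b = a + m) : V F m →ₗ[F] V F b →ₗ[F] V F a :=
  LinearMap.mk₂ F (fun u p => ⟨contract (V.incl F m u) (V.incl F b p),
      contract_isHomogeneous h u.2 p.2⟩)
    (fun u v p => V.ext (by
      change contract (V.incl F m (u + v)) _ = contract _ _ + contract _ _
      simp))
    (fun c u p => V.ext (by
      change contract (V.incl F m (c • u)) _ = c • contract _ _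
      simp))
    (fun u p q => V.ext (by
      change contract _ (V.incl F b (p + q)) = contract _ _ + contract _ _
      simp))
    (fun c u p => V.ext (by
      change contract _ (V.incl F b (c • p)) = c • contract _ _
      simp))

lemma incl_lower {m a b : ℕ} (h : b = a + m) (u : V F m) (p : V F b) :
    V.incl F a (lower h u p) = contract (V.incl F m u) (V.incl F b p) := rfl

lemma lie_lower {m a b : ℕ} (h : b = a + m) (A : sl2 F) (u : V F m) (p : V F b) :
    ⁅A, lower h u p⁆ = lower h ⁅A, u⁆ p + lower h u ⁅A, p⁆ := by
  apply V.ext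
  simp only [map_add, V.incl_lie, incl_lower, der_contract]

lemma lower_comm {m a b c : ℕ} (h : b = a + m) (h' : c = b + m) (u v : V F m) (p : V F c) :
    lower h u (lower h' v p) = lower h v (lower h' u p) := by
  apply V.ext
  simp only [incl_lower]
  exact LinearMap.congr_fun (contract_commute (V.incl F m u) (V.incl F m v)).eq (V.incl F c p)

end

/-- `Z(α, ℓ) = V(α) ⊕ V(α + m) ⊕ ⋯ ⊕ V(α + ℓ m)`. -/
def Z (F : Type*) [Field F] (m α l : ℕ) : Type _ := ∀ i : Fin (l + 1), V F (α + i * m)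

section

variable {F : Type*} [Field F] {m α l : ℕ}

instance : AddCommGroup (Z F m α l) :=
  inferInstanceAs (AddCommGroup (∀ i : Fin (l + 1), V F (α + i * m)))

instance : Module F (Z F m α l) :=
  inferInstanceAs (Module F (∀ i : Fin (l + 1), V F (α + i * m)))

/-- The action of `𝔯 = V(m)` on `Z(α, ℓ)`: it sends the summand `V(α + (i + 1) m)` to the summand
`V(α + i m)` by `lower`, and `V(α)` to `0`. -/
def radAct (u : V F m) (z : Z F m α l) : Z F m α l := fun i =>
  if h : (i : ℕ) + 1 < l + 1 then
    lower (by push_cast; ring) u (z ⟨i + 1, h⟩)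
  else 0

/-- On `Z(α, ℓ)` the Lie algebra `sl(2)` acts on every summand, and `𝔯` by `radAct`. -/
instance : Bracket (𝔤 F m) (Z F m α l) where
  bracket x z := fun i => ⁅x.right, z i⁆ + radAct x.left z i

lemma Z.lie_apply (x : 𝔤 F m) (z : Z F m α l) (i : Fin (l + 1)) :
    ⁅x, z⁆ i = ⁅x.right, z i⁆ + radAct x.left z i := rfl

lemma Z.add_apply (z w : Z F m α l) (i : Fin (l + 1)) : (z + w) i = z i + w i := rfl

lemma Z.smul_apply (c : F) (z : Z F m α l) (i : Fin (l + 1)) : (c • z) i = c • z i := rfl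

lemma Z.ext {z w : Z F m α l} (h : ∀ i, z i = w i) : z = w := funext h

lemma radAct_add_left (u v : V F m) (z : Z F m α l) (i : Fin (l + 1)) :
    radAct (u + v) z i = radAct u z i + radAct v z i := by
  unfold radAct; split_ifs <;> simp

lemma radAct_sub_left (u v : V F m) (z : Z F m α l) (i : Fin (l + 1)) :
    radAct (u - v) z i = radAct u z i - radAct v z i := by
  unfold radAct; split_ifs <;> simp

lemma radAct_zero_left (z : Z F m α l) (i : Fin (l + 1)) : radAct 0 z i = 0 := by
  unfold radAct; split_ifs <;> simp

lemma radAct_add_right (u : V F m) (z w : Z F m α l) (i : Fin (l + 1)) :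
    radAct u (z + w) i = radAct u z i + radAct u w i := by
  unfold radAct; split_ifs <;> simp [Z.add_apply]

lemma radAct_smul_left (c : F) (u : V F m) (z : Z F m α l) (i : Fin (l + 1)) :
    radAct (c • u) z i = c • radAct u z i := by
  unfold radAct; split_ifs <;> simp

lemma radAct_smul_right (c : F) (u : V F m) (z : Z F m α l) (i : Fin (l + 1)) :
    radAct u (c • z) i = c • radAct u z i := by
  unfold radAct; split_ifs <;> simp [Z.smul_apply]

lemma radAct_comm (u v : V F m) (z : Z F m α l) : radAct u (radAct v z) = radAct v (radAct u z) := by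
  apply Z.ext
  intro i
  unfold radAct
  split_ifs
  · exact lower_comm _ _ _ _ _
  · rw [map_zero, map_zero]
  · rfl

lemma lie_radAct (A : sl2 F) (u : V F m) (z : Z F m α l) (i : Fin (l + 1)) :
    ⁅A, radAct u z i⁆ = radAct ⁅A, u⁆ z i + radAct u (fun j => ⁅A, z j⁆ : Z F m α l) i := by
  unfold radAct
  split_ifs with h1
  · exact lie_lower _ _ _ _
  · simp

instance : LieRingModule (𝔤 F m) (Z F m α l) where
  add_lie x y z := by
    apply Z.ext; intro i
    simp only [Z.add_apply, Z.lie_apply, LieAlgebra.SemiDirectSum.add_eq_mk, add_lie,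
      radAct_add_left]
    abel
  lie_add x z w := by
    apply Z.ext; intro i
    simp only [Z.add_apply, Z.lie_apply, lie_add, radAct_add_right]
    abel
  leibniz_lie x y z := by
    apply Z.ext; intro i
    have e : ∀ (x : 𝔤 F m) (z : Z F m α l), ⁅x, z⁆ =
        (show Z F m α l from fun j => ⁅x.right, z j⁆) + radAct x.left z := fun _ _ => rfl
    have hx : ∀ A : sl2 F, ∀ u : V F m, (actDer F m A) u = ⁅A, u⁆ := fun _ _ => rfl
    simp only [Z.add_apply, Z.lie_apply, LieAlgebra.SemiDirectSum.lie_eq_mk, lie_add,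
      V.abelian, zero_add, radAct_sub_left, hx, lie_radAct]
    rw [e y z, e x z, radAct_add_right, radAct_add_right, radAct_comm x.left y.left,
      leibniz_lie x.right y.right]
    abel

instance : LieModule F (𝔤 F m) (Z F m α l) where
  smul_lie c x z := by
    apply Z.ext; intro i
    simp only [Z.smul_apply, Z.lie_apply, LieAlgebra.SemiDirectSum.smul_eq_mk, smul_lie,
      radAct_smul_left, smul_add]
  lie_smul c x z := by
    apply Z.ext; intro i
    simp only [Z.smul_apply, Z.lie_apply, lie_smul, radAct_smul_right, smul_add]

end

/-- A `𝔤ₘ`-module is of type `Z` if it is isomorphic to some `Z(α, ℓ)` or to the dual of one. -/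
def IsTypeZ (F : Type*) [Field F] (m : ℕ) (M : Type*) [AddCommGroup M] [Module F M]
    [LieRingModule (𝔤 F m) M] [LieModule F (𝔤 F m) M] : Prop :=
  ∃ α l : ℕ, Nonempty (M ≃ₗ⁅F, 𝔤 F m⁆ Z F m α l) ∨
    Nonempty (M ≃ₗ⁅F, 𝔤 F m⁆ Module.Dual F (Z F m α l))

/-! ### Socles -/

section

variable (F : Type*) [Field F] (L : Type*) [LieRing L] [LieAlgebra F L]
  (M : Type*) [AddCommGroup M] [Module F M] [LieRingModule L M] [LieModule F L M]

/-- The socle: the sum of all irreducible submodules. -/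
def socle : LieSubmodule F L M :=
  sSup {N : LieSubmodule F L M | LieModule.IsIrreducible F L N}

/-- The socle series: `soc⁰ = 0` and `socⁱ⁺¹ / socⁱ` is the socle of `M / socⁱ`. -/
def socleSeries : ℕ → LieSubmodule F L M
  | 0 => ⊥
  | i + 1 => (socle F L (M ⧸ socleSeries i)).comap (LieSubmodule.Quotient.mk' (socleSeries i))

/-- The quotient `socⁱ⁺¹ / socⁱ`. -/
abbrev SocleFactor (i : ℕ) : Type _ :=
  ↥(socleSeries F L M (i + 1)) ⧸ (socleSeries F L M i).comap (socleSeries F L M (i + 1)).incl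

/-- A module is multiplicity free if it is the direct sum of pairwise non-isomorphic irreducible
submodules. -/
def IsMultiplicityFree : Prop :=
  ∃ S : Set (LieSubmodule F L M), (∀ N ∈ S, LieModule.IsIrreducible F L N) ∧
    sSupIndep S ∧ sSup S = ⊤ ∧
    ∀ N ∈ S, ∀ N' ∈ S, Nonempty (N ≃ₗ⁅F, L⁆ N') → N = N'

end

/-- A socle decomposition `M = U₀ ⊕ ⋯ ⊕ Uₗ` of a `𝔤ₘ`-module: the `Uᵢ` are irreducible
`𝔰`-submodules, `Uᵢ ≃ socⁱ⁺¹(M) / socⁱ(M)` as `𝔰`-modules, and `𝔯 Uᵢ ⊆ U₀ ⊕ ⋯ ⊕ Uᵢ`. -/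
structure IsSocleDecomposition {F : Type*} [Field F] {m : ℕ} {M : Type*} [AddCommGroup M]
    [Module F M] [LieRingModule (𝔤 F m) M] [LieModule F (𝔤 F m) M] {l : ℕ}
    (U : Fin (l + 1) → LieSubmodule F (levi F m) M) : Prop where
  isInternal : DirectSum.IsInternal fun i => (U i).toSubmodule
  irreducible : ∀ i, LieModule.IsIrreducible F (levi F m) (U i)
  factor : ∀ i : Fin (l + 1),
    Nonempty (U i ≃ₗ⁅F, levi F m⁆ SocleFactor F (𝔤 F m) M i)
  rad_lie_mem : ∀ i, ∀ e : V F m, ∀ u ∈ U i,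
    ⁅radIncl F m e, u⁆ ∈ ⨆ j : Fin (l + 1), ⨆ _ : j ≤ i, (U j).toSubmodule

/-! ### The summands of the socle of a tensor product -/

section

variable {F : Type*} [Field F] {m : ℕ}
  {M : Type*} [AddCommGroup M] [Module F M] [LieRingModule (𝔤 F m) M] [LieModule F (𝔤 F m) M]
  {N : Type*} [AddCommGroup N] [Module F N] [LieRingModule (𝔤 F m) N] [LieModule F (𝔤 F m) N]

/-- The subspace `⨁_{i + j = t} Uᵢ ⊗ U'ⱼ` of `M ⊗ N`. -/
def diag {l l' : ℕ} (U : Fin (l + 1) → LieSubmodule F (levi F m) M)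
    (U' : Fin (l' + 1) → LieSubmodule F (levi F m) N) (t : ℕ) : Submodule F (M ⊗[F] N) :=
  ⨆ (i : Fin (l + 1)) (j : Fin (l' + 1)) (_ : (i : ℕ) + (j : ℕ) = t),
    LinearMap.range (TensorProduct.mapIncl (U i).toSubmodule (U' j).toSubmodule)

lemma diag_stable {l l' : ℕ} (U : Fin (l + 1) → LieSubmodule F (levi F m) M)
    (U' : Fin (l' + 1) → LieSubmodule F (levi F m) N) (t : ℕ) (A : sl2 F) {u : M ⊗[F] N}
    (hu : u ∈ diag U U' t) :
    ⁅LieAlgebra.SemiDirectSum.inr (actDer F m) A, u⁆ ∈ diag U U' t := by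
  set x : 𝔤 F m := LieAlgebra.SemiDirectSum.inr (actDer F m) A with hx
  have hxl : x ∈ levi F m := ⟨A, rfl⟩
  have key : diag U U' t ≤ (diag U U' t).comap (LieModule.toEnd F (𝔤 F m) (M ⊗[F] N) x) := by
    conv_lhs => unfold diag
    refine iSup_le fun i => iSup_le fun j => iSup_le fun hij => ?_
    have hle : LinearMap.range (TensorProduct.mapIncl (U i).toSubmodule (U' j).toSubmodule) ≤
        diag U U' t :=
      le_iSup_of_le i (le_iSup_of_le j (le_iSup_of_le hij le_rfl))
    rintro _ ⟨w, rfl⟩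
    induction w with
    | zero => simp
    | add w w' h h' => rw [map_add]; exact Submodule.add_mem _ h h'
    | tmul p q =>
      change ⁅x, (p : M) ⊗ₜ[F] (q : N)⁆ ∈ diag U U' t
      rw [TensorProduct.LieModule.lie_tmul_right]
      have hp : ⁅x, (p : M)⁆ ∈ U i := (U i).lie_mem (x := (⟨x, hxl⟩ : levi F m)) p.2
      have hq : ⁅x, (q : N)⁆ ∈ U' j := (U' j).lie_mem (x := (⟨x, hxl⟩ : levi F m)) q.2
      refine Submodule.add_mem _ (hle ⟨(⟨_, hp⟩ : (U i).toSubmodule) ⊗ₜ[F] q, rfl⟩)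
        (hle ⟨p ⊗ₜ[F] (⟨_, hq⟩ : (U' j).toSubmodule), rfl⟩)
  exact key hu

/-- `S_t = (⨁_{i + j = t} Uᵢ ⊗ U'ⱼ)^𝔯`, the vectors annihilated by `𝔯`; a `𝔤ₘ`-submodule. -/
def S {l l' : ℕ} (U : Fin (l + 1) → LieSubmodule F (levi F m) M)
    (U' : Fin (l' + 1) → LieSubmodule F (levi F m) N) (t : ℕ) :
    LieSubmodule F (𝔤 F m) (M ⊗[F] N) where
  carrier := {u | u ∈ diag U U' t ∧ ∀ e : V F m, ⁅radIncl F m e, u⁆ = 0}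
  add_mem' := fun ⟨h1, h2⟩ ⟨h1', h2'⟩ =>
    ⟨Submodule.add_mem _ h1 h1', fun e => by rw [lie_add, h2, h2', add_zero]⟩
  zero_mem' := ⟨Submodule.zero_mem _, fun e => lie_zero _⟩
  smul_mem' := fun c _ ⟨h1, h2⟩ =>
    ⟨Submodule.smul_mem _ c h1, fun e => by rw [lie_smul, h2, smul_zero]⟩
  lie_mem := by
    rintro ⟨v, A⟩ u ⟨h1, h2⟩
    have hsplit : (⟨v, A⟩ : 𝔤 F m) =
        radIncl F m v + LieAlgebra.SemiDirectSum.inr (actDer F m) A := by simp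
    have h3 : ⁅(⟨v, A⟩ : 𝔤 F m), u⁆ = ⁅LieAlgebra.SemiDirectSum.inr (actDer F m) A, u⁆ := by
      rw [hsplit, add_lie, h2, zero_add]
    refine ⟨?_, fun e => ?_⟩
    · change ⁅(⟨v, A⟩ : 𝔤 F m), u⁆ ∈ diag U U' t
      rw [h3]; exact diag_stable U U' t A h1
    · change ⁅radIncl F m e, ⁅(⟨v, A⟩ : 𝔤 F m), u⁆⁆ = 0
      have hb : ⁅radIncl F m e, (⟨v, A⟩ : 𝔤 F m)⁆ = radIncl F m (-⁅A, e⁆) := by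
        have hx : (actDer F m A) e = ⁅A, e⁆ := rfl
        simp [V.abelian, hx]
      rw [leibniz_lie, h2, lie_zero, add_zero, hb, h2]

variable (M N) in
/-- The submodule `soc(M) ⊗ soc(N)` of `M ⊗ N`. -/
def socleTensor : LieSubmodule F (𝔤 F m) (M ⊗[F] N) :=
  (TensorProduct.LieModule.mapIncl (socle F (𝔤 F m) M) (socle F (𝔤 F m) N)).range

end

end

end GM

open GM

/-!
The proof computes in coordinates. On `V(n)` the divided-power coordinates, the coefficients of
`x ^ (n - s) / (n - s)! * y ^ s / s!`, turn the operators `u(∂_y, -∂_x)`, for `u` a suitable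
multiple of the monomial `x ^ c * y ^ (m - c)`, into the shift `s ↦ s + c` of the index. So a module
`Z(α, ℓ)` has coordinates, with a degree `i` and an index `s`, such that the coordinate `(i, s)` of
`u v` is the coordinate `(i + 1, s + c)` of `v` (`Coords.IsLowering`). For suitable coordinates on
the dual module it is the coordinate `(i + 1, s - c)` of `v`, or `0` if `s < c`
(`Coords.IsRaising`). The Casimir operator separates the degrees, and the radical maps each degree nontrivially to the preceding one. Hence the members of a
socle decomposition are the homogeneous parts, in this order (`Coords.IsGraded.eq_layer`).

The radical strictly lowers the degree, both in a module of type `Z` and in a tensor product of two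
of them. So irreducible submodules are annihilated by it (`socle_le_radInv`). Conversely, a copy of
`V(k)` annihilated by the radical is an irreducible submodule (`range_le_socle`). The socle of a
tensor product is thus the space of invariants of the radical, which is the direct sum of its
homogeneous parts. Degree `0` contributes `soc(M) ⊗ soc(N)`, decomposed by the Clebsch–Gordan rule
(`clebschGordan`). Degree `t` contributes `S_t`.

The equations saying that `u` of degree `t` is an invariant relate the coordinates of degrees
`(i + 1, j)` and `(i, j + 1)`, where `i + 1 + j = t`, to each other. They show that `u` is determined
by its component of degree `(0, t)`, and that `u = 0` if `t` exceeds one of the two lengths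
(`Coords.IsGraded.eq_zero_of_first` and `Coords.IsGraded.eq_zero_of_min_lt`). For this component they
have the following consequences, where the socles are `V(a)` and `V(b)`, and the part of degree `t`
of the second factor is `V(b_t)`.

* For `Z ⊗ Z` the coordinates depend only on the sum of the two indices. Hence they are those of one
  binary form of degree `a + b_t = a + b + m t` (`Coords.IsLowering.exists_equiv`).
* For `Z ⊗ Z^*` they depend only on the difference of the indices, and vanish unless it lies between
  `0` and `b_t - a`. This leaves a copy of `V(b_t - a)` if `a ≤ b_t`
  (`Coords.IsLowering.exists_equiv_raising`) and nothing otherwise (`Coords.IsLowering.eq_zero_of_lt`).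
* For `Z^* ⊗ Z^*` they all vanish (`Coords.IsRaising.eq_zero_of_homog`).
* The case of `Z^* ⊗ Z` is that of `Z ⊗ Z^*` with the factors interchanged (`exists_S_comm`).

The highest weights found in positive degrees differ from each other and from those in degree `0`.
So the socle is multiplicity free, and its decomposition follows from the independence of copies of
distinct `V(k)` (`socle_tensor` and `IsSumOfForms.exists_equiv`).
-/

set_option linter.unusedSectionVars false

namespace GM

noncomputable section

/-! ### Divided-power coordinates on binary forms -/

section Coefficients

variable {F : Type*} [Field F]

/-- The element `e` of `sl(2)`. -/
def sl2E (F : Type*) [Field F] : sl2 F :=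
  ⟨!![0, 1; 0, 0], LinearMap.mem_ker.2 (by simp [Matrix.trace, Fin.sum_univ_two])⟩

/-- The element `f` of `sl(2)`. -/
def sl2F (F : Type*) [Field F] : sl2 F :=
  ⟨!![0, 0; 1, 0], LinearMap.mem_ker.2 (by simp [Matrix.trace, Fin.sum_univ_two])⟩

lemma sl2_eq_combination (A : sl2 F) :
    A = A.val 0 0 • ⁅sl2E F, sl2F F⁆ + A.val 0 1 • sl2E F + A.val 1 0 • sl2F F := by
  have ht : A.val 0 0 + A.val 1 1 = 0 := by
    have := LinearMap.mem_ker.1 A.2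
    simpa [Matrix.trace, Fin.sum_univ_two] using this
  have ht' : A.val 1 1 = -A.val 0 0 := by linear_combination ht
  apply Subtype.ext
  have h : ((⁅sl2E F, sl2F F⁆ : sl2 F) : Matrix (Fin 2) (Fin 2) F) = !![1, 0; 0, -1] := by
    rw [LieAlgebra.SpecialLinear.sl_bracket]
    ext i j
    fin_cases i <;> fin_cases j <;> simp [sl2E, sl2F]
  change A.val = A.val 0 0 • ((⁅sl2E F, sl2F F⁆ : sl2 F) : Matrix (Fin 2) (Fin 2) F) +
    A.val 0 1 • (sl2E F).val + A.val 1 0 • (sl2F F).val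
  rw [h]
  ext i j
  fin_cases i <;> fin_cases j <;> simp [sl2E, sl2F, ht']

lemma der_sl2E (p : BinPoly F) :
    der (sl2E F).val p = MvPolynomial.X 0 * MvPolynomial.pderiv 1 p := by
  simp [der_eq_sum, sl2E, Fin.sum_univ_two]

lemma der_sl2F (p : BinPoly F) :
    der (sl2F F).val p = MvPolynomial.X 1 * MvPolynomial.pderiv 0 p := by
  simp [der_eq_sum, sl2F, Fin.sum_univ_two]

/-- The exponent of the monomial `x ^ i * y ^ j`. -/
def expo (i j : ℕ) : Fin 2 →₀ ℕ := Finsupp.single 0 i + Finsupp.single 1 j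

@[simp] lemma expo_zero (i j : ℕ) : expo i j 0 = i := by simp [expo]

@[simp] lemma expo_one (i j : ℕ) : expo i j 1 = j := by simp [expo]

lemma expo_eta (s : Fin 2 →₀ ℕ) : expo (s 0) (s 1) = s := by
  ext i; fin_cases i <;> simp

lemma expo_inj {i j k l : ℕ} : expo i j = expo k l ↔ i = k ∧ j = l := by
  refine ⟨fun h => ⟨?_, ?_⟩, fun h => by rw [h.1, h.2]⟩
  · simpa using DFunLike.congr_fun h 0
  · simpa using DFunLike.congr_fun h 1

/-- The coefficient of `x ^ i / i! * y ^ j / j!` in a polynomial. -/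
def dpCoeff (i j : ℕ) : BinPoly F →ₗ[F] F :=
  ((i.factorial * j.factorial : ℕ) : F) • MvPolynomial.lcoeff F (expo i j)

lemma dpCoeff_apply (i j : ℕ) (p : BinPoly F) :
    dpCoeff i j p = ((i.factorial * j.factorial : ℕ) : F) * p.coeff (expo i j) := rfl

lemma dpCoeff_pderiv_zero (i j : ℕ) (p : BinPoly F) :
    dpCoeff i j (MvPolynomial.pderiv 0 p) = dpCoeff (i + 1) j p := by
  rw [dpCoeff_apply, dpCoeff_apply, MvPolynomial.coeff_pderiv]
  have : expo i j + Finsupp.single 0 1 = expo (i + 1) j := by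
    ext k; fin_cases k <;> simp [expo]
  rw [this, expo_zero, Nat.factorial_succ]
  push_cast; ring

lemma dpCoeff_pderiv_one (i j : ℕ) (p : BinPoly F) :
    dpCoeff i j (MvPolynomial.pderiv 1 p) = dpCoeff i (j + 1) p := by
  rw [dpCoeff_apply, dpCoeff_apply, MvPolynomial.coeff_pderiv]
  have : expo i j + Finsupp.single 1 1 = expo i (j + 1) := by
    ext k; fin_cases k <;> simp [expo]
  rw [this, expo_one, Nat.factorial_succ]
  push_cast; ring

lemma dpCoeff_X_zero_mul (i j : ℕ) (p : BinPoly F) :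
    dpCoeff (i + 1) j (MvPolynomial.X 0 * p) = (i + 1 : F) * dpCoeff i j p := by
  have : expo (i + 1) j = Finsupp.single 0 1 + expo i j := by
    ext k; fin_cases k <;> simp [expo, add_comm]
  rw [dpCoeff_apply, dpCoeff_apply, this, MvPolynomial.coeff_X_mul, Nat.factorial_succ]
  push_cast; ring

lemma dpCoeff_X_one_mul (i j : ℕ) (p : BinPoly F) :
    dpCoeff i (j + 1) (MvPolynomial.X 1 * p) = (j + 1 : F) * dpCoeff i j p := by
  have : expo i (j + 1) = Finsupp.single 1 1 + expo i j := by
    ext k; fin_cases k <;> simp [expo, add_comm]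
  rw [dpCoeff_apply, dpCoeff_apply, this, MvPolynomial.coeff_X_mul, Nat.factorial_succ]
  push_cast; ring

lemma dpCoeff_zero_X_zero_mul (j : ℕ) (p : BinPoly F) :
    dpCoeff 0 j (MvPolynomial.X 0 * p) = 0 := by
  rw [dpCoeff_apply, MvPolynomial.coeff_X_mul', if_neg (by simp), mul_zero]

lemma dpCoeff_zero_X_one_mul (i : ℕ) (p : BinPoly F) :
    dpCoeff i 0 (MvPolynomial.X 1 * p) = 0 := by
  rw [dpCoeff_apply, MvPolynomial.coeff_X_mul', if_neg (by simp), mul_zero]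

/-- The `s`-th divided-power coordinate on `V(n)`: the coefficient of
`x ^ (n - s) / (n - s)! * y ^ s / s!`, and `0` for `s > n`. -/
def formCoord (n s : ℕ) : V F n →ₗ[F] F :=
  if s ≤ n then dpCoeff (n - s) s ∘ₗ V.incl F n else 0

lemma formCoord_of_le {n s : ℕ} (h : s ≤ n) (p : V F n) :
    formCoord n s p = dpCoeff (n - s) s (V.incl F n p) := by
  simp [formCoord, h]

lemma formCoord_of_lt {n s : ℕ} (h : n < s) : (formCoord n s : V F n →ₗ[F] F) = 0 := by
  simp [formCoord, h]

lemma formCoord_ext [CharZero F] {n : ℕ} {p : V F n} (h : ∀ s, formCoord n s p = 0) : p = 0 := by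
  apply V.ext
  rw [map_zero]
  ext t
  rw [MvPolynomial.coeff_zero]
  by_contra hc
  have hd : t.degree = n := by
    rw [Finsupp.degree_eq_weight_one]
    exact V.isHomogeneous p hc
  rw [Finsupp.degree_eq_sum, Fin.sum_univ_two] at hd
  have h1 := h (t 1)
  rw [formCoord_of_le (by omega), dpCoeff_apply, show n - t 1 = t 0 by omega, expo_eta,
    mul_eq_zero] at h1
  exact h1.elim (fun h => Nat.cast_ne_zero.2 (by positivity) h) hc

/-- A homogeneous polynomial of degree `n` as an element of `V(n)`. -/
def homForm {n : ℕ} (q : BinPoly F) (hq : q.IsHomogeneous n) : V F n :=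
  ⟨q, (MvPolynomial.mem_homogeneousSubmodule n q).2 hq⟩

@[simp] lemma incl_homForm {n : ℕ} (q : BinPoly F) (hq : q.IsHomogeneous n) :
    V.incl F n (homForm q hq) = q := rfl

lemma exists_formCoord [CharZero F] (n : ℕ) (x : ℕ → F) :
    ∃ p : V F n, ∀ s ≤ n, formCoord n s p = x s := by
  let q : BinPoly F := ∑ s ∈ Finset.range (n + 1), MvPolynomial.monomial (expo (n - s) s)
    (x s / (((n - s).factorial * s.factorial : ℕ) : F))
  have hq : q.IsHomogeneous n := by
    refine MvPolynomial.IsHomogeneous.sum _ _ _ fun s hs => ?_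
    refine MvPolynomial.isHomogeneous_monomial _ ?_
    rw [Finsupp.degree_eq_sum, Fin.sum_univ_two, expo_zero, expo_one]
    have := Finset.mem_range.1 hs
    omega
  refine ⟨homForm q hq, fun s hs => ?_⟩
  rw [formCoord_of_le hs, dpCoeff_apply, incl_homForm, MvPolynomial.coeff_sum,
    Finset.sum_eq_single s]
  · rw [MvPolynomial.coeff_monomial, if_pos rfl]
    exact mul_div_cancel₀ _ (Nat.cast_ne_zero.2 (by positivity))
  · intro r _ hr
    rw [MvPolynomial.coeff_monomial, if_neg]
    rw [expo_inj]
    exact fun h => hr h.2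
  · intro h
    exact absurd (Finset.mem_range.2 (by omega)) h

lemma formCoord_sl2E (n s : ℕ) (p : V F n) :
    formCoord n s ⁅sl2E F, p⁆ = (n - s : F) * formCoord n (s + 1) p := by
  rcases lt_trichotomy s n with h | rfl | h
  · obtain ⟨k, rfl⟩ := Nat.exists_eq_add_of_lt h
    rw [formCoord_of_le (by omega), formCoord_of_le (by omega), V.incl_lie, der_sl2E,
      show s + k + 1 - s = k + 1 by omega, show s + k + 1 - (s + 1) = k by omega,
      dpCoeff_X_zero_mul, dpCoeff_pderiv_one]
    push_cast; ring
  · rw [formCoord_of_le le_rfl, V.incl_lie, der_sl2E, Nat.sub_self, dpCoeff_zero_X_zero_mul]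
    simp
  · rw [formCoord_of_lt h, formCoord_of_lt (by omega)]
    simp

lemma formCoord_zero_sl2F (n : ℕ) (p : V F n) : formCoord n 0 ⁅sl2F F, p⁆ = 0 := by
  rw [formCoord_of_le (Nat.zero_le _), V.incl_lie, der_sl2F, dpCoeff_zero_X_one_mul]

lemma formCoord_succ_sl2F {n s : ℕ} (h : s + 1 ≤ n) (p : V F n) :
    formCoord n (s + 1) ⁅sl2F F, p⁆ = (s + 1 : F) * formCoord n s p := by
  rw [formCoord_of_le h, formCoord_of_le (by omega), V.incl_lie, der_sl2F, dpCoeff_X_one_mul,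
    dpCoeff_pderiv_zero, show n - (s + 1) + 1 = n - s by omega]

/-! ### A basis of the radical -/

/-- The basis vector `(-1) ^ (m - c) * x ^ c * y ^ (m - c)` of `𝔯 = V(m)`, with `c ≤ m`. The sign
is chosen so that the corresponding differential operator is `∂_x ^ (m - c) * ∂_y ^ c`. -/
def radBasis (F : Type*) [Field F] (m c : ℕ) : V F m :=
  if h : c ≤ m then homForm (MvPolynomial.monomial (expo c (m - c)) ((-1) ^ (m - c)))
    (MvPolynomial.isHomogeneous_monomial _ (by
      rw [Finsupp.degree_eq_sum, Fin.sum_univ_two, expo_zero, expo_one]; omega))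
  else 0

lemma incl_radBasis {m c : ℕ} (h : c ≤ m) : V.incl F m (radBasis F m c) =
    MvPolynomial.monomial (expo c (m - c)) ((-1) ^ (m - c)) := by
  rw [radBasis, dif_pos h, incl_homForm]

lemma dpCoeff_dOp_zero_pow (i j k : ℕ) (p : BinPoly F) :
    dpCoeff i j ((dOp 0 ^ k) p) = dpCoeff i (j + k) p := by
  induction k generalizing j with
  | zero => simp
  | succ k ih =>
    rw [pow_succ', Module.End.mul_apply]
    change dpCoeff i j (MvPolynomial.pderiv 1 _) = _
    rw [dpCoeff_pderiv_one, ih]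
    congr 2; omega

lemma dpCoeff_dOp_one_pow (i j k : ℕ) (p : BinPoly F) :
    dpCoeff i j ((dOp 1 ^ k) p) = (-1) ^ k * dpCoeff (i + k) j p := by
  induction k generalizing i with
  | zero => simp
  | succ k ih =>
    rw [pow_succ', Module.End.mul_apply]
    change dpCoeff i j (-(MvPolynomial.pderiv 0 _)) = _
    rw [map_neg, dpCoeff_pderiv_zero, ih, show i + 1 + k = i + (k + 1) by omega]
    ring

/-- In divided-power coordinates a basis vector of the radical acts on `Z(α, ℓ)` by a mere shift of
the index. -/
lemma formCoord_lower_radBasis {m a b c s : ℕ} (h : b = a + m) (hc : c ≤ m) (hs : s ≤ a)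
    (p : V F b) : formCoord a s (lower h (radBasis F m c) p) = formCoord b (s + c) p := by
  rw [formCoord_of_le hs, formCoord_of_le (by omega), incl_lower, incl_radBasis hc,
    contract_monomial, expo_zero, expo_one, LinearMap.smul_apply, Module.End.mul_apply, map_smul,
    dpCoeff_dOp_zero_pow, dpCoeff_dOp_one_pow, smul_eq_mul, ← mul_assoc, ← mul_pow,
    show a - s + (m - c) = b - (s + c) by omega]
  simp

lemma formCoord_radBasis_ne {m c s : ℕ} (hc : c ≤ m) (hs : s ≠ m - c) :
    formCoord m s (radBasis F m c) = 0 := by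
  by_cases h : s ≤ m
  · rw [formCoord_of_le h, incl_radBasis hc, dpCoeff_apply, MvPolynomial.coeff_monomial, if_neg,
      mul_zero]
    rw [expo_inj]
    omega
  · rw [formCoord_of_lt (not_le.1 h), LinearMap.zero_apply]

lemma formCoord_radBasis_self [CharZero F] {m c : ℕ} (hc : c ≤ m) :
    formCoord m (m - c) (radBasis F m c) ≠ 0 := by
  rw [formCoord_of_le (by omega), incl_radBasis hc, dpCoeff_apply, MvPolynomial.coeff_monomial,
    if_pos (by rw [expo_inj]; omega)]
  exact mul_ne_zero (Nat.cast_ne_zero.2 (by positivity)) (pow_ne_zero _ (by simp))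

lemma span_radBasis [CharZero F] (m : ℕ) :
    Submodule.span F (radBasis F m '' Set.Iic m) = ⊤ := by
  rw [eq_top_iff]
  intro p _
  have hp : p = ∑ c ∈ Finset.range (m + 1),
      (formCoord m (m - c) p / formCoord m (m - c) (radBasis F m c)) • radBasis F m c := by
    rw [← sub_eq_zero]
    apply formCoord_ext
    intro s
    rw [map_sub, map_sum, sub_eq_zero]
    by_cases hs : s ≤ m
    · rw [Finset.sum_eq_single (m - s)]
      · rw [map_smul, show m - (m - s) = s by omega, smul_eq_mul, div_mul_cancel₀]
        have := formCoord_radBasis_self (F := F) (m := m) (c := m - s) (by omega)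
        rwa [show m - (m - s) = s by omega] at this
      · intro c hc hcs
        have := Finset.mem_range.1 hc
        rw [map_smul, formCoord_radBasis_ne (s := s) (by omega) (by omega), smul_zero]
      · intro h
        exact absurd (Finset.mem_range.2 (by omega)) h
    · simp [formCoord_of_lt (not_le.1 hs)]
  rw [hp]
  refine Submodule.sum_mem _ fun c hc => Submodule.smul_mem _ _ (Submodule.subset_span ⟨c, ?_, rfl⟩)
  have := Finset.mem_range.1 hc
  exact Set.mem_Iic.2 (by omega)

end Coefficients

/-! ### Equivariance under the Levi factor and the Casimir operator -/

section Equivariance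

lemma lieModuleEquiv_map_lie {R L M N : Type*} [CommRing R] [LieRing L] [AddCommGroup M]
    [Module R M] [LieRingModule L M] [AddCommGroup N] [Module R N] [LieRingModule L N]
    (φ : M ≃ₗ⁅R, L⁆ N) (x : L) (v : M) : φ ⁅x, v⁆ = ⁅x, φ v⁆ :=
  φ.toLieModuleHom.map_lie x v

variable {F : Type*} [Field F] (m : ℕ)

/-- The inclusion of `sl(2)` into `𝔤ₘ`. -/
def leviIncl (F : Type*) [Field F] (m : ℕ) : sl2 F →ₗ⁅F⁆ 𝔤 F m :=
  LieAlgebra.SemiDirectSum.inr (actDer F m)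

variable {P : Type*} [AddCommGroup P] [Module F P] [LieRingModule (𝔤 F m) P]
  {Q : Type*} [AddCommGroup Q] [Module F Q] [LieRingModule (𝔤 F m) Q]

/-- `sl(2)`-equivariance of a linear map between `𝔤ₘ`-modules. -/
def IsSlMap (φ : P →ₗ[F] Q) : Prop :=
  ∀ (A : sl2 F) (v : P), φ ⁅leviIncl F m A, v⁆ = ⁅leviIncl F m A, φ v⁆

lemma IsSlMap.comp {R : Type*} [AddCommGroup R] [Module F R] [LieRingModule (𝔤 F m) R]
    {ψ : Q →ₗ[F] R} {φ : P →ₗ[F] Q} (hψ : IsSlMap m ψ) (hφ : IsSlMap m φ) :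
    IsSlMap m (ψ ∘ₗ φ) := fun A v => by
  rw [LinearMap.comp_apply, LinearMap.comp_apply, hφ, hψ]

lemma IsSlMap.symm {φ : P ≃ₗ[F] Q} (h : IsSlMap m (φ : P →ₗ[F] Q)) :
    IsSlMap m (φ.symm : Q →ₗ[F] P) := fun A v => by
  apply φ.injective
  have := h A (φ.symm v)
  simp only [LinearEquiv.coe_coe, LinearEquiv.apply_symm_apply] at this ⊢
  exact this.symm

variable [LieModule F (𝔤 F m) P] [LieModule F (𝔤 F m) Q]

lemma lie_leviIncl (A : sl2 F) (v : P) : ⁅leviIncl F m A, v⁆ =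
    A.val 0 0 • (⁅leviIncl F m (sl2E F), ⁅leviIncl F m (sl2F F), v⁆⁆ -
      ⁅leviIncl F m (sl2F F), ⁅leviIncl F m (sl2E F), v⁆⁆) +
    A.val 0 1 • ⁅leviIncl F m (sl2E F), v⁆ + A.val 1 0 • ⁅leviIncl F m (sl2F F), v⁆ := by
  conv_lhs => rw [sl2_eq_combination A]
  rw [map_add, map_add, map_smul, map_smul, map_smul, LieHom.map_lie, add_lie, add_lie, smul_lie,
    smul_lie, smul_lie, lie_lie]

lemma isSlMap_of_sl2E_sl2F {φ : P →ₗ[F] Q}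
    (he : ∀ v, φ ⁅leviIncl F m (sl2E F), v⁆ = ⁅leviIncl F m (sl2E F), φ v⁆)
    (hf : ∀ v, φ ⁅leviIncl F m (sl2F F), v⁆ = ⁅leviIncl F m (sl2F F), φ v⁆) :
    IsSlMap m φ := by
  intro A v
  rw [lie_leviIncl m A v, lie_leviIncl m A (φ v)]
  simp only [map_add, map_sub, map_smul, he, hf]

variable (F P) in
/-- The Casimir operator `4 f e + h ^ 2 + 2 h` of `sl(2)`, where `h = e f - f e`. It acts on `V(n)`
as the scalar `n (n + 2)`. -/
def casimir : Module.End F P :=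
  let e : Module.End F P := LieModule.toEnd F (𝔤 F m) P (leviIncl F m (sl2E F))
  let f : Module.End F P := LieModule.toEnd F (𝔤 F m) P (leviIncl F m (sl2F F))
  (4 : F) • (f * e) + (e * f - f * e) * (e * f - f * e) + (2 : F) • (e * f - f * e)

lemma IsSlMap.casimir {φ : P →ₗ[F] Q} (h : IsSlMap m φ) (v : P) :
    φ (casimir F m P v) = GM.casimir F m Q (φ v) := by
  simp [GM.casimir, h _ _]

end Equivariance

/-! ### Coordinate systems adapted to the two kinds of modules -/

/-- A system of linear coordinates `coord i s`, for `i ≤ L` and `s ≤ n i`, on a vector space. The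
first index is the degree in a grading by spaces of dimension `n i + 1`. Outside this range the
coordinate is `0`. -/
structure Coords (F : Type*) [Field F] (M : Type*) [AddCommGroup M] [Module F M]
    (L : ℕ) (n : ℕ → ℕ) where
  coord : ℕ → ℕ → M →ₗ[F] F
  coord_eq_zero : ∀ i s, L < i ∨ n i < s → coord i s = 0
  ext : ∀ v, (∀ i s, coord i s v = 0) → v = 0
  exists_coord : ∀ x : ℕ → ℕ → F, ∃ v, ∀ i ≤ L, ∀ s ≤ n i, coord i s v = x i s

namespace Coords

variable {F : Type*} [Field F] {m : ℕ} {M : Type*} [AddCommGroup M] [Module F M]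
  {L : ℕ} {n : ℕ → ℕ}

lemma ext_of_le (κ : Coords F M L n) {v w : M}
    (h : ∀ i ≤ L, ∀ s ≤ n i, κ.coord i s v = κ.coord i s w) : v = w := by
  rw [← sub_eq_zero]
  apply κ.ext
  intro i s
  by_cases hi : L < i ∨ n i < s
  · rw [κ.coord_eq_zero i s hi, LinearMap.zero_apply]
  · push Not at hi
    rw [map_sub, h i hi.1 s hi.2, sub_self]

/-- The linear equivalence with a space of functions on a finite set. -/
def equivFun (κ : Coords F M L n) : M ≃ₗ[F] ((Σ i : Fin (L + 1), Fin (n i + 1)) → F) :=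
  LinearEquiv.ofBijective (LinearMap.pi fun x => κ.coord x.1 x.2) <| by
    refine ⟨fun v w h => ?_, fun x => ?_⟩
    · refine κ.ext_of_le fun i hi s hs => ?_
      exact congrFun h ⟨⟨i, Nat.lt_succ_of_le hi⟩, ⟨s, Nat.lt_succ_of_le hs⟩⟩
    · obtain ⟨v, hv⟩ := κ.exists_coord fun i s =>
        if h : i < L + 1 then if h' : s < n i + 1 then x ⟨⟨i, h⟩, ⟨s, h'⟩⟩ else 0 else 0
      refine ⟨v, funext fun y => ?_⟩
      rw [LinearMap.pi_apply, hv _ (Nat.le_of_lt_succ y.1.2) _ (Nat.le_of_lt_succ y.2.2),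
        dif_pos y.1.2, dif_pos y.2.2]

/-- The basis dual to the coordinates. -/
def basis (κ : Coords F M L n) : Module.Basis (Σ i : Fin (L + 1), Fin (n i + 1)) F M :=
  Module.Basis.ofEquivFun κ.equivFun

lemma basis_repr (κ : Coords F M L n) (v : M) (x : Σ i : Fin (L + 1), Fin (n i + 1)) :
    κ.basis.repr v x = κ.coord x.1 x.2 v := rfl

lemma exists_linearMap {P : Type*} [AddCommGroup P] [Module F P] (κ : Coords F M L n)
    (g : ℕ → ℕ → P →ₗ[F] F) :
    ∃ Φ : P →ₗ[F] M, ∀ i ≤ L, ∀ s ≤ n i, ∀ u, κ.coord i s (Φ u) = g i s u := by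
  refine ⟨κ.equivFun.symm ∘ₗ
    LinearMap.pi fun x : (Σ i : Fin (L + 1), Fin (n i + 1)) => g x.1 x.2, fun i hi s hs u => ?_⟩
  exact congrFun (κ.equivFun.apply_symm_apply
    (LinearMap.pi (fun x : (Σ i : Fin (L + 1), Fin (n i + 1)) => g x.1 x.2) u))
    ⟨⟨i, Nat.lt_succ_of_le hi⟩, ⟨s, Nat.lt_succ_of_le hs⟩⟩

/-- The dual basis indexed by pairs of natural numbers, with the value `0` out of range. -/
def vec (κ : Coords F M L n) (i s : ℕ) : M :=
  if h : i < L + 1 then if h' : s < n i + 1 then κ.basis ⟨⟨i, h⟩, ⟨s, h'⟩⟩ else 0 else 0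

lemma vec_eq_basis (κ : Coords F M L n) (x : Σ i : Fin (L + 1), Fin (n i + 1)) :
    κ.vec x.1 x.2 = κ.basis x := by
  rw [vec, dif_pos x.1.2, dif_pos x.2.2]

lemma vec_eq_zero (κ : Coords F M L n) {i s : ℕ} (h : L < i ∨ n i < s) : κ.vec i s = 0 := by
  unfold vec
  split_ifs
  · omega
  all_goals rfl

lemma coord_vec (κ : Coords F M L n) {i s : ℕ} (hi : i ≤ L) (hs : s ≤ n i) (k r : ℕ) :
    κ.coord k r (κ.vec i s) = if k = i ∧ r = s then 1 else 0 := by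
  by_cases h : L < k ∨ n k < r
  · rw [κ.coord_eq_zero k r h, if_neg, LinearMap.zero_apply]
    rintro ⟨rfl, rfl⟩
    omega
  · push Not at h
    have := κ.basis_repr (κ.vec i s)
      ⟨⟨k, Nat.lt_succ_of_le h.1⟩, ⟨r, Nat.lt_succ_of_le h.2⟩⟩
    rw [← this, vec, dif_pos (Nat.lt_succ_of_le hi), dif_pos (Nat.lt_succ_of_le hs),
      Module.Basis.repr_self, Finsupp.single_apply]
    refine if_congr ?_ rfl rfl
    constructor
    · intro h'
      have h1 := congrArg (fun z : (Σ i : Fin (L + 1), Fin (n i + 1)) => ((z.1 : ℕ), (z.2 : ℕ))) h'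
      simp only [Prod.mk.injEq] at h1
      exact ⟨h1.1.symm, h1.2.symm⟩
    · rintro ⟨rfl, rfl⟩
      rfl

variable [LieRingModule (𝔤 F m) M]

variable (m) in
/-- The behaviour of the divided-power coordinates of `Z(α, L)`: the vector `radBasis F m c` of the
radical shifts the second index by `c`. -/
structure IsLowering (κ : Coords F M L n) : Prop where
  step : ∀ i < L, n (i + 1) = n i + m
  lie_e : ∀ i s v, κ.coord i s ⁅leviIncl F m (sl2E F), v⁆ = (n i - s : F) * κ.coord i (s + 1) v
  lie_f_zero : ∀ i v, κ.coord i 0 ⁅leviIncl F m (sl2F F), v⁆ = 0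
  lie_f_succ : ∀ i s v, s + 1 ≤ n i →
    κ.coord i (s + 1) ⁅leviIncl F m (sl2F F), v⁆ = (s + 1 : F) * κ.coord i s v
  lie_rad : ∀ i s c v, s ≤ n i → c ≤ m →
    κ.coord i s ⁅radIncl F m (radBasis F m c), v⁆ = κ.coord (i + 1) (s + c) v

variable (m) in
/-- The behaviour of the coordinates of `Z(α, L)^*` dual to divided powers (up to the sign `-1` in
every other degree): the vector `radBasis F m c` of the radical shifts the second index by `-c`. -/
structure IsRaising (κ : Coords F M L n) : Prop where
  step : ∀ i < L, n i = n (i + 1) + m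
  lie_e_zero : ∀ i v, κ.coord i 0 ⁅leviIncl F m (sl2E F), v⁆ = 0
  lie_e_succ : ∀ i s v,
    κ.coord i (s + 1) ⁅leviIncl F m (sl2E F), v⁆ = -(n i - s : F) * κ.coord i s v
  lie_f : ∀ i s v, κ.coord i s ⁅leviIncl F m (sl2F F), v⁆ = -(s + 1 : F) * κ.coord i (s + 1) v
  lie_rad : ∀ i s c v, c ≤ m → κ.coord i (s + c) ⁅radIncl F m (radBasis F m c), v⁆ =
    κ.coord (i + 1) s v
  lie_rad_of_lt : ∀ i s c v, s < c → c ≤ m →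
    κ.coord i s ⁅radIncl F m (radBasis F m c), v⁆ = 0

lemma IsLowering.weight_eq {κ : Coords F M L n} (hκ : κ.IsLowering m) {i : ℕ} (hi : i ≤ L) :
    n i = n 0 + i * m := by
  induction i with
  | zero => simp
  | succ i ih => rw [hκ.step i hi, ih (by omega)]; ring

lemma IsRaising.weight_add {κ : Coords F M L n} (hκ : κ.IsRaising m) {i : ℕ} (hi : i ≤ L) :
    n i + i * m = n 0 := by
  induction i with
  | zero => simp
  | succ i ih => rw [← ih (by omega), hκ.step i hi]; ring

lemma IsLowering.lie_f {κ : Coords F M L n} (hκ : κ.IsLowering m) {i s : ℕ} (hs : s ≤ n i)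
    (v : M) : κ.coord i s ⁅leviIncl F m (sl2F F), v⁆ = (s : F) * κ.coord i (s - 1) v := by
  rcases s with _ | s
  · rw [hκ.lie_f_zero]; simp
  · rw [hκ.lie_f_succ _ _ _ hs]; simp

/-- Transport of coordinates along a linear equivalence. -/
def comap {N : Type*} [AddCommGroup N] [Module F N] (κ : Coords F M L n) (φ : N ≃ₗ[F] M) :
    Coords F N L n where
  coord i s := κ.coord i s ∘ₗ φ
  coord_eq_zero i s h := by rw [κ.coord_eq_zero i s h, LinearMap.zero_comp]
  ext v h := φ.map_eq_zero_iff.1 (κ.ext _ h)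
  exists_coord x := by
    obtain ⟨v, hv⟩ := κ.exists_coord x
    exact ⟨φ.symm v, fun i hi s hs => by simp [hv i hi s hs]⟩

section Comap

variable {N : Type*} [AddCommGroup N] [Module F N] [LieRingModule (𝔤 F m) N]
  {κ : Coords F M L n}

lemma IsLowering.comap (hκ : κ.IsLowering m) (φ : N ≃ₗ⁅F, 𝔤 F m⁆ M) :
    (κ.comap φ.toLinearEquiv).IsLowering m where
  step := hκ.step
  lie_e i s v := by
    change κ.coord i s (φ _) = _ * κ.coord i _ (φ v)
    rw [lieModuleEquiv_map_lie, hκ.lie_e]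
  lie_f_zero i v := by
    change κ.coord i 0 (φ _) = _
    rw [lieModuleEquiv_map_lie, hκ.lie_f_zero]
  lie_f_succ i s v h := by
    change κ.coord i _ (φ _) = _ * κ.coord i _ (φ v)
    rw [lieModuleEquiv_map_lie, hκ.lie_f_succ _ _ _ h]
  lie_rad i s c v h h' := by
    change κ.coord i _ (φ _) = κ.coord (i + 1) _ (φ v)
    rw [lieModuleEquiv_map_lie, hκ.lie_rad _ _ _ _ h h']

lemma IsRaising.comap (hκ : κ.IsRaising m) (φ : N ≃ₗ⁅F, 𝔤 F m⁆ M) :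
    (κ.comap φ.toLinearEquiv).IsRaising m where
  step := hκ.step
  lie_e_zero i v := by
    change κ.coord i 0 (φ _) = _
    rw [lieModuleEquiv_map_lie, hκ.lie_e_zero]
  lie_e_succ i s v := by
    change κ.coord i _ (φ _) = _ * κ.coord i _ (φ v)
    rw [lieModuleEquiv_map_lie, hκ.lie_e_succ]
  lie_f i s v := by
    change κ.coord i s (φ _) = _ * κ.coord i _ (φ v)
    rw [lieModuleEquiv_map_lie, hκ.lie_f]
  lie_rad i s c v h := by
    change κ.coord i _ (φ _) = κ.coord (i + 1) _ (φ v)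
    rw [lieModuleEquiv_map_lie, hκ.lie_rad _ _ _ _ h]
  lie_rad_of_lt i s c v h h' := by
    change κ.coord i _ (φ _) = _
    rw [lieModuleEquiv_map_lie, hκ.lie_rad_of_lt _ _ _ _ h h']

end Comap

variable (m) in
/-- What coordinates of the two kinds have in common: the degrees are distinguished by the weights
`n i`, and hence by the Casimir operator, and the coordinates of degree `i + 1` are exactly the
compositions of those of degree `i` with the basis vectors of the radical. -/
structure IsGraded [LieModule F (𝔤 F m) M] (κ : Coords F M L n) : Prop where
  inj : ∀ i ≤ L, ∀ j ≤ L, n i = n j → i = j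
  casimir : ∀ i s v, κ.coord i s (casimir F m M v) = (n i * (n i + 2) : F) * κ.coord i s v
  lie_rad : ∀ i s c, c ≤ m → ∃ r, ∀ v,
    κ.coord i s ⁅radIncl F m (radBasis F m c), v⁆ = κ.coord (i + 1) r v
  exists_lie_rad : ∀ i r, ∃ c ≤ m, ∃ s, ∀ v,
    κ.coord i s ⁅radIncl F m (radBasis F m c), v⁆ = κ.coord (i + 1) r v

variable [LieModule F (𝔤 F m) M] {κ : Coords F M L n}

lemma IsLowering.isGraded (hκ : κ.IsLowering m) (hm : 1 ≤ m) : κ.IsGraded m where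
  inj := by
    intro i hi j hj h
    rw [hκ.weight_eq hi, hκ.weight_eq hj] at h
    exact Nat.eq_of_mul_eq_mul_right hm (by omega)
  casimir := by
    have hfe : ∀ i s v, s ≤ n i →
        κ.coord i s ⁅leviIncl F m (sl2F F), ⁅leviIncl F m (sl2E F), v⁆⁆ =
          (s * (n i - s + 1) : F) * κ.coord i s v := by
      intro i s v h
      rcases s with _ | s
      · simp [hκ.lie_f_zero]
      · rw [hκ.lie_f_succ _ _ _ h, hκ.lie_e]
        push_cast; ring
    have hef : ∀ i s v, s ≤ n i →
        κ.coord i s ⁅leviIncl F m (sl2E F), ⁅leviIncl F m (sl2F F), v⁆⁆ =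
          ((s + 1) * (n i - s) : F) * κ.coord i s v := by
      intro i s v h
      rw [hκ.lie_e]
      rcases h.eq_or_lt with rfl | h
      · simp
      · rw [hκ.lie_f_succ _ _ _ h]
        ring
    intro i s v
    rcases le_or_gt s (n i) with h | h
    · simp only [GM.casimir, LinearMap.add_apply, LinearMap.smul_apply, Module.End.mul_apply,
        LinearMap.sub_apply, LieModule.toEnd_apply_apply, map_add, map_sub, map_smul, smul_eq_mul,
        hfe _ _ _ h, hef _ _ _ h]
      ring
    · simp [κ.coord_eq_zero i s (Or.inr h)]
  lie_rad := by
    intro i s c hc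
    rcases le_or_gt s (n i) with h | h
    · exact ⟨s + c, fun v => hκ.lie_rad i s c v h hc⟩
    · refine ⟨n (i + 1) + 1, fun v => ?_⟩
      rw [κ.coord_eq_zero i s (Or.inr h), κ.coord_eq_zero (i + 1) _ (Or.inr (by omega))]
      rfl
  exists_lie_rad := by
    intro i r
    by_cases h : L < i + 1 ∨ n (i + 1) < r
    · refine ⟨0, Nat.zero_le _, n i + 1, fun v => ?_⟩
      rw [κ.coord_eq_zero i _ (Or.inr (Nat.lt_succ_self _)), κ.coord_eq_zero _ _ h]
      rfl
    · push Not at h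
      have h1 := hκ.step i (by omega)
      refine ⟨r - min r (n i), by omega, min r (n i), fun v => ?_⟩
      rw [hκ.lie_rad _ _ _ _ (by omega) (by omega)]
      congr 2; omega

lemma IsRaising.isGraded (hκ : κ.IsRaising m) (hm : 1 ≤ m) : κ.IsGraded m where
  inj := by
    intro i hi j hj h
    have h1 := hκ.weight_add hi
    have h2 := hκ.weight_add hj
    exact Nat.eq_of_mul_eq_mul_right hm (by omega)
  casimir := by
    have hfe : ∀ i s v,
        κ.coord i s ⁅leviIncl F m (sl2F F), ⁅leviIncl F m (sl2E F), v⁆⁆ =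
          ((s + 1) * (n i - s) : F) * κ.coord i s v := by
      intro i s v
      rw [hκ.lie_f, hκ.lie_e_succ]
      ring
    have hef : ∀ i s v,
        κ.coord i s ⁅leviIncl F m (sl2E F), ⁅leviIncl F m (sl2F F), v⁆⁆ =
          (s * (n i - s + 1) : F) * κ.coord i s v := by
      intro i s v
      rcases s with _ | s
      · simp [hκ.lie_e_zero]
      · rw [hκ.lie_e_succ, hκ.lie_f]
        push_cast; ring
    intro i s v
    simp only [GM.casimir, LinearMap.add_apply, LinearMap.smul_apply, Module.End.mul_apply,
      LinearMap.sub_apply, LieModule.toEnd_apply_apply, map_add, map_sub, map_smul, smul_eq_mul,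
      hfe, hef]
    ring
  lie_rad := by
    intro i s c hc
    rcases le_or_gt c s with h | h
    · obtain ⟨k, rfl⟩ := Nat.exists_eq_add_of_le' h
      exact ⟨k, fun v => hκ.lie_rad i k c v hc⟩
    · refine ⟨n (i + 1) + 1, fun v => ?_⟩
      rw [hκ.lie_rad_of_lt i s c v h hc, κ.coord_eq_zero (i + 1) _ (Or.inr (by omega))]
      rfl
  exists_lie_rad := fun i r => ⟨0, Nat.zero_le _, r, fun v => hκ.lie_rad i r 0 v (Nat.zero_le _)⟩

end Coords

/-! ### Coordinates on `V(n)`, on `Z(α, ℓ)` and on duals -/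

namespace Coords

section Dual

variable {F : Type*} [Field F] {m : ℕ} {M : Type*} [AddCommGroup M] [Module F M]
  {L : ℕ} {n : ℕ → ℕ}

/-- The variant of `Coords.coord_vec` which also covers the vanishing vectors. -/
lemma coord_vec' (κ : Coords F M L n) (i s k r : ℕ) :
    κ.coord k r (κ.vec i s) = if k = i ∧ r = s ∧ i ≤ L ∧ s ≤ n i then 1 else 0 := by
  by_cases h : L < i ∨ n i < s
  · rw [κ.vec_eq_zero h, map_zero, if_neg]
    omega
  · push Not at h
    rw [κ.coord_vec h.1 h.2]
    exact if_congr ⟨fun h' => ⟨h'.1, h'.2, h⟩, fun h' => ⟨h'.1, h'.2.1⟩⟩ rfl rfl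

/-- Coordinates on the dual space: the degrees are reversed, and the coordinates are the values on
the dual basis. The sign `(-1) ^ j` absorbs the one in `⁅x, ξ⁆ v = -ξ ⁅x, v⁆` for `x` in the
radical. -/
def dual (κ : Coords F M L n) : Coords F (Module.Dual F M) L (fun j => n (L - j)) where
  coord j s := if j ≤ L then (-1 : F) ^ j • Module.Dual.eval F M (κ.vec (L - j) s) else 0
  coord_eq_zero j s h := by
    split_ifs with hj
    · rw [κ.vec_eq_zero (by omega), map_zero, smul_zero]
    · rfl
  ext ξ h := by
    refine κ.basis.ext fun x => ?_
    have h1 := h (L - x.1) x.2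
    rw [if_pos (Nat.sub_le _ _), LinearMap.smul_apply, Module.Dual.eval_apply,
      Nat.sub_sub_self (Nat.le_of_lt_succ x.1.2), κ.vec_eq_basis, smul_eq_zero] at h1
    rw [LinearMap.zero_apply]
    exact h1.resolve_left (pow_ne_zero _ (by simp))
  exists_coord x := by
    refine ⟨κ.basis.constr F fun y => (-1) ^ (L - y.1) * x (L - y.1) y.2, fun i hi s hs => ?_⟩
    rw [if_pos hi, LinearMap.smul_apply, Module.Dual.eval_apply,
      κ.vec_eq_basis ⟨⟨L - i, Nat.lt_succ_of_le (Nat.sub_le L i)⟩, ⟨s, Nat.lt_succ_of_le hs⟩⟩,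
      Module.Basis.constr_basis]
    simp only [Nat.sub_sub_self hi, smul_eq_mul, ← mul_assoc, ← mul_pow]
    simp

variable [LieRingModule (𝔤 F m) M] [LieModule F (𝔤 F m) M] {κ : Coords F M L n}

lemma IsLowering.lie_e_vec_zero (hκ : κ.IsLowering m) (i : ℕ) :
    ⁅leviIncl F m (sl2E F), κ.vec i 0⁆ = 0 := by
  refine κ.ext_of_le fun k _ r _ => ?_
  rw [hκ.lie_e, coord_vec', if_neg (by omega), mul_zero, map_zero]

lemma IsLowering.lie_e_vec_succ (hκ : κ.IsLowering m) (i s : ℕ) :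
    ⁅leviIncl F m (sl2E F), κ.vec i (s + 1)⁆ = (n i - s : F) • κ.vec i s := by
  refine κ.ext_of_le fun k hk r hr => ?_
  rw [hκ.lie_e, map_smul, coord_vec', coord_vec', smul_eq_mul]
  by_cases h : k = i ∧ r = s
  · obtain ⟨rfl, rfl⟩ := h
    rcases hr.lt_or_eq with h | h
    · rw [if_pos (by omega), if_pos (by omega)]
    · rw [h]; ring
  · rw [if_neg (by omega), if_neg (by omega), mul_zero, mul_zero]

lemma IsLowering.lie_f_vec (hκ : κ.IsLowering m) (i s : ℕ) :
    ⁅leviIncl F m (sl2F F), κ.vec i s⁆ = (s + 1 : F) • κ.vec i (s + 1) := by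
  refine κ.ext_of_le fun k hk r hr => ?_
  rw [map_smul, coord_vec', smul_eq_mul]
  rcases r with _ | r
  · rw [hκ.lie_f_zero, if_neg (by omega), mul_zero]
  · rw [hκ.lie_f_succ _ _ _ hr, coord_vec']
    by_cases h : k = i ∧ r = s
    · obtain ⟨rfl, rfl⟩ := h
      rw [if_pos (by omega), if_pos (by omega)]
    · rw [if_neg (by omega), if_neg (by omega), mul_zero, mul_zero]

lemma IsLowering.lie_rad_vec (hκ : κ.IsLowering m) {i s c : ℕ} (hc : c ≤ m) (hi : i < L) :
    ⁅radIncl F m (radBasis F m c), κ.vec (i + 1) (s + c)⁆ = κ.vec i s := by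
  refine κ.ext_of_le fun k hk r hr => ?_
  have := hκ.step i hi
  rw [hκ.lie_rad _ _ _ _ hr hc, coord_vec', coord_vec']
  by_cases h : k = i ∧ r = s
  · obtain ⟨rfl, rfl⟩ := h
    rw [if_pos (by omega), if_pos (by omega)]
  · rw [if_neg (by omega), if_neg (by omega)]

lemma IsLowering.lie_rad_vec_eq_zero (hκ : κ.IsLowering m) {i s c : ℕ} (hc : c ≤ m)
    (h : i = 0 ∨ s < c) : ⁅radIncl F m (radBasis F m c), κ.vec i s⁆ = 0 := by
  refine κ.ext_of_le fun k hk r hr => ?_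
  rw [hκ.lie_rad _ _ _ _ hr hc, coord_vec', if_neg (by omega), map_zero]

lemma dual_coord (κ : Coords F M L n) {j : ℕ} (hj : j ≤ L) (s : ℕ) (ξ : Module.Dual F M) :
    κ.dual.coord j s ξ = (-1) ^ j * ξ (κ.vec (L - j) s) := by
  change (if j ≤ L then _ else _ : Module.Dual F M →ₗ[F] F) ξ = _
  rw [if_pos hj]
  rfl

lemma dual_coord_of_lt (κ : Coords F M L n) {j : ℕ} (hj : L < j) (s : ℕ) (ξ : Module.Dual F M) :
    κ.dual.coord j s ξ = 0 := by
  rw [κ.dual.coord_eq_zero j s (Or.inl hj), LinearMap.zero_apply]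

lemma lie_dual_apply (x : 𝔤 F m) (ξ : Module.Dual F M) (v : M) : ⁅x, ξ⁆ v = -ξ ⁅x, v⁆ := by
  simp [Module.Dual.lie_apply]

lemma IsLowering.dual (hκ : κ.IsLowering m) : κ.dual.IsRaising m where
  step i hi := by
    have := hκ.step (L - (i + 1)) (by omega)
    rwa [show L - (i + 1) + 1 = L - i by omega] at this
  lie_e_zero i ξ := by
    rcases le_or_gt i L with hi | hi
    · rw [dual_coord κ hi, lie_dual_apply, hκ.lie_e_vec_zero]
      simp
    · rw [dual_coord_of_lt κ hi]
  lie_e_succ i s ξ := by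
    rcases le_or_gt i L with hi | hi
    · rw [dual_coord κ hi, dual_coord κ hi, lie_dual_apply, hκ.lie_e_vec_succ, map_smul,
        smul_eq_mul]
      ring
    · rw [dual_coord_of_lt κ hi, dual_coord_of_lt κ hi, mul_zero]
  lie_f i s ξ := by
    rcases le_or_gt i L with hi | hi
    · rw [dual_coord κ hi, dual_coord κ hi, lie_dual_apply, hκ.lie_f_vec, map_smul, smul_eq_mul]
      ring
    · rw [dual_coord_of_lt κ hi, dual_coord_of_lt κ hi, mul_zero]
  lie_rad i s c ξ hc := by
    rcases lt_trichotomy i L with hi | rfl | hi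
    · rw [dual_coord κ hi.le, dual_coord κ hi, lie_dual_apply,
        show L - i = L - (i + 1) + 1 by omega, hκ.lie_rad_vec hc (by omega), pow_succ]
      ring
    · rw [dual_coord κ le_rfl, dual_coord_of_lt κ (Nat.lt_succ_self _), lie_dual_apply,
        hκ.lie_rad_vec_eq_zero hc (Or.inl (Nat.sub_self _))]
      simp
    · rw [dual_coord_of_lt κ hi, dual_coord_of_lt κ (by omega)]
  lie_rad_of_lt i s c ξ h hc := by
    rcases le_or_gt i L with hi | hi
    · rw [dual_coord κ hi, lie_dual_apply, hκ.lie_rad_vec_eq_zero hc (Or.inr h)]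
      simp
    · rw [dual_coord_of_lt κ hi]

end Dual

section Forms

variable {F : Type*} [Field F] [CharZero F] (m : ℕ)

lemma lie_leviIncl_form {n : ℕ} (A : sl2 F) (p : V F n) : ⁅leviIncl F m A, p⁆ = ⁅A, p⁆ := rfl

lemma lie_radIncl_form {n : ℕ} (u : V F m) (p : V F n) : ⁅radIncl F m u, p⁆ = 0 :=
  zero_lie (L := sl2 F) p

/-- The divided-power coordinates on `V(n)`. -/
def form (F : Type*) [Field F] [CharZero F] (n : ℕ) : Coords F (V F n) 0 (fun _ => n) where
  coord i s := if i = 0 then formCoord n s else 0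
  coord_eq_zero i s h := by
    split_ifs with hi
    · exact formCoord_of_lt (by omega)
    · rfl
  ext v h := formCoord_ext fun s => by simpa using h 0 s
  exists_coord x := by
    obtain ⟨p, hp⟩ := exists_formCoord n (x 0)
    refine ⟨p, fun i hi s hs => ?_⟩
    obtain rfl := Nat.le_zero.1 hi
    simpa using hp s hs

lemma form_isLowering (n : ℕ) : (form F n).IsLowering m where
  step i hi := absurd hi (Nat.not_lt_zero i)
  lie_e i s v := by
    change (if i = 0 then _ else _ : V F n →ₗ[F] F) _ =
      _ * (if i = 0 then _ else _ : V F n →ₗ[F] F) _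
    split_ifs
    · exact formCoord_sl2E n s v
    · simp
  lie_f_zero i v := by
    change (if i = 0 then _ else _ : V F n →ₗ[F] F) _ = _
    split_ifs
    · exact formCoord_zero_sl2F n v
    · simp
  lie_f_succ i s v h := by
    change (if i = 0 then _ else _ : V F n →ₗ[F] F) _ =
      _ * (if i = 0 then _ else _ : V F n →ₗ[F] F) _
    split_ifs
    · exact formCoord_succ_sl2F h v
    · simp
  lie_rad i s c v _ _ := by
    rw [lie_radIncl_form, map_zero, (form F n).coord_eq_zero _ _ (Or.inl (Nat.succ_pos i))]
    rfl

/-- The coefficients of the monomials, with signs and in the order opposite to `Coords.form`. -/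
def formDual (F : Type*) [Field F] [CharZero F] (n : ℕ) : Coords F (V F n) 0 (fun _ => n) where
  coord i s := if i = 0 ∧ s ≤ n then
    ((-1 : F) ^ s / ((s.factorial * (n - s).factorial : ℕ) : F)) • formCoord n (n - s) else 0
  coord_eq_zero i s h := if_neg (by omega)
  ext v h := formCoord_ext fun s => by
    rcases le_or_gt s n with hs | hs
    · have := h 0 (n - s)
      rw [if_pos (by omega), Nat.sub_sub_self hs, LinearMap.smul_apply, smul_eq_zero] at this
      exact this.resolve_left (div_ne_zero (pow_ne_zero _ (by simp))
        (Nat.cast_ne_zero.2 (by positivity)))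
    · rw [formCoord_of_lt hs, LinearMap.zero_apply]
  exists_coord x := by
    obtain ⟨p, hp⟩ := exists_formCoord n fun s =>
      ((-1 : F) ^ (n - s) / (((n - s).factorial * s.factorial : ℕ) : F))⁻¹ * x 0 (n - s)
    refine ⟨p, fun i hi s hs => ?_⟩
    obtain rfl := Nat.le_zero.1 hi
    rw [if_pos ⟨rfl, hs⟩, LinearMap.smul_apply, hp _ (Nat.sub_le _ _), Nat.sub_sub_self hs,
      smul_eq_mul, mul_inv_cancel_left₀]
    exact div_ne_zero (pow_ne_zero _ (by simp)) (Nat.cast_ne_zero.2 (by positivity))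

lemma formDual_coord {n s : ℕ} (hs : s ≤ n) (p : V F n) : (formDual F n).coord 0 s p =
    (-1 : F) ^ s / ((s.factorial * (n - s).factorial : ℕ) : F) * formCoord n (n - s) p := by
  simp [formDual, hs]

lemma formDual_isRaising (n : ℕ) : (formDual F n).IsRaising m where
  step i hi := absurd hi (Nat.not_lt_zero i)
  lie_e_zero i v := by
    rcases Nat.eq_zero_or_pos i with rfl | hi
    · rw [formDual_coord (Nat.zero_le n), lie_leviIncl_form, formCoord_sl2E]
      simp
    · rw [(formDual F n).coord_eq_zero _ _ (Or.inl hi)]; rfl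
  lie_e_succ i s v := by
    rcases Nat.eq_zero_or_pos i with rfl | hi
    · rcases lt_trichotomy s n with hs | rfl | hs
      · obtain ⟨k, rfl⟩ := Nat.exists_eq_add_of_lt hs
        rw [formDual_coord (by omega), formDual_coord (by omega), lie_leviIncl_form,
          formCoord_sl2E, show s + k + 1 - (s + 1) = k by omega,
          show s + k + 1 - s = k + 1 by omega, Nat.factorial_succ, Nat.factorial_succ]
        have h1 : (s.factorial : F) ≠ 0 := Nat.cast_ne_zero.2 (by positivity)
        have h2 : (k.factorial : F) ≠ 0 := Nat.cast_ne_zero.2 (by positivity)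
        have h3 : (s + 1 : F) ≠ 0 := by exact_mod_cast Nat.succ_ne_zero s
        have h4 : (k + 1 : F) ≠ 0 := by exact_mod_cast Nat.succ_ne_zero k
        push_cast
        field_simp
        ring
      · rw [(formDual F s).coord_eq_zero _ _ (Or.inr (Nat.lt_succ_self s))]
        simp
      · rw [(formDual F n).coord_eq_zero _ _ (Or.inr hs),
          (formDual F n).coord_eq_zero _ _ (Or.inr (by omega))]
        simp
    · rw [(formDual F n).coord_eq_zero _ _ (Or.inl hi),
        (formDual F n).coord_eq_zero _ _ (Or.inl hi)]
      simp
  lie_f i s v := by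
    rcases Nat.eq_zero_or_pos i with rfl | hi
    · rcases lt_trichotomy s n with hs | rfl | hs
      · obtain ⟨k, rfl⟩ := Nat.exists_eq_add_of_lt hs
        rw [formDual_coord (by omega), formDual_coord (by omega), lie_leviIncl_form,
          show s + k + 1 - (s + 1) = k by omega,
          show s + k + 1 - s = k + 1 by omega, formCoord_succ_sl2F (by omega),
          Nat.factorial_succ, Nat.factorial_succ]
        have h1 : (s.factorial : F) ≠ 0 := Nat.cast_ne_zero.2 (by positivity)
        have h2 : (k.factorial : F) ≠ 0 := Nat.cast_ne_zero.2 (by positivity)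
        have h3 : (s + 1 : F) ≠ 0 := by exact_mod_cast Nat.succ_ne_zero s
        have h4 : (k + 1 : F) ≠ 0 := by exact_mod_cast Nat.succ_ne_zero k
        push_cast
        field_simp
        ring
      · rw [(formDual F s).coord_eq_zero 0 (s + 1) (Or.inr (Nat.lt_succ_self s)),
          formDual_coord le_rfl, lie_leviIncl_form, Nat.sub_self, formCoord_zero_sl2F]
        simp
      · rw [(formDual F n).coord_eq_zero _ _ (Or.inr hs),
          (formDual F n).coord_eq_zero _ _ (Or.inr (by omega))]
        simp
    · rw [(formDual F n).coord_eq_zero _ _ (Or.inl hi),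
        (formDual F n).coord_eq_zero _ _ (Or.inl hi)]
      simp
  lie_rad i s c v _ := by
    rw [lie_radIncl_form, map_zero, (formDual F n).coord_eq_zero _ _ (Or.inl (Nat.succ_pos i))]
    rfl
  lie_rad_of_lt i s c v _ _ := by
    rw [lie_radIncl_form, map_zero]

end Forms

section TypeZ

variable {F : Type*} [Field F] [CharZero F] {m α l : ℕ}

/-- The component `V(α + i m)` of `Z(α, ℓ)` as a linear projection. -/
def zProj (i : Fin (l + 1)) : Z F m α l →ₗ[F] V F (α + i * m) where
  toFun z := z i
  map_add' _ _ := rfl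
  map_smul' _ _ := rfl

/-- The divided-power coordinates on all the summands of `Z(α, ℓ)`. -/
def typeZ (F : Type*) [Field F] [CharZero F] (m α l : ℕ) :
    Coords F (Z F m α l) l (fun i => α + i * m) where
  coord i s := if h : i < l + 1 then formCoord (α + i * m) s ∘ₗ zProj ⟨i, h⟩ else 0
  coord_eq_zero i s h := by
    split_ifs with hi
    · rw [formCoord_of_lt (by omega), LinearMap.zero_comp]
    · rfl
  ext v h := Z.ext fun i => formCoord_ext fun s => by
    have := h i s
    rwa [dif_pos i.2] at this
  exists_coord x := by
    choose p hp using fun i : Fin (l + 1) => exists_formCoord (α + i * m) (x i)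
    refine ⟨p, fun i hi s hs => ?_⟩
    rw [dif_pos (Nat.lt_succ_of_le hi)]
    exact hp ⟨i, Nat.lt_succ_of_le hi⟩ s hs

lemma typeZ_coord (i : Fin (l + 1)) (s : ℕ) (z : Z F m α l) :
    (typeZ F m α l).coord i s z = formCoord (α + i * m) s (z i) := by
  change (dite _ _ _ : Z F m α l →ₗ[F] F) z = _
  rw [dif_pos i.2]
  rfl

lemma leviIncl_lie_Z (A : sl2 F) (z : Z F m α l) (i : Fin (l + 1)) :
    ⁅leviIncl F m A, z⁆ i = ⁅A, z i⁆ := by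
  rw [Z.lie_apply]
  change ⁅A, z i⁆ + radAct 0 z i = _
  rw [radAct_zero_left, add_zero]

lemma radIncl_lie_Z (u : V F m) (z : Z F m α l) (i : Fin (l + 1)) :
    ⁅radIncl F m u, z⁆ i = radAct u z i := by
  rw [Z.lie_apply]
  change ⁅(0 : sl2 F), z i⁆ + radAct u z i = _
  rw [zero_lie, zero_add]

lemma typeZ_isLowering : (typeZ F m α l).IsLowering m where
  step i _ := by ring
  lie_e i s z := by
    rcases lt_or_ge l i with hi | hi
    · rw [(typeZ F m α l).coord_eq_zero _ _ (Or.inl hi),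
        (typeZ F m α l).coord_eq_zero _ _ (Or.inl hi)]
      simp
    · lift i to Fin (l + 1) using Nat.lt_succ_of_le hi
      rw [typeZ_coord, typeZ_coord, leviIncl_lie_Z, formCoord_sl2E]
  lie_f_zero i z := by
    rcases lt_or_ge l i with hi | hi
    · rw [(typeZ F m α l).coord_eq_zero _ _ (Or.inl hi)]; rfl
    · lift i to Fin (l + 1) using Nat.lt_succ_of_le hi
      rw [typeZ_coord, leviIncl_lie_Z, formCoord_zero_sl2F]
  lie_f_succ i s z h := by
    rcases lt_or_ge l i with hi | hi
    · rw [(typeZ F m α l).coord_eq_zero _ _ (Or.inl hi),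
        (typeZ F m α l).coord_eq_zero _ _ (Or.inl hi)]
      simp
    · lift i to Fin (l + 1) using Nat.lt_succ_of_le hi
      rw [typeZ_coord, typeZ_coord, leviIncl_lie_Z, formCoord_succ_sl2F h]
  lie_rad i s c z hs hc := by
    rcases lt_or_ge l i with hi | hi
    · rw [(typeZ F m α l).coord_eq_zero _ _ (Or.inl hi),
        (typeZ F m α l).coord_eq_zero _ _ (Or.inl (by omega))]
      rfl
    · lift i to Fin (l + 1) using Nat.lt_succ_of_le hi
      rw [typeZ_coord, radIncl_lie_Z, radAct]
      split_ifs with h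
      · rw [formCoord_lower_radBasis _ hc hs]
        exact (typeZ_coord ⟨(i : ℕ) + 1, h⟩ _ z).symm
      · rw [(typeZ F m α l).coord_eq_zero _ _ (Or.inl (by omega)), map_zero]
        rfl

end TypeZ

end Coords

/-! ### Coordinates on tensor products -/

section Pair

variable {F : Type*} [Field F] {M : Type*} [AddCommGroup M] [Module F M]
  {N : Type*} [AddCommGroup N] [Module F N]

/-- The tensor product of two linear functionals. -/
def pairing (f : M →ₗ[F] F) (g : N →ₗ[F] F) : M ⊗[F] N →ₗ[F] F :=
  LinearMap.mul' F F ∘ₗ TensorProduct.map f g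

@[simp] lemma pairing_tmul (f : M →ₗ[F] F) (g : N →ₗ[F] F) (v : M) (w : N) :
    pairing f g (v ⊗ₜ[F] w) = f v * g w := by
  simp [pairing]

@[simp] lemma pairing_zero_left (g : N →ₗ[F] F) : pairing (0 : M →ₗ[F] F) g = 0 := by
  ext; simp

@[simp] lemma pairing_zero_right (f : M →ₗ[F] F) : pairing f (0 : N →ₗ[F] F) = 0 := by
  ext; simp

lemma pairing_smul_left (a : F) (f : M →ₗ[F] F) (g : N →ₗ[F] F) (u : M ⊗[F] N) :
    pairing (a • f) g u = a * pairing f g u := by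
  have : pairing (a • f) g = a • pairing f g := by ext; simp [mul_assoc]
  rw [this]; rfl

lemma pairing_smul_right (a : F) (f : M →ₗ[F] F) (g : N →ₗ[F] F) (u : M ⊗[F] N) :
    pairing f (a • g) u = a * pairing f g u := by
  have : pairing f (a • g) = a • pairing f g := by ext; simp [mul_left_comm]
  rw [this]; rfl

lemma pairing_comm (f : M →ₗ[F] F) (g : N →ₗ[F] F) (u : M ⊗[F] N) :
    pairing g f (TensorProduct.comm F M N u) = pairing f g u := by
  induction u with
  | zero => simp
  | add u v hu hv => rw [map_add, map_add, map_add, hu, hv]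
  | tmul v w => simp [mul_comm]

lemma pairing_lie {K : Type*} [LieRing K] [LieAlgebra F K] [LieRingModule K M] [LieModule F K M]
    [LieRingModule K N] [LieModule F K N] {x : K} {f f' : M →ₗ[F] F} {g g' : N →ₗ[F] F}
    (hf : ∀ v, f ⁅x, v⁆ = f' v) (hg : ∀ w, g ⁅x, w⁆ = g' w) (u : M ⊗[F] N) :
    pairing f g ⁅x, u⁆ = pairing f' g u + pairing f g' u := by
  induction u with
  | zero => simp
  | add u v hu hv => rw [lie_add, map_add, map_add, map_add, hu, hv]; ring
  | tmul v w => simp [TensorProduct.LieModule.lie_tmul_right, hf, hg]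

end Pair

namespace Coords

variable {F : Type*} [Field F] {m : ℕ} {M : Type*} [AddCommGroup M] [Module F M]
  {N : Type*} [AddCommGroup N] [Module F N] {L L' : ℕ} {n n' : ℕ → ℕ}

/-- The coordinate of `M ⊗ N` which is the product of the coordinates `(i, s)` and `(j, q)`. -/
def tcoord (κ : Coords F M L n) (κ' : Coords F N L' n') (i j s q : ℕ) : M ⊗[F] N →ₗ[F] F :=
  pairing (κ.coord i s) (κ'.coord j q)

section Linear

variable (κ : Coords F M L n) (κ' : Coords F N L' n')

lemma tcoord_eq_zero {i j s q : ℕ} (h : L < i ∨ n i < s ∨ L' < j ∨ n' j < q) :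
    κ.tcoord κ' i j s q = 0 := by
  unfold tcoord
  by_cases h1 : L < i ∨ n i < s
  · rw [κ.coord_eq_zero _ _ h1, pairing_zero_left]
  · rw [κ'.coord_eq_zero _ _ (by omega), pairing_zero_right]

lemma tbasis_repr (u : M ⊗[F] N) (x : Σ i : Fin (L + 1), Fin (n i + 1))
    (y : Σ i : Fin (L' + 1), Fin (n' i + 1)) :
    (κ.basis.tensorProduct κ'.basis).repr u (x, y) = κ.tcoord κ' x.1 y.1 x.2 y.2 u := by
  induction u with
  | zero => simp
  | add u v hu hv => rw [map_add, map_add, Finsupp.add_apply, hu, hv]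
  | tmul v w =>
    rw [Module.Basis.tensorProduct_repr_tmul_apply, basis_repr, basis_repr, tcoord, pairing_tmul,
      smul_eq_mul, mul_comm]

lemma tcoord_ext {u v : M ⊗[F] N} (h : ∀ i ≤ L, ∀ j ≤ L', ∀ s ≤ n i, ∀ q ≤ n' j,
    κ.tcoord κ' i j s q u = κ.tcoord κ' i j s q v) : u = v := by
  refine (κ.basis.tensorProduct κ'.basis).repr.injective (Finsupp.ext fun ⟨x, y⟩ => ?_)
  rw [tbasis_repr, tbasis_repr]
  exact h _ (Nat.le_of_lt_succ x.1.2) _ (Nat.le_of_lt_succ y.1.2) _ (Nat.le_of_lt_succ x.2.2) _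
    (Nat.le_of_lt_succ y.2.2)

lemma exists_tcoord (x : ℕ → ℕ → ℕ → ℕ → F) : ∃ u : M ⊗[F] N, ∀ i ≤ L, ∀ j ≤ L', ∀ s ≤ n i,
    ∀ q ≤ n' j, κ.tcoord κ' i j s q u = x i j s q := by
  refine ⟨(κ.basis.tensorProduct κ'.basis).equivFun.symm fun z => x z.1.1 z.2.1 z.1.2 z.2.2,
    fun i hi j hj s hs q hq => ?_⟩
  have := tbasis_repr κ κ' ((κ.basis.tensorProduct κ'.basis).equivFun.symm
    fun z => x z.1.1 z.2.1 z.1.2 z.2.2) ⟨⟨i, Nat.lt_succ_of_le hi⟩, ⟨s, Nat.lt_succ_of_le hs⟩⟩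
    ⟨⟨j, Nat.lt_succ_of_le hj⟩, ⟨q, Nat.lt_succ_of_le hq⟩⟩
  rw [← this, ← Module.Basis.equivFun_apply, LinearEquiv.apply_symm_apply]

lemma mem_of_tcoord {P : Submodule F (M ⊗[F] N)} {u : M ⊗[F] N}
    (h : ∀ i j s q, κ.tcoord κ' i j s q u ≠ 0 → κ.vec i s ⊗ₜ[F] κ'.vec j q ∈ P) : u ∈ P := by
  rw [← (κ.basis.tensorProduct κ'.basis).sum_repr u]
  refine Submodule.sum_mem _ fun ⟨x, y⟩ _ => ?_
  rw [tbasis_repr, Module.Basis.tensorProduct_apply, ← vec_eq_basis, ← vec_eq_basis]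
  by_cases h0 : κ.tcoord κ' x.1 y.1 x.2 y.2 u = 0
  · rw [h0, zero_smul]
    exact P.zero_mem
  · exact P.smul_mem _ (h _ _ _ _ h0)

/-- The part of degree `t` of `M ⊗ N`. -/
def homog (t : ℕ) : Submodule F (M ⊗[F] N) where
  carrier := {u | ∀ i j s q, i + j ≠ t → κ.tcoord κ' i j s q u = 0}
  add_mem' hu hv i j s q h := by rw [map_add, hu i j s q h, hv i j s q h, add_zero]
  zero_mem' i j s q _ := map_zero _
  smul_mem' c u hu i j s q h := by rw [map_smul, hu i j s q h, smul_zero]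

lemma iSupIndep_homog : iSupIndep (homog κ κ') := by
  intro t
  rw [Submodule.disjoint_def]
  intro u hu hu'
  have key : ⨆ (t') (_ : t' ≠ t), homog κ κ' t' ≤
      (⨅ (i) (j) (s) (q) (_ : i + j = t), LinearMap.ker (κ.tcoord κ' i j s q)) := by
    refine iSup₂_le fun t' ht' => ?_
    simp only [le_iInf_iff]
    intro i j s q h v hv
    exact hv i j s q (by omega)
  have h1 := key hu'
  simp only [Submodule.mem_iInf, LinearMap.mem_ker] at h1
  refine κ.tcoord_ext κ' fun i _ j _ s _ q _ => ?_
  rw [map_zero]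
  by_cases h : i + j = t
  · exact h1 i j s q h
  · exact hu i j s q h

end Linear

end Coords

/-! ### Invariants of the radical -/

section RadInv

lemma lie_split {F : Type*} [Field F] {m : ℕ} {Q : Type*} [AddCommGroup Q]
    [LieRingModule (𝔤 F m) Q] (x : 𝔤 F m) (u : Q) :
    ⁅x, u⁆ = ⁅radIncl F m x.left, u⁆ + ⁅leviIncl F m x.right, u⁆ := by
  rw [← add_lie]
  congr 1
  simp [leviIncl]

lemma lie_radIncl_leviIncl {F : Type*} [Field F] {m : ℕ} (u : V F m) (A : sl2 F) :
    ⁅radIncl F m u, leviIncl F m A⁆ = radIncl F m (-⁅A, u⁆) := by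
  have hx : (actDer F m A) u = ⁅A, u⁆ := rfl
  simp [leviIncl, hx]

variable {F : Type*} [Field F] {m : ℕ} {Q : Type*} [AddCommGroup Q] [Module F Q]
  [LieRingModule (𝔤 F m) Q]

variable [LieModule F (𝔤 F m) Q]

variable (F m Q) in
/-- The submodule of vectors annihilated by the radical. -/
def radInv : LieSubmodule F (𝔤 F m) Q where
  carrier := {u | ∀ e : V F m, ⁅radIncl F m e, u⁆ = 0}
  add_mem' h h' e := by rw [lie_add, h, h', add_zero]
  zero_mem' e := lie_zero _
  smul_mem' c u h e := by rw [lie_smul, h, smul_zero]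
  lie_mem := by
    intro x u h e
    change ∀ e, ⁅radIncl F m e, u⁆ = 0 at h
    rw [lie_split x u, h, zero_add, leibniz_lie, h, lie_zero, add_zero, lie_radIncl_leviIncl, h]

lemma mem_radInv {u : Q} : u ∈ radInv F m Q ↔ ∀ e : V F m, ⁅radIncl F m e, u⁆ = 0 := Iff.rfl

lemma lie_rad_mem_of_basis [CharZero F] {P : Submodule F Q} {u : Q}
    (h : ∀ c ≤ m, ⁅radIncl F m (radBasis F m c), u⁆ ∈ P) (e : V F m) :
    ⁅radIncl F m e, u⁆ ∈ P := by
  have he : e ∈ Submodule.span F (radBasis F m '' Set.Iic m) := by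
    rw [span_radBasis]; trivial
  induction he using Submodule.span_induction with
  | mem e he => obtain ⟨c, hc, rfl⟩ := he; exact h c hc
  | zero => rw [map_zero, zero_lie]; exact P.zero_mem
  | add e e' _ _ h h' => rw [map_add, add_lie]; exact P.add_mem h h'
  | smul a e _ h => rw [map_smul, smul_lie]; exact P.smul_mem a h

lemma mem_radInv_of_basis [CharZero F] {u : Q}
    (h : ∀ c ≤ m, ⁅radIncl F m (radBasis F m c), u⁆ = 0) : u ∈ radInv F m Q := fun e =>
  (Submodule.mem_bot F).1 (lie_rad_mem_of_basis (P := ⊥) (fun c hc => h c hc) e)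

/-- If the radical strictly lowers a finite filtration, then it annihilates every irreducible
submodule. -/
lemma socle_le_radInv {T : ℕ} (Fil : ℕ → Submodule F Q) (h0 : Fil 0 = ⊥) (hT : Fil T = ⊤)
    (hr : ∀ t, ∀ u ∈ Fil (t + 1), ∀ e : V F m, ⁅radIncl F m e, u⁆ ∈ Fil t) :
    socle F (𝔤 F m) Q ≤ radInv F m Q := by
  refine sSup_le fun P hP => ?_
  have hP' : LieModule.IsIrreducible F (𝔤 F m) P := hP
  rcases eq_bot_or_eq_top ((radInv F m Q).comap P.incl) with h | h
  · exfalso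
    have key : ∀ t, ∀ u ∈ P, u ∈ Fil t → u = 0 := by
      intro t
      induction t with
      | zero => intro u _ hu; rwa [h0, Submodule.mem_bot] at hu
      | succ t ih =>
        intro u hu hut
        have h1 : (⟨u, hu⟩ : P) ∈ (radInv F m Q).comap P.incl := fun e =>
          ih _ (P.lie_mem hu) (hr t u hut e)
        rw [h, LieSubmodule.mem_bot] at h1
        exact congrArg Subtype.val h1
    have := LieModule.nontrivial_of_isIrreducible F (𝔤 F m) P
    obtain ⟨v, hv⟩ := exists_ne (0 : P)
    exact hv (Subtype.ext (key T v v.2 (by rw [hT]; trivial)))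
  · intro u hu
    have h1 : (⟨u, hu⟩ : P) ∈ (radInv F m Q).comap P.incl := by rw [h]; trivial
    exact h1

end RadInv

namespace Coords

variable {F : Type*} [Field F] [CharZero F] {m : ℕ}
  {M : Type*} [AddCommGroup M] [Module F M] [LieRingModule (𝔤 F m) M] [LieModule F (𝔤 F m) M]
  {N : Type*} [AddCommGroup N] [Module F N] [LieRingModule (𝔤 F m) N] [LieModule F (𝔤 F m) N]
  {L L' : ℕ} {n n' : ℕ → ℕ}

lemma IsGraded.mem_radInv_iff {κ : Coords F M L n} (hκ : κ.IsGraded m) {v : M} :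
    v ∈ radInv F m M ↔ ∀ i s, κ.coord (i + 1) s v = 0 := by
  constructor
  · intro hv i s
    obtain ⟨c, _, r, h⟩ := hκ.exists_lie_rad i s
    rw [← h, hv, map_zero]
  · intro h
    refine mem_radInv_of_basis fun c hc => κ.ext _ fun i s => ?_
    obtain ⟨r, hr⟩ := hκ.lie_rad i s c hc
    rw [hr, h]

lemma IsGraded.socle_le_radInv {κ : Coords F M L n} (hκ : κ.IsGraded m) :
    socle F (𝔤 F m) M ≤ radInv F m M := by
  refine GM.socle_le_radInv (T := L + 1)
    (fun t => ⨅ (i) (s) (_ : t ≤ i), LinearMap.ker (κ.coord i s)) ?_ ?_ ?_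
  · refine (Submodule.eq_bot_iff _).2 fun v hv => κ.ext v fun i s => ?_
    simp only [Submodule.mem_iInf, LinearMap.mem_ker] at hv
    exact hv i s (Nat.zero_le _)
  · rw [eq_top_iff]
    intro v _
    simp only [Submodule.mem_iInf, LinearMap.mem_ker]
    intro i s h
    rw [κ.coord_eq_zero i s (Or.inl h), LinearMap.zero_apply]
  · intro t v hv e
    refine lie_rad_mem_of_basis (fun c hc => ?_) e
    simp only [Submodule.mem_iInf, LinearMap.mem_ker] at hv ⊢
    intro i s h
    obtain ⟨r, hr⟩ := hκ.lie_rad i s c hc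
    rw [hr]
    exact hv _ _ (by omega)

variable {κ : Coords F M L n} {κ' : Coords F N L' n'}

lemma IsGraded.tcoord_lie_rad (hκ : κ.IsGraded m) (hκ' : κ'.IsGraded m) (i j s q : ℕ) {c : ℕ}
    (hc : c ≤ m) : ∃ r r', ∀ u, κ.tcoord κ' i j s q ⁅radIncl F m (radBasis F m c), u⁆ =
      κ.tcoord κ' (i + 1) j r q u + κ.tcoord κ' i (j + 1) s r' u := by
  obtain ⟨r, hr⟩ := hκ.lie_rad i s c hc
  obtain ⟨r', hr'⟩ := hκ'.lie_rad j q c hc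
  exact ⟨r, r', fun u => pairing_lie hr hr' u⟩

lemma IsGraded.socle_tensor_le_radInv (hκ : κ.IsGraded m) (hκ' : κ'.IsGraded m) :
    socle F (𝔤 F m) (M ⊗[F] N) ≤ radInv F m (M ⊗[F] N) := by
  refine GM.socle_le_radInv (T := L + L' + 1)
    (fun t => ⨅ (i) (j) (s) (q) (_ : t ≤ i + j), LinearMap.ker (κ.tcoord κ' i j s q)) ?_ ?_ ?_
  · refine (Submodule.eq_bot_iff _).2 fun v hv => κ.tcoord_ext κ' fun i _ j _ s _ q _ => ?_
    simp only [Submodule.mem_iInf, LinearMap.mem_ker] at hv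
    rw [map_zero]
    exact hv i j s q (Nat.zero_le _)
  · rw [eq_top_iff]
    intro v _
    simp only [Submodule.mem_iInf, LinearMap.mem_ker]
    intro i j s q h
    rw [tcoord_eq_zero κ κ' (by omega), LinearMap.zero_apply]
  · intro t v hv e
    refine lie_rad_mem_of_basis (fun c hc => ?_) e
    simp only [Submodule.mem_iInf, LinearMap.mem_ker] at hv ⊢
    intro i j s q h
    obtain ⟨r, r', hr⟩ := hκ.tcoord_lie_rad hκ' i j s q hc
    rw [hr, hv _ _ _ _ (by omega), hv _ _ _ _ (by omega), add_zero]

lemma IsGraded.tcoord_eq_zero_of_left (hκ : κ.IsGraded m) (hκ' : κ'.IsGraded m)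
    {u : M ⊗[F] N} (hu : u ∈ radInv F m (M ⊗[F] N)) {i j : ℕ}
    (h : ∀ s q, κ.tcoord κ' (i + 1) j s q u = 0) (s q : ℕ) :
    κ.tcoord κ' i (j + 1) s q u = 0 := by
  obtain ⟨c, hc, r, hr⟩ := hκ'.exists_lie_rad j q
  obtain ⟨r', hr'⟩ := hκ.lie_rad i s c hc
  have := pairing_lie hr' hr u
  rw [hu, map_zero] at this
  have h1 := h r' r
  unfold tcoord at h1 ⊢
  rw [h1, zero_add] at this
  exact this.symm

lemma IsGraded.tcoord_eq_zero_of_right (hκ : κ.IsGraded m) (hκ' : κ'.IsGraded m)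
    {u : M ⊗[F] N} (hu : u ∈ radInv F m (M ⊗[F] N)) {i j : ℕ}
    (h : ∀ s q, κ.tcoord κ' i (j + 1) s q u = 0) (s q : ℕ) :
    κ.tcoord κ' (i + 1) j s q u = 0 := by
  obtain ⟨c, hc, r, hr⟩ := hκ.exists_lie_rad i s
  obtain ⟨r', hr'⟩ := hκ'.lie_rad j q c hc
  have := pairing_lie hr hr' u
  rw [hu, map_zero] at this
  have h1 := h r r'
  unfold tcoord at h1 ⊢
  rw [h1, add_zero] at this
  exact this.symm

/-- An invariant of degree `t` is determined by its component in degree `(0, t)`. -/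
lemma IsGraded.eq_zero_of_first (hκ : κ.IsGraded m) (hκ' : κ'.IsGraded m) {t : ℕ}
    {u : M ⊗[F] N} (hu : u ∈ radInv F m (M ⊗[F] N)) (hut : u ∈ homog κ κ' t)
    (h : ∀ s q, κ.tcoord κ' 0 t s q u = 0) : u = 0 := by
  have key : ∀ i j, i + j = t → ∀ s q, κ.tcoord κ' i j s q u = 0 := by
    intro i
    induction i with
    | zero => intro j hj; rw [Nat.zero_add] at hj; rwa [hj]
    | succ i ih =>
      intro j hj
      exact hκ.tcoord_eq_zero_of_right hκ' hu (ih (j + 1) (by omega))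
  refine κ.tcoord_ext κ' fun i _ j _ s _ q _ => ?_
  rw [map_zero]
  by_cases hij : i + j = t
  · exact key i j hij s q
  · exact hut i j s q hij

/-- There are no invariants in the degrees larger than both lengths. -/
lemma IsGraded.eq_zero_of_min_lt (hκ : κ.IsGraded m) (hκ' : κ'.IsGraded m) {t : ℕ}
    (ht : min L L' < t) {u : M ⊗[F] N} (hu : u ∈ radInv F m (M ⊗[F] N))
    (hut : u ∈ homog κ κ' t) : u = 0 := by
  refine hκ.eq_zero_of_first hκ' hu hut ?_
  rcases lt_or_ge L' t with h | h
  · intro s q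
    rw [tcoord_eq_zero κ κ' (by omega), LinearMap.zero_apply]
  · have hL : L < t := by omega
    have key : ∀ j ≤ t, ∀ s q, κ.tcoord κ' (t - j) j s q u = 0 := by
      intro j
      induction j with
      | zero =>
        intro _ s q
        rw [tcoord_eq_zero κ κ' (by omega), LinearMap.zero_apply]
      | succ j ih =>
        intro hj
        refine hκ.tcoord_eq_zero_of_left hκ' hu ?_
        rw [show t - (j + 1) + 1 = t - j by omega]
        exact ih (by omega)
    have := key t le_rfl
    rwa [Nat.sub_self] at this

/-- Every invariant is a sum of homogeneous invariants. -/
lemma IsGraded.radInv_le_iSup (hκ : κ.IsGraded m) (hκ' : κ'.IsGraded m) :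
    (radInv F m (M ⊗[F] N)).toSubmodule ≤
      ⨆ t : ℕ, homog κ κ' t ⊓ (radInv F m (M ⊗[F] N)).toSubmodule := by
  intro u hu
  choose w hw using fun t => exists_tcoord κ κ' fun i j s q =>
    if i + j = t then κ.tcoord κ' i j s q u else 0
  have hw' : ∀ t i j s q, κ.tcoord κ' i j s q (w t) =
      if i + j = t then κ.tcoord κ' i j s q u else 0 := by
    intro t i j s q
    by_cases h : L < i ∨ n i < s ∨ L' < j ∨ n' j < q
    · simp [tcoord_eq_zero κ κ' h]
    · push Not at h
      exact hw t i h.1 j h.2.2.1 s h.2.1 q h.2.2.2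
  have hsum : u = ∑ t ∈ Finset.range (L + L' + 1), w t := by
    refine κ.tcoord_ext κ' fun i hi j hj s _ q _ => ?_
    rw [map_sum]
    simp only [hw']
    rw [Finset.sum_ite_eq, if_pos (Finset.mem_range.2 (by omega))]
  rw [hsum]
  refine Submodule.sum_mem _ fun t _ => Submodule.mem_iSup_of_mem t ⟨?_, ?_⟩
  · intro i j s q h
    rw [hw', if_neg h]
  · refine mem_radInv_of_basis fun c hc => κ.tcoord_ext κ' fun i _ j _ s _ q _ => ?_
    obtain ⟨r, r', hr⟩ := hκ.tcoord_lie_rad hκ' i j s q hc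
    rw [hr, hw', hw', map_zero]
    by_cases h : i + 1 + j = t
    · rw [if_pos h, if_pos (by omega), ← hr, (mem_radInv.1 hu), map_zero]
    · rw [if_neg h, if_neg (by omega), add_zero]

end Coords

/-! ### Homogeneous invariants in the three kinds of tensor products -/

namespace Coords

variable {F : Type*} [Field F] [CharZero F] {m : ℕ}
  {M : Type*} [AddCommGroup M] [Module F M] [LieRingModule (𝔤 F m) M] [LieModule F (𝔤 F m) M]
  {N : Type*} [AddCommGroup N] [Module F N] [LieRingModule (𝔤 F m) N] [LieModule F (𝔤 F m) N]
  {L L' : ℕ} {n n' : ℕ → ℕ} {κ : Coords F M L n} {κ' : Coords F N L' n'}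

section LoweringLowering

lemma IsLowering.tcoord_lie_rad (hκ : κ.IsLowering m) (hκ' : κ'.IsLowering m) {i j s q c : ℕ}
    (hs : s ≤ n i) (hq : q ≤ n' j) (hc : c ≤ m) (u : M ⊗[F] N) :
    κ.tcoord κ' i j s q ⁅radIncl F m (radBasis F m c), u⁆ =
      κ.tcoord κ' (i + 1) j (s + c) q u + κ.tcoord κ' i (j + 1) s (q + c) u :=
  pairing_lie (fun v => hκ.lie_rad i s c v hs hc) (fun w => hκ'.lie_rad j q c w hq hc) u

lemma IsLowering.tcoord_lie_e (hκ : κ.IsLowering m) (hκ' : κ'.IsLowering m) (i j s q : ℕ)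
    (u : M ⊗[F] N) : κ.tcoord κ' i j s q ⁅leviIncl F m (sl2E F), u⁆ =
      (n i - s : F) * κ.tcoord κ' i j (s + 1) q u +
        (n' j - q : F) * κ.tcoord κ' i j s (q + 1) u := by
  have := pairing_lie (f' := (n i - s : F) • κ.coord i (s + 1))
    (g' := (n' j - q : F) • κ'.coord j (q + 1)) (fun v => hκ.lie_e i s v)
    (fun w => hκ'.lie_e j q w) u
  rwa [pairing_smul_left, pairing_smul_right] at this

lemma IsLowering.tcoord_lie_f (hκ : κ.IsLowering m) (hκ' : κ'.IsLowering m) {i j s q : ℕ}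
    (hs : s ≤ n i) (hq : q ≤ n' j) (u : M ⊗[F] N) :
    κ.tcoord κ' i j s q ⁅leviIncl F m (sl2F F), u⁆ =
      (s : F) * κ.tcoord κ' i j (s - 1) q u + (q : F) * κ.tcoord κ' i j s (q - 1) u := by
  have := pairing_lie (f' := (s : F) • κ.coord i (s - 1)) (g' := (q : F) • κ'.coord j (q - 1))
    (fun v => hκ.lie_f hs v) (fun w => hκ'.lie_f hq w) u
  rwa [pairing_smul_left, pairing_smul_right] at this

/-- If the coordinates of degree `(i, j)` of every element of an `sl(2)`-submodule only depend on
the sum of the two indices, then they are the coordinates of a binary form. -/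
lemma IsLowering.exists_isSlMap (hκ : κ.IsLowering m) (hκ' : κ'.IsLowering m) {i j k : ℕ}
    (hk : k = n i + n' j) {P : Type*} [AddCommGroup P] [Module F P] [LieRingModule (𝔤 F m) P]
    [LieModule F (𝔤 F m) P] {ι : P →ₗ[F] M ⊗[F] N} (hι : IsSlMap m ι)
    (h : ∀ (u : P) (s q : ℕ), s + 1 ≤ n i → q + 1 ≤ n' j →
      κ.tcoord κ' i j (s + 1) q (ι u) = κ.tcoord κ' i j s (q + 1) (ι u)) :
    ∃ Φ : P →ₗ[F] V F k, IsSlMap m Φ ∧ ∀ u : P, ∀ s ≤ n i, ∀ q ≤ n' j,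
      κ.tcoord κ' i j s q (ι u) = (form F k).coord 0 (s + q) (Φ u) := by
  have h1 : ∀ (u : P) (d s q : ℕ), s + d ≤ n i → q + d ≤ n' j →
      κ.tcoord κ' i j (s + d) q (ι u) = κ.tcoord κ' i j s (q + d) (ι u) := by
    intro u d
    induction d with
    | zero => intros; rfl
    | succ d ih =>
      intro s q hs hq
      rw [← add_assoc, h u _ _ (by omega) (by omega), ih _ _ (by omega) (by omega)]
      congr 2; omega
  obtain ⟨Φ, hΦ⟩ := (form F k).exists_linearMap fun _ r =>
    κ.tcoord κ' i j (min r (n i)) (r - min r (n i)) ∘ₗ ι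
  have h2 : ∀ u : P, ∀ s ≤ n i, ∀ q ≤ n' j,
      κ.tcoord κ' i j s q (ι u) = (form F k).coord 0 (s + q) (Φ u) := by
    intro u s hs q hq
    rw [hΦ 0 le_rfl _ (by omega), LinearMap.comp_apply]
    have := h1 u (min (s + q) (n i) - s) s (s + q - min (s + q) (n i)) (by omega) (by omega)
    rw [show s + (min (s + q) (n i) - s) = min (s + q) (n i) by omega,
      show s + q - min (s + q) (n i) + (min (s + q) (n i) - s) = q by omega] at this
    exact this.symm
  have hform := form_isLowering (F := F) m k
  refine ⟨Φ, isSlMap_of_sl2E_sl2F m (fun u => ?_) (fun u => ?_), h2⟩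
  · refine (form F k).ext_of_le fun i' hi' r hr => ?_
    obtain rfl := Nat.le_zero.1 hi'
    rw [hform.lie_e]
    obtain ⟨s, q, hs, hq, rfl⟩ : ∃ s q, s ≤ n i ∧ q ≤ n' j ∧ r = s + q :=
      ⟨min r (n i), r - min r (n i), by omega, by omega, by omega⟩
    have hkF : (k : F) = n i + n' j := by rw [hk]; push_cast; rfl
    rw [← h2 _ s hs q hq, hι, hκ.tcoord_lie_e hκ']
    have e1 : (n i - s : F) * κ.tcoord κ' i j (s + 1) q (ι u) =
        (n i - s : F) * (form F k).coord 0 (s + q + 1) (Φ u) := by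
      rcases hs.eq_or_lt with rfl | hs
      · simp
      · rw [h2 _ (s + 1) hs q hq, show s + 1 + q = s + q + 1 by omega]
    have e2 : (n' j - q : F) * κ.tcoord κ' i j s (q + 1) (ι u) =
        (n' j - q : F) * (form F k).coord 0 (s + q + 1) (Φ u) := by
      rcases hq.eq_or_lt with rfl | hq
      · simp
      · rw [h2 _ s hs (q + 1) hq, show s + (q + 1) = s + q + 1 by omega]
    rw [e1, e2, hkF]
    push_cast; ring
  · refine (form F k).ext_of_le fun i' hi' r hr => ?_
    obtain rfl := Nat.le_zero.1 hi'
    rw [hform.lie_f hr]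
    obtain ⟨s, q, hs, hq, rfl⟩ : ∃ s q, s ≤ n i ∧ q ≤ n' j ∧ r = s + q :=
      ⟨min r (n i), r - min r (n i), by omega, by omega, by omega⟩
    rw [← h2 _ s hs q hq, hι, hκ.tcoord_lie_f hκ' hs hq]
    have e1 : (s : F) * κ.tcoord κ' i j (s - 1) q (ι u) =
        (s : F) * (form F k).coord 0 (s + q - 1) (Φ u) := by
      rcases s with _ | s
      · simp
      · rw [h2 _ _ (by omega) q hq, show s + 1 - 1 + q = s + 1 + q - 1 by omega]
    have e2 : (q : F) * κ.tcoord κ' i j s (q - 1) (ι u) =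
        (q : F) * (form F k).coord 0 (s + q - 1) (Φ u) := by
      rcases q with _ | q
      · simp
      · rw [h2 _ s hs _ (by omega), show s + (q + 1 - 1) = s + (q + 1) - 1 by omega]
    rw [e1, e2]
    push_cast; ring

/-- The invariants of degree `t` in `Z ⊗ Z`. Their components of degree `(0, t)` are the
polarizations of the binary forms of degree `n 0 + n' t`. -/
lemma IsLowering.exists_equiv (hm : 1 ≤ m) (hκ : κ.IsLowering m) (hκ' : κ'.IsLowering m)
    {t : ℕ} (ht : 1 ≤ t) (htL : t ≤ L) (htL' : t ≤ L') {k : ℕ} (hk : k = n 0 + n' t)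
    {P : LieSubmodule F (𝔤 F m) (M ⊗[F] N)}
    (hP : ∀ u, u ∈ P ↔ u ∈ homog κ κ' t ∧ u ∈ radInv F m (M ⊗[F] N)) :
    ∃ φ : P ≃ₗ[F] V F k, IsSlMap m (φ : P →ₗ[F] V F k) := by
  obtain ⟨t, rfl⟩ := Nat.exists_eq_add_of_le' ht
  have hn' := hκ'.step t (by omega)
  have hrel : ∀ u ∈ P, ∀ s ≤ n 0, ∀ q ≤ n' t, ∀ c ≤ m,
      κ.tcoord κ' 1 t (s + c) q u = -κ.tcoord κ' 0 (t + 1) s (q + c) u := by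
    intro u hu s hs q hq c hc
    have := hκ.tcoord_lie_rad hκ' hs hq hc u
    rw [((hP u).1 hu).2, map_zero] at this
    exact eq_neg_of_add_eq_zero_left this.symm
  obtain ⟨Φ, hΦ, hcoord⟩ := hκ.exists_isSlMap hκ' hk (P := P) (ι := P.incl)
    (fun A v => rfl) (i := 0) (j := t + 1) <| by
      intro u s q hs hq
      have hu := u.2
      change κ.tcoord κ' 0 (t + 1) (s + 1) q u.1 = κ.tcoord κ' 0 (t + 1) s (q + 1) u.1
      -- move `d` units of the second index to the first one and back
      obtain ⟨q', d, hq', hd, rfl⟩ : ∃ q' d, q' ≤ n' t ∧ d + 1 ≤ m ∧ q = q' + d :=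
        ⟨min q (n' t), q - min q (n' t), by omega, by omega, by omega⟩
      rw [← neg_inj, ← hrel u.1 hu (s + 1) hs q' hq' d (by omega), add_assoc q' d 1,
        ← hrel u.1 hu s (by omega) q' hq' (d + 1) hd]
      congr 2; omega
  have hgr := hκ.isGraded hm
  have hgr' := hκ'.isGraded hm
  refine ⟨LinearEquiv.ofBijective Φ ⟨?_, ?_⟩, hΦ⟩
  · rw [← LinearMap.ker_eq_bot, Submodule.eq_bot_iff]
    intro u hu
    have h1 := (hP u.1).1 u.2
    refine Subtype.ext (hgr.eq_zero_of_first hgr' h1.2 h1.1 fun s q => ?_)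
    by_cases h : L < 0 ∨ n 0 < s ∨ L' < t + 1 ∨ n' (t + 1) < q
    · rw [tcoord_eq_zero κ κ' h, LinearMap.zero_apply]
    · push Not at h
      have := hcoord u s h.2.1 q h.2.2.2
      rwa [LinearMap.mem_ker.1 hu, map_zero] at this
  · intro p
    -- the alternating sign makes the two terms of `tcoord_lie_rad` cancel
    obtain ⟨u, hu⟩ := exists_tcoord κ κ' fun i j s q =>
      if i + j = t + 1 then (-1 : F) ^ i * (form F k).coord 0 (s + q) p else 0
    have huP : u ∈ P := by
      refine (hP u).2 ⟨fun i j s q hij => ?_, mem_radInv_of_basis fun c hc => ?_⟩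
      · by_cases h : L < i ∨ n i < s ∨ L' < j ∨ n' j < q
        · rw [tcoord_eq_zero κ κ' h, LinearMap.zero_apply]
        · push Not at h
          rw [hu i h.1 j h.2.2.1 s h.2.1 q h.2.2.2, if_neg hij]
      · refine κ.tcoord_ext κ' fun i hi j hj s hs q hq => ?_
        rw [map_zero, hκ.tcoord_lie_rad hκ' hs hq hc]
        have hrange : ∀ i' j' s' q', i' + j' ≠ t + 1 → κ.tcoord κ' i' j' s' q' u = 0 := by
          intro i' j' s' q' hij
          by_cases h : L < i' ∨ n i' < s' ∨ L' < j' ∨ n' j' < q'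
          · rw [tcoord_eq_zero κ κ' h, LinearMap.zero_apply]
          · push Not at h
            rw [hu i' h.1 j' h.2.2.1 s' h.2.1 q' h.2.2.2, if_neg hij]
        by_cases hij : i + j = t
        · have s1 := hκ.step i (by omega)
          have s2 := hκ'.step j (by omega)
          rw [hu (i + 1) (by omega) j hj (s + c) (by omega) q hq, if_pos (by omega),
            hu i hi (j + 1) (by omega) s hs (q + c) (by omega), if_pos (by omega),
            show s + c + q = s + (q + c) by omega, pow_succ]
          ring
        · rw [hrange _ _ _ _ (by omega), hrange _ _ _ _ (by omega), add_zero]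
    refine ⟨⟨u, huP⟩, (form F k).ext_of_le fun i' hi' r hr => ?_⟩
    obtain rfl := Nat.le_zero.1 hi'
    obtain ⟨s, q, hs, hq, rfl⟩ : ∃ s q, s ≤ n 0 ∧ q ≤ n' (t + 1) ∧ r = s + q :=
      ⟨min r (n 0), r - min r (n 0), by omega, by omega, by omega⟩
    rw [← hcoord ⟨u, huP⟩ s hs q hq]
    change κ.tcoord κ' 0 (t + 1) s q u = _
    rw [hu 0 (by omega) (t + 1) (by omega) s hs q hq, if_pos (by omega)]
    simp

end LoweringLowering

section LoweringRaising

lemma IsLowering.tcoord_lie_rad_raising (hκ : κ.IsLowering m) (hκ' : κ'.IsRaising m)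
    {i j s q c : ℕ} (hs : s ≤ n i) (hc : c ≤ m) (u : M ⊗[F] N) :
    κ.tcoord κ' i j s (q + c) ⁅radIncl F m (radBasis F m c), u⁆ =
      κ.tcoord κ' (i + 1) j (s + c) (q + c) u + κ.tcoord κ' i (j + 1) s q u :=
  pairing_lie (fun v => hκ.lie_rad i s c v hs hc) (fun w => hκ'.lie_rad j q c w hc) u

lemma IsLowering.tcoord_lie_rad_raising_of_lt (hκ : κ.IsLowering m) (hκ' : κ'.IsRaising m)
    {i j s q c : ℕ} (hs : s ≤ n i) (hc : c ≤ m) (hq : q < c) (u : M ⊗[F] N) :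
    κ.tcoord κ' i j s q ⁅radIncl F m (radBasis F m c), u⁆ =
      κ.tcoord κ' (i + 1) j (s + c) q u := by
  have := pairing_lie (g' := 0) (fun v => hκ.lie_rad i s c v hs hc)
    (fun w => hκ'.lie_rad_of_lt j q c w hq hc) u
  rwa [pairing_zero_right, LinearMap.zero_apply, add_zero] at this

/-- The coordinates of degree `(0, t)` of an invariant only depend on the difference of the two
indices, and vanish unless this difference is between `0` and `n' t - n 0`. -/
lemma IsLowering.tcoord_raising (hm : 1 ≤ m) (hκ : κ.IsLowering m) (hκ' : κ'.IsRaising m)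
    {t : ℕ} (ht : 1 ≤ t) {u : M ⊗[F] N} (hu : u ∈ radInv F m (M ⊗[F] N)) :
    (∀ s q, s + 1 ≤ n 0 → κ.tcoord κ' 0 t (s + 1) (q + 1) u = κ.tcoord κ' 0 t s q u) ∧
    (∀ s, s + 1 ≤ n 0 → κ.tcoord κ' 0 t (s + 1) 0 u = 0) ∧
    (∀ s q, s ≤ n 0 → q < s → κ.tcoord κ' 0 t s q u = 0) ∧
    (∀ s d, s ≤ n 0 → κ.tcoord κ' 0 t s (s + d) u = κ.tcoord κ' 0 t 0 d u) ∧
    ∀ d, n' t < n 0 + d → κ.tcoord κ' 0 t 0 d u = 0 := by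
  obtain ⟨t, rfl⟩ := Nat.exists_eq_add_of_le' ht
  have hrel : ∀ s ≤ n 0, ∀ q, ∀ c ≤ m, κ.tcoord κ' 1 t (s + c) (q + c) u =
      -κ.tcoord κ' 0 (t + 1) s q u := by
    intro s hs q c hc
    have := hκ.tcoord_lie_rad_raising hκ' (j := t) (q := q) hs hc u
    rw [hu, map_zero] at this
    exact eq_neg_of_add_eq_zero_left this.symm
  have h1 : ∀ s q, s + 1 ≤ n 0 →
      κ.tcoord κ' 0 (t + 1) (s + 1) (q + 1) u = κ.tcoord κ' 0 (t + 1) s q u := by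
    intro s q hs
    rw [← neg_inj, ← hrel (s + 1) hs (q + 1) 0 (Nat.zero_le _), ← hrel s (by omega) q 1 hm]
  have h2 : ∀ s, s + 1 ≤ n 0 → κ.tcoord κ' 0 (t + 1) (s + 1) 0 u = 0 := by
    intro s hs
    have := hκ.tcoord_lie_rad_raising_of_lt hκ' (i := 0) (j := t) (s := s) (q := 0) (c := 1)
      (by omega) hm one_pos u
    rw [hu, map_zero] at this
    rw [← neg_eq_zero, ← hrel (s + 1) hs 0 0 (Nat.zero_le _)]
    exact this.symm
  have h3 : ∀ s q, s ≤ n 0 → q < s → κ.tcoord κ' 0 (t + 1) s q u = 0 := by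
    intro s
    induction s with
    | zero => intro q _ hq; omega
    | succ s ih =>
      intro q hs hq
      rcases q with _ | q
      · exact h2 s hs
      · rw [h1 s q hs]
        exact ih q (by omega) (by omega)
  have h4 : ∀ s d, s ≤ n 0 →
      κ.tcoord κ' 0 (t + 1) s (s + d) u = κ.tcoord κ' 0 (t + 1) 0 d u := by
    intro s d
    induction s with
    | zero => intro _; rw [Nat.zero_add]
    | succ s ih =>
      intro hs
      rw [show s + 1 + d = s + d + 1 by omega, h1 _ _ hs, ih (by omega)]
  refine ⟨h1, h2, h3, h4, fun d hd => ?_⟩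
  rw [← h4 (n 0) d le_rfl, tcoord_eq_zero κ κ' (by omega), LinearMap.zero_apply]

/-- There are no invariants of degree `t` in `Z ⊗ Z^*` if `n' t < n 0`. -/
lemma IsLowering.eq_zero_of_lt (hm : 1 ≤ m) (hκ : κ.IsLowering m) (hκ' : κ'.IsRaising m)
    {t : ℕ} (ht : 1 ≤ t) (hlt : n' t < n 0) {u : M ⊗[F] N}
    (hu : u ∈ radInv F m (M ⊗[F] N)) (hut : u ∈ homog κ κ' t) : u = 0 := by
  obtain ⟨-, -, h3, h4, h5⟩ := hκ.tcoord_raising hm hκ' ht hu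
  refine (hκ.isGraded hm).eq_zero_of_first (hκ'.isGraded hm) hu hut fun s q => ?_
  rcases lt_or_ge (n 0) s with hs | hs
  · rw [tcoord_eq_zero κ κ' (by omega), LinearMap.zero_apply]
  rcases lt_or_ge q s with hq | hq
  · exact h3 s q hs hq
  · obtain ⟨d, rfl⟩ := Nat.exists_eq_add_of_le hq
    rw [h4 s d hs]
    exact h5 d (by omega)

/-- The invariants of degree `t` in `Z ⊗ Z^*` for `n 0 ≤ n' t`. Their components of degree `(0, t)`
correspond to the products of `(x₁ y₂ - x₂ y₁) ^ n 0` with the binary forms of degree `n' t - n 0`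
in the second pair of variables. -/
lemma IsLowering.exists_equiv_raising (hm : 1 ≤ m) (hκ : κ.IsLowering m) (hκ' : κ'.IsRaising m)
    {t : ℕ} (ht : 1 ≤ t) (htL : t ≤ L) (htL' : t ≤ L') {k : ℕ} (hk : n' t = n 0 + k)
    {P : LieSubmodule F (𝔤 F m) (M ⊗[F] N)}
    (hP : ∀ u, u ∈ P ↔ u ∈ homog κ κ' t ∧ u ∈ radInv F m (M ⊗[F] N)) :
    ∃ φ : P ≃ₗ[F] V F k, IsSlMap m (φ : P →ₗ[F] V F k) := by
  have hgr := hκ.isGraded hm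
  have hgr' := hκ'.isGraded hm
  have hform := formDual_isRaising (F := F) m k
  obtain ⟨Φ, hΦ⟩ := (formDual F k).exists_linearMap fun _ r =>
    κ.tcoord κ' 0 t 0 r ∘ₗ (P.incl : P →ₗ[F] M ⊗[F] N)
  have hΦ' : ∀ r, ∀ u : P, (formDual F k).coord 0 r (Φ u) = κ.tcoord κ' 0 t 0 r u.1 := by
    intro r u
    rcases le_or_gt r k with hr | hr
    · exact hΦ 0 le_rfl r hr u
    · rw [(formDual F k).coord_eq_zero _ _ (Or.inr hr), LinearMap.zero_apply]
      exact ((hκ.tcoord_raising hm hκ' ht ((hP u.1).1 u.2).2).2.2.2.2 r (by omega)).symm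
  have he0 : ∀ v, κ.coord 0 0 ⁅leviIncl F m (sl2E F), v⁆ = ((n 0 : F) • κ.coord 0 1) v := by
    intro v
    rw [hκ.lie_e]
    simp
  have hsl : IsSlMap m Φ := by
    refine isSlMap_of_sl2E_sl2F m (fun u => ?_) (fun u => ?_)
    · refine (formDual F k).ext_of_le fun i' hi' r hr => ?_
      obtain rfl := Nat.le_zero.1 hi'
      obtain ⟨h1, h2, -⟩ := hκ.tcoord_raising hm hκ' ht ((hP u.1).1 u.2).2
      rw [hΦ']
      change κ.tcoord κ' 0 t 0 r ⁅leviIncl F m (sl2E F), u.1⁆ = _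
      rcases r with _ | r
      · have := pairing_lie (f' := (n 0 : F) • κ.coord 0 1) (g' := (0 : N →ₗ[F] F))
          he0 (fun w => hκ'.lie_e_zero t w) u.1
        rw [pairing_smul_left, pairing_zero_right, LinearMap.zero_apply, add_zero] at this
        rw [hform.lie_e_zero, tcoord, this, mul_eq_zero]
        rcases Nat.eq_zero_or_pos (n 0) with h0 | h0
        · left; simp [h0]
        · right; exact h2 0 h0
      · have := pairing_lie (f' := (n 0 : F) • κ.coord 0 1)
          (g' := (-(n' t - r : F)) • κ'.coord t r)
          he0 (fun w => hκ'.lie_e_succ t r w) u.1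
        rw [pairing_smul_left, pairing_smul_right] at this
        rw [hform.lie_e_succ, tcoord, this, hΦ']
        have e1 : (n 0 : F) * κ.tcoord κ' 0 t 1 (r + 1) u.1 =
            (n 0 : F) * κ.tcoord κ' 0 t 0 r u.1 := by
          rcases Nat.eq_zero_or_pos (n 0) with h0 | h0
          · simp [h0]
          · rw [← h1 0 r h0]
        unfold tcoord at e1 ⊢
        rw [e1, hk]
        push_cast; ring
    · refine (formDual F k).ext_of_le fun i' hi' r hr => ?_
      obtain rfl := Nat.le_zero.1 hi'
      rw [hΦ']
      change κ.tcoord κ' 0 t 0 r ⁅leviIncl F m (sl2F F), u.1⁆ = _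
      have := pairing_lie (f' := (0 : M →ₗ[F] F)) (g' := (-(r + 1 : F)) • κ'.coord t (r + 1))
        (fun v => hκ.lie_f_zero 0 v) (fun w => hκ'.lie_f t r w) u.1
      rw [pairing_smul_right, pairing_zero_left, LinearMap.zero_apply, zero_add] at this
      rw [hform.lie_f, tcoord, this, hΦ']
      rfl
  refine ⟨LinearEquiv.ofBijective Φ ⟨?_, ?_⟩, hsl⟩
  · rw [← LinearMap.ker_eq_bot, Submodule.eq_bot_iff]
    intro u hu
    have hu1 := (hP u.1).1 u.2
    obtain ⟨-, -, h3, h4, h5⟩ := hκ.tcoord_raising hm hκ' ht hu1.2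
    refine Subtype.ext (hgr.eq_zero_of_first hgr' hu1.2 hu1.1 fun s q => ?_)
    rcases lt_or_ge (n 0) s with hs | hs
    · rw [tcoord_eq_zero κ κ' (by omega), LinearMap.zero_apply]
    rcases lt_or_ge q s with hq | hq
    · exact h3 s q hs hq
    · obtain ⟨d, rfl⟩ := Nat.exists_eq_add_of_le hq
      rw [h4 s d hs, ← hΦ', LinearMap.mem_ker.1 hu, map_zero]
  · intro p
    obtain ⟨u, hu⟩ := exists_tcoord κ κ' fun i j s q =>
      if i + j = t ∧ s ≤ q then (-1 : F) ^ i * (formDual F k).coord 0 (q - s) p else 0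
    have hrange : ∀ i' j' s' q', i' + j' ≠ t → κ.tcoord κ' i' j' s' q' u = 0 := by
      intro i' j' s' q' hij
      by_cases h : L < i' ∨ n i' < s' ∨ L' < j' ∨ n' j' < q'
      · rw [tcoord_eq_zero κ κ' h, LinearMap.zero_apply]
      · push Not at h
        rw [hu i' h.1 j' h.2.2.1 s' h.2.1 q' h.2.2.2, if_neg (fun h => hij h.1)]
    have hweight : ∀ i ≤ L, ∀ j ≤ L', i + j = t → n' j = n i + k := by
      intro i hi j hj hij
      have w1 := hκ.weight_eq hi
      have w2 := hκ'.weight_add hj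
      have w3 := hκ'.weight_add htL'
      have : t * m = i * m + j * m := by rw [← hij, add_mul]
      omega
    have huP : u ∈ P := by
      refine (hP u).2 ⟨hrange, mem_radInv_of_basis fun c hc => ?_⟩
      refine κ.tcoord_ext κ' fun i hi j hj s hs q hq => ?_
      rw [map_zero]
      rcases lt_or_ge q c with hqc | hqc
      · rw [hκ.tcoord_lie_rad_raising_of_lt hκ' hs hc hqc]
        by_cases hij : i + 1 + j = t
        · have s1 := hκ.step i (by omega)
          rw [hu (i + 1) (by omega) j hj (s + c) (by omega) q hq, if_neg (by omega)]
        · exact hrange _ _ _ _ hij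
      · obtain ⟨q, rfl⟩ := Nat.exists_eq_add_of_le' hqc
        rw [hκ.tcoord_lie_rad_raising hκ' hs hc]
        by_cases hij : i + 1 + j = t
        · have s1 := hκ.step i (by omega)
          have s2 := hκ'.step j (by omega)
          have w1 := hweight i hi (j + 1) (by omega) (by omega)
          rw [hu (i + 1) (by omega) j hj (s + c) (by omega) (q + c) hq]
          rcases le_or_gt q (n' (j + 1)) with hq' | hq'
          · rw [hu i hi (j + 1) (by omega) s hs q hq']
            by_cases hsq : s ≤ q
            · rw [if_pos (by omega), if_pos (by omega), Nat.add_sub_add_right, pow_succ]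
              ring
            · rw [if_neg (by omega), if_neg (by omega), add_zero]
          · rw [tcoord_eq_zero κ κ' (by omega), LinearMap.zero_apply, if_pos (by omega),
              (formDual F k).coord_eq_zero _ _ (Or.inr (by omega))]
            simp
        · rw [hrange _ _ _ _ hij, hrange _ _ _ _ (by omega), add_zero]
    refine ⟨⟨u, huP⟩, (formDual F k).ext_of_le fun i' hi' r hr => ?_⟩
    obtain rfl := Nat.le_zero.1 hi'
    rw [hΦ', hu 0 (by omega) t (by omega) 0 (by omega) r (by omega), if_pos (by omega)]
    simp

end LoweringRaising

section RaisingRaising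

/-- The invariants of `Z^* ⊗ Z^*` have degree `0`. The reason is that the radical acts on `Z^*`
through multiplication by binary forms, and that `e(x₁, y₁) p + e(x₂, y₂) q = 0` for all forms `e`
of degree `m ≥ 1` only if `p = q = 0`. -/
lemma IsRaising.tcoord_eq_zero (hm : 1 ≤ m) (hκ : κ.IsRaising m) (hκ' : κ'.IsRaising m)
    {u : M ⊗[F] N} (hu : u ∈ radInv F m (M ⊗[F] N)) (i j s q : ℕ) :
    κ.tcoord κ' i (j + 1) s q u = 0 := by
  have h0 : ∀ s q, κ.tcoord κ' (i + 1) j s q u = -κ.tcoord κ' i (j + 1) s q u := by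
    intro s q
    have := pairing_lie (fun v => hκ.lie_rad i s 0 v (Nat.zero_le _))
      (fun w => hκ'.lie_rad j q 0 w (Nat.zero_le _)) u
    rw [hu, map_zero] at this
    exact eq_neg_of_add_eq_zero_left this.symm
  induction s generalizing q with
  | zero =>
    have := pairing_lie (f' := 0) (fun v => hκ.lie_rad_of_lt i 0 1 v one_pos hm)
      (fun w => hκ'.lie_rad j q 1 w hm) u
    rw [hu, map_zero, pairing_zero_left, LinearMap.zero_apply, zero_add] at this
    exact this.symm
  | succ s ih =>
    have := pairing_lie (fun v => hκ.lie_rad i s 1 v hm) (fun w => hκ'.lie_rad j q 1 w hm) u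
    rw [hu, map_zero] at this
    have h1 := h0 s (q + 1)
    rw [ih, neg_zero] at h1
    unfold tcoord at h1 ⊢
    rw [h1, zero_add] at this
    exact this.symm

lemma IsRaising.eq_zero_of_homog (hm : 1 ≤ m) (hκ : κ.IsRaising m) (hκ' : κ'.IsRaising m)
    {t : ℕ} (ht : 1 ≤ t) {u : M ⊗[F] N} (hu : u ∈ radInv F m (M ⊗[F] N))
    (hut : u ∈ homog κ κ' t) : u = 0 := by
  obtain ⟨t, rfl⟩ := Nat.exists_eq_add_of_le' ht
  exact (hκ.isGraded hm).eq_zero_of_first (hκ'.isGraded hm) hu hut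
    (hκ.tcoord_eq_zero hm hκ' hu 0 t)

end RaisingRaising

end Coords

/-! ### Irreducibility of `V(n)` -/

section Irreducible

open Coords

variable {F : Type*} [Field F] [CharZero F]

/-- `V(n)` is irreducible: repeated application of `e` to a nonzero vector leads to a highest weight
vector, from which `f` produces everything else. -/
lemma submodule_form_eq_top {n : ℕ} {P : Submodule F (V F n)}
    (he : ∀ p ∈ P, ⁅sl2E F, p⁆ ∈ P) (hf : ∀ p ∈ P, ⁅sl2F F, p⁆ ∈ P) (hP : P ≠ ⊥) : P = ⊤ := by
  have hκ := form_isLowering (F := F) 0 n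
  set κ := form F n with hκdef
  -- induction on an upper bound `B` for the indices of the nonzero coordinates
  have h0 : ∀ B, ∀ p ∈ P, p ≠ 0 → (∀ r, B < r → κ.coord 0 r p = 0) → κ.vec 0 0 ∈ P := by
    intro B
    induction B with
    | zero =>
      intro p hp hp0 hr
      have hpv : p = κ.coord 0 0 p • κ.vec 0 0 := by
        refine κ.ext_of_le fun i hi s hs => ?_
        obtain rfl := Nat.le_zero.1 hi
        rw [map_smul, coord_vec', smul_eq_mul]
        rcases s with _ | s
        · simp
        · rw [hr _ (Nat.succ_pos s), if_neg (by omega), mul_zero]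
      rw [hpv] at hp hp0
      have hne : κ.coord 0 0 p ≠ 0 := fun h => hp0 (by rw [h, zero_smul])
      exact (P.smul_mem_iff hne).1 hp
    | succ B ih =>
      intro p hp hp0 hr
      by_cases hB : κ.coord 0 (B + 1) p = 0
      · refine ih p hp hp0 fun r hr' => ?_
        rcases Nat.eq_or_lt_of_le (Nat.succ_le_of_lt hr') with rfl | h
        · exact hB
        · exact hr r h
      · have hBn : B + 1 ≤ n := by
          by_contra h
          exact hB (by rw [κ.coord_eq_zero _ _ (Or.inr (by omega)), LinearMap.zero_apply])
        refine ih _ (he p hp) (fun h => ?_) fun r hr' => ?_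
        · have h1 := hκ.lie_e 0 B p
          rw [lie_leviIncl_form, h, map_zero] at h1
          have hne : (n - B : F) ≠ 0 := by
            rw [sub_ne_zero]
            exact_mod_cast (show n ≠ B by omega)
          exact (mul_ne_zero hne hB) h1.symm
        · have h1 := hκ.lie_e 0 r p
          rw [lie_leviIncl_form] at h1
          rw [h1, hr _ (by omega), mul_zero]
  obtain ⟨p, hp, hp0⟩ := P.ne_bot_iff.1 hP
  have hv0 := h0 n p hp hp0 fun r hr => by
    rw [κ.coord_eq_zero _ _ (Or.inr hr), LinearMap.zero_apply]
  have hv : ∀ s, κ.vec 0 s ∈ P := by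
    intro s
    induction s with
    | zero => exact hv0
    | succ s ih =>
      have h1 := hf _ ih
      have h2 := hκ.lie_f_vec 0 s
      rw [lie_leviIncl_form] at h2
      rw [h2] at h1
      exact (P.smul_mem_iff (by exact_mod_cast Nat.succ_ne_zero s)).1 h1
  rw [eq_top_iff]
  intro q _
  rw [← κ.basis.sum_repr q]
  refine P.sum_mem fun x _ => P.smul_mem _ ?_
  rw [← vec_eq_basis]
  obtain ⟨i, s⟩ := x
  obtain rfl : i = 0 := Fin.ext (by omega)
  exact hv s

lemma finrank_form (n : ℕ) : Module.finrank F (V F n) = n + 1 := by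
  rw [Module.finrank_eq_card_basis (form F n).basis]
  simp

instance (n : ℕ) : Module.Finite F (V F n) := Module.Finite.of_basis (form F n).basis

instance (n : ℕ) : Nontrivial (V F n) :=
  Module.nontrivial_of_finrank_pos (R := F) (by rw [finrank_form]; omega)

/-- A module which is linearly isomorphic to `V(n)`, compatibly with the actions of `e` and `f`, is
irreducible. -/
lemma isIrreducible_of_bijective {K : Type*} [LieRing K] [LieAlgebra F K] {P : Type*}
    [AddCommGroup P] [Module F P] [LieRingModule K P] [LieModule F K P] {n : ℕ}
    {g : V F n →ₗ[F] P} (hg : Function.Bijective g) {x y : K}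
    (hx : ∀ p, g ⁅sl2E F, p⁆ = ⁅x, g p⁆) (hy : ∀ p, g ⁅sl2F F, p⁆ = ⁅y, g p⁆) :
    LieModule.IsIrreducible F K P := by
  have : Nontrivial P := hg.1.nontrivial
  refine LieModule.IsIrreducible.mk fun R hR => ?_
  have h1 : R.toSubmodule.comap g = ⊤ := by
    refine submodule_form_eq_top (fun p hp => ?_) (fun p hp => ?_) fun h => hR ?_
    · rw [Submodule.mem_comap, hx]; exact R.lie_mem hp
    · rw [Submodule.mem_comap, hy]; exact R.lie_mem hp
    · rw [LieSubmodule.eq_bot_iff]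
      intro r hr
      obtain ⟨p, rfl⟩ := hg.2 r
      have : p ∈ R.toSubmodule.comap g := hr
      rw [h, Submodule.mem_bot] at this
      rw [this, map_zero]
  rw [eq_top_iff]
  intro r _
  obtain ⟨p, rfl⟩ := hg.2 r
  have : p ∈ R.toSubmodule.comap g := by rw [h1]; trivial
  exact this

end Irreducible

/-! ### Modules generated by copies of distinct `V(n)` -/

section Generated

open Coords

variable {F : Type*} [Field F] [CharZero F] {m : ℕ}
  {Q : Type*} [AddCommGroup Q] [Module F Q] [LieRingModule (𝔤 F m) Q] [LieModule F (𝔤 F m) Q]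

lemma casimir_form (hm : 1 ≤ m) {n : ℕ} (p : V F n) :
    casimir F m (V F n) p = (n * (n + 2) : F) • p := by
  refine (form F n).ext_of_le fun i hi s hs => ?_
  rw [((form_isLowering m n).isGraded hm).casimir, map_smul, smul_eq_mul]

lemma casimirValue_injective : Function.Injective fun n : ℕ => (n * (n + 2) : F) := by
  intro a b h
  have h' : a * (a + 2) = b * (b + 2) := by
    have h1 : (a * (a + 2) : F) = b * (b + 2) := h
    exact_mod_cast h1
  rcases lt_trichotomy a b with hab | hab | hab
  · nlinarith
  · exact hab
  · nlinarith

/-- Images of copies of distinct `V(n)` are independent, as the Casimir operator acts on them by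
distinct scalars. -/
lemma iSupIndep_range (hm : 1 ≤ m) {ι : Type*} {n : ι → ℕ} (hn : Function.Injective n)
    {g : ∀ x, V F (n x) →ₗ[F] Q} (hg : ∀ x, IsSlMap m (g x)) :
    iSupIndep fun x => LinearMap.range (g x) := by
  refine ((Module.End.eigenspaces_iSupIndep (casimir F m Q)).comp
    (casimirValue_injective.comp hn)).mono fun x => ?_
  rintro _ ⟨p, rfl⟩
  refine Module.End.mem_eigenspace_iff.2 ?_
  rw [← (hg x).casimir, casimir_form hm, map_smul]
  rfl

lemma levi_exists (x : levi F m) : ∃ A : sl2 F, (x : 𝔤 F m) = leviIncl F m A := by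
  obtain ⟨A, hA⟩ := x.2
  exact ⟨A, hA.symm⟩

/-- The element of the Levi factor given by an element of `sl(2)`. -/
def leviElt (m : ℕ) (A : sl2 F) : levi F m := ⟨leviIncl F m A, A, rfl⟩

/-- A module which is the sum of copies of distinct `V(n)` is their direct sum over the Levi
factor. -/
lemma exists_directSum_equiv (hm : 1 ≤ m) {ι : Type*} {n : ι → ℕ} (hn : Function.Injective n)
    {g : ∀ x, V F (n x) →ₗ[F] Q} (hg : ∀ x, IsSlMap m (g x))
    (hinj : ∀ x, Function.Injective (g x)) (htop : ⨆ x, LinearMap.range (g x) = ⊤) :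
    Nonempty (Q ≃ₗ⁅F, levi F m⁆ ⨁ x, V F (n x)) := by
  classical
  let e := (DFinsupp.mapRange.linearEquiv fun x => LinearEquiv.ofInjective (g x) (hinj x)) ≪≫ₗ
    (iSupIndep_range hm hn hg).linearEquiv htop
  let Ψ : (⨁ x, V F (n x)) ≃ₗ[F] Q := e
  have hΨ : ∀ x p, Ψ (DirectSum.lof F ι (fun x => V F (n x)) x p) = g x p := by
    intro x p
    change (iSupIndep_range hm hn hg).linearEquiv htop
      (DFinsupp.mapRange.linearEquiv (fun x => LinearEquiv.ofInjective (g x) (hinj x))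
        (DFinsupp.single x p)) = _
    rw [DFinsupp.mapRange.linearEquiv_apply, DFinsupp.mapRange_single,
      iSupIndep.linearEquiv_apply]
    simp
  have hlie : ∀ (y : levi F m) (z : ⨁ x, V F (n x)), Ψ ⁅y, z⁆ = ⁅y, Ψ z⁆ := by
    intro y z
    induction z using DirectSum.induction_on with
    | zero => rw [lie_zero, map_zero, lie_zero]
    | add z w hz hw => rw [lie_add, map_add, map_add, lie_add, hz, hw]
    | of x p =>
      have h1 := (DirectSum.lieModuleOf F ι (levi F m) (fun x => V F (n x)) x).map_lie y p
      have h2 : Ψ ⁅y, DirectSum.lof F ι (fun x => V F (n x)) x p⁆ =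
          Ψ (DirectSum.lof F ι (fun x => V F (n x)) x ⁅y, p⁆) := congrArg Ψ h1.symm
      obtain ⟨A, hA⟩ := levi_exists y
      change Ψ ⁅y, DirectSum.lof F ι (fun x => V F (n x)) x p⁆ =
        ⁅y, Ψ (DirectSum.lof F ι (fun x => V F (n x)) x p)⁆
      rw [h2, hΨ, hΨ, LieSubalgebra.coe_bracket_of_module, LieSubalgebra.coe_bracket_of_module,
        hA, hg]
  exact ⟨LieModuleEquiv.symm { Ψ with map_lie' := fun {y z} => hlie y z }⟩

/-- The range of an equivariant map as a submodule over the Levi factor. -/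
def leviRange {n : ℕ} {g : V F n →ₗ[F] Q} (hg : IsSlMap m g) : LieSubmodule F (levi F m) Q where
  toSubmodule := LinearMap.range g
  lie_mem := by
    rintro x _ ⟨p, rfl⟩
    obtain ⟨A, hA⟩ := levi_exists x
    rw [LieSubalgebra.coe_bracket_of_module, hA]
    exact ⟨⁅leviIncl F m A, p⁆, hg A p⟩

lemma isMultiplicityFree_of_range (hm : 1 ≤ m) {ι : Type*} {n : ι → ℕ}
    (hn : Function.Injective n) {g : ∀ x, V F (n x) →ₗ[F] Q} (hg : ∀ x, IsSlMap m (g x))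
    (hinj : ∀ x, Function.Injective (g x)) (htop : ⨆ x, LinearMap.range (g x) = ⊤) :
    IsMultiplicityFree F (levi F m) Q := by
  have hindep : iSupIndep fun x => leviRange (hg x) := by
    rw [← LieSubmodule.iSupIndep_toSubmodule]
    exact iSupIndep_range hm hn hg
  have heq : ∀ x, ∃ e : V F (n x) ≃ₗ[F] leviRange (hg x), ∀ p, (e p : Q) = g x p :=
    fun x => ⟨LinearEquiv.ofInjective (g x) (hinj x), fun p => rfl⟩
  refine ⟨Set.range fun x => leviRange (hg x), ?_, hindep.sSupIndep_range, ?_, ?_⟩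
  · rintro _ ⟨x, rfl⟩
    obtain ⟨e, he⟩ := heq x
    refine isIrreducible_of_bijective (g := (e : V F (n x) →ₗ[F] leviRange (hg x))) e.bijective
      (x := leviElt m (sl2E F)) (y := leviElt m (sl2F F)) (fun p => ?_) (fun p => ?_)
    all_goals
      apply Subtype.ext
      rw [LinearEquiv.coe_coe, he, LieSubmodule.coe_bracket, he]
      exact hg x _ p
  · rw [sSup_range, ← LieSubmodule.toSubmodule_inj, LieSubmodule.iSup_toSubmodule]
    exact htop
  · rintro _ ⟨x, rfl⟩ _ ⟨y, rfl⟩ ⟨φ⟩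
    obtain ⟨e, -⟩ := heq x
    obtain ⟨e', -⟩ := heq y
    have h1 := (e ≪≫ₗ φ.toLinearEquiv ≪≫ₗ e'.symm).finrank_eq
    rw [finrank_form, finrank_form] at h1
    obtain rfl := hn (Nat.succ_injective h1)
    rfl

variable (m Q) in
/-- `Q` is the sum of one copy of `V(k)` for every `k` in the set `A`. The maps `g k` for `k ∉ A` are
irrelevant. The sum is direct by `iSupIndep_range`. -/
def IsSumOfForms (A : Set ℕ) : Prop :=
  ∃ g : ∀ k, V F k →ₗ[F] Q, (∀ k, IsSlMap m (g k)) ∧ (∀ k ∈ A, Function.Injective (g k)) ∧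
    ⨆ k ∈ A, LinearMap.range (g k) = ⊤

lemma isSlMap_zero {P : Type*} [AddCommGroup P] [Module F P] [LieRingModule (𝔤 F m) P]
    [LieModule F (𝔤 F m) P] : IsSlMap m (0 : P →ₗ[F] Q) := fun A v => by simp

lemma IsSumOfForms.of_index {ι : Type*} {n : ι → ℕ} (hn : Function.Injective n)
    {g : ∀ x, V F (n x) →ₗ[F] Q} (hg : ∀ x, IsSlMap m (g x))
    (hinj : ∀ x, Function.Injective (g x)) (htop : ⨆ x, LinearMap.range (g x) = ⊤) :
    IsSumOfForms (F := F) m Q (Set.range n) := by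
  have key : ∀ k, ∃ g' : V F k →ₗ[F] Q, IsSlMap m g' ∧ ∀ x, n x = k →
      Function.Injective g' ∧ LinearMap.range g' = LinearMap.range (g x) := by
    intro k
    by_cases h : ∃ x, n x = k
    · obtain ⟨x, rfl⟩ := h
      refine ⟨g x, hg x, fun y hy => ?_⟩
      obtain rfl := hn hy
      exact ⟨hinj y, rfl⟩
    · exact ⟨0, isSlMap_zero, fun x hx => absurd ⟨x, hx⟩ h⟩
  choose g' hg' hg'' using key
  refine ⟨g', hg', ?_, ?_⟩
  · rintro _ ⟨x, rfl⟩
    exact (hg'' _ x rfl).1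
  · rw [iSup_range, ← htop]
    exact iSup_congr fun x => (hg'' _ x rfl).2

lemma IsSumOfForms.exists_equiv {A : Set ℕ} (h : IsSumOfForms (F := F) m Q A) (hm : 1 ≤ m)
    {ι : Type*} {n : ι → ℕ} (hn : Function.Injective n) (hA : Set.range n = A) :
    Nonempty (Q ≃ₗ⁅F, levi F m⁆ ⨁ x, V F (n x)) := by
  obtain ⟨g, hg, hinj, htop⟩ := h
  subst hA
  rw [iSup_range] at htop
  exact exists_directSum_equiv hm hn (fun x => hg (n x)) (fun x => hinj _ ⟨x, rfl⟩) htop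

lemma IsSumOfForms.isMultiplicityFree {A : Set ℕ} (h : IsSumOfForms (F := F) m Q A)
    (hm : 1 ≤ m) : IsMultiplicityFree F (levi F m) Q := by
  obtain ⟨g, hg, hinj, htop⟩ := h
  refine isMultiplicityFree_of_range hm (n := fun x : A => (x : ℕ)) Subtype.val_injective
    (fun x => hg x) (fun x => hinj x x.2) ?_
  rw [← htop, iSup_subtype']

/-- Copies of `V(n)` annihilated by the radical are contained in the socle. -/
lemma range_le_socle {n : ℕ} {g : V F n →ₗ[F] Q} (hg : IsSlMap m g)
    (hinj : Function.Injective g) (hrad : ∀ p, g p ∈ radInv F m Q) :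
    LinearMap.range g ≤ (socle F (𝔤 F m) Q).toSubmodule := by
  let R : LieSubmodule F (𝔤 F m) Q :=
    { LinearMap.range g with
      lie_mem := by
        rintro x _ ⟨p, rfl⟩
        rw [lie_split x (g p), hrad p, zero_add]
        exact ⟨⁅leviIncl F m x.right, p⁆, hg _ p⟩ }
  let e : V F n ≃ₗ[F] R := LinearEquiv.ofInjective g hinj
  have he : ∀ p, (e p : Q) = g p := fun p => rfl
  have hR : LieModule.IsIrreducible F (𝔤 F m) R := by
    refine isIrreducible_of_bijective (g := (e : V F n →ₗ[F] R)) e.bijective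
      (x := leviIncl F m (sl2E F)) (y := leviIncl F m (sl2F F)) (fun p => ?_) (fun p => ?_)
    all_goals
      apply Subtype.ext
      rw [LinearEquiv.coe_coe, he, LieSubmodule.coe_bracket, he]
      exact hg _ p
  have hle : R ≤ socle F (𝔤 F m) Q := le_sSup hR
  exact hle

end Generated

/-! ### The Clebsch–Gordan decomposition -/

section ClebschGordan

open Coords

variable {F : Type*} [Field F] [CharZero F] (m : ℕ)

/-- Multiplication of binary forms. -/
def mulForm (F : Type*) [Field F] (a b : ℕ) : V F a ⊗[F] V F b →ₗ[F] V F (a + b) :=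
  TensorProduct.lift (LinearMap.mk₂ F
    (fun p q => homForm (V.incl F a p * V.incl F b q) ((V.isHomogeneous p).mul (V.isHomogeneous q)))
    (fun p p' q => V.ext (by simp only [incl_homForm, map_add, add_mul]))
    (fun c p q => V.ext (by simp only [incl_homForm, map_smul, smul_mul_assoc]))
    (fun p q q' => V.ext (by simp only [incl_homForm, map_add, mul_add]))
    (fun c p q => V.ext (by simp only [incl_homForm, map_smul, mul_smul_comm])))

lemma incl_mulForm_tmul {a b : ℕ} (p : V F a) (q : V F b) :
    V.incl F (a + b) (mulForm F a b (p ⊗ₜ[F] q)) = V.incl F a p * V.incl F b q := rfl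

lemma isSlMap_mulForm (a b : ℕ) : IsSlMap m (mulForm F a b) := by
  intro A u
  induction u with
  | zero => simp
  | add u v hu hv => rw [lie_add, map_add, map_add, lie_add, hu, hv]
  | tmul p q =>
    apply V.ext
    rw [TensorProduct.LieModule.lie_tmul_right, map_add, map_add, incl_mulForm_tmul,
      incl_mulForm_tmul, lie_leviIncl_form, lie_leviIncl_form, lie_leviIncl_form, V.incl_lie,
      V.incl_lie, V.incl_lie, incl_mulForm_tmul, Derivation.leibniz, smul_eq_mul, smul_eq_mul]
    ring

lemma pairing_map {P P' Q Q' : Type*} [AddCommGroup P] [Module F P] [AddCommGroup P'] [Module F P']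
    [AddCommGroup Q] [Module F Q] [AddCommGroup Q'] [Module F Q'] (f : P' →ₗ[F] F)
    (g : Q' →ₗ[F] F) (D : P →ₗ[F] P') (D' : Q →ₗ[F] Q') (u : P ⊗[F] Q) :
    pairing f g (TensorProduct.map D D' u) = pairing (f ∘ₗ D) (g ∘ₗ D') u := by
  induction u with
  | zero => simp
  | add u v hu hv => rw [map_add, map_add, map_add, hu, hv]
  | tmul p q => simp

/-- A nonzero equivariant map to `V(n)` is surjective. -/
lemma IsSlMap.surjective {P : Type*} [AddCommGroup P] [Module F P] [LieRingModule (𝔤 F m) P]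
    [LieModule F (𝔤 F m) P] {n : ℕ} {φ : P →ₗ[F] V F n} (hφ : IsSlMap m φ) (h : φ ≠ 0) :
    Function.Surjective φ := by
  rw [← LinearMap.range_eq_top]
  refine submodule_form_eq_top ?_ ?_ fun h0 => h (LinearMap.range_eq_bot.1 h0)
  all_goals
    rintro _ ⟨v, rfl⟩
    exact ⟨_, hφ _ v⟩

lemma incl_ne_zero {n : ℕ} {p : V F n} (hp : p ≠ 0) : V.incl F n p ≠ 0 := fun h =>
  hp (V.ext (by rw [h, map_zero]))

lemma mulForm_tmul_ne_zero {a b : ℕ} {p : V F a} {q : V F b} (hp : p ≠ 0) (hq : q ≠ 0) :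
    mulForm F a b (p ⊗ₜ[F] q) ≠ 0 := by
  intro h
  have h1 := incl_mulForm_tmul p q
  rw [h, map_zero] at h1
  exact mul_ne_zero (incl_ne_zero hp) (incl_ne_zero hq) h1.symm

lemma mulForm_surjective (a b : ℕ) : Function.Surjective (mulForm F a b) := by
  refine (isSlMap_mulForm 0 a b).surjective 0 fun h => ?_
  obtain ⟨p, hp⟩ := exists_ne (0 : V F a)
  obtain ⟨q, hq⟩ := exists_ne (0 : V F b)
  exact mulForm_tmul_ne_zero hp hq (by rw [h, LinearMap.zero_apply])

/-- The equivariant operator `∂_{x₁} ∂_{y₂} - ∂_{y₁} ∂_{x₂}` (Cayley's `Ω`-process), in divided-power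
coordinates. -/
lemma exists_cayley (a b : ℕ) :
    ∃ Ω : V F (a + 1) ⊗[F] V F (b + 1) →ₗ[F] V F a ⊗[F] V F b,
      IsSlMap m Ω ∧ ∀ u, ∀ s ≤ a, ∀ q ≤ b, (form F a).tcoord (form F b) 0 0 s q (Ω u) =
        (form F (a + 1)).tcoord (form F (b + 1)) 0 0 s (q + 1) u -
          (form F (a + 1)).tcoord (form F (b + 1)) 0 0 (s + 1) q u := by
  let D (c a : ℕ) : V F (a + 1) →ₗ[F] V F a := lower (m := 1) rfl (radBasis F 1 c)
  have hD : ∀ c a s, c ≤ 1 → s ≤ a →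
      (form F a).coord 0 s ∘ₗ D c a = (form F (a + 1)).coord 0 (s + c) := by
    intro c a s hc hs
    ext p
    exact formCoord_lower_radBasis rfl hc hs p
  let Ω := TensorProduct.map (D 0 a) (D 1 b) - TensorProduct.map (D 1 a) (D 0 b)
  have hΩ : ∀ u, ∀ s ≤ a, ∀ q ≤ b, (form F a).tcoord (form F b) 0 0 s q (Ω u) =
      (form F (a + 1)).tcoord (form F (b + 1)) 0 0 s (q + 1) u -
        (form F (a + 1)).tcoord (form F (b + 1)) 0 0 (s + 1) q u := by
    intro u s hs q hq
    simp only [Ω, tcoord, LinearMap.sub_apply, map_sub, pairing_map,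
      hD 0 a s (Nat.zero_le _) hs, hD 1 a s le_rfl hs, hD 0 b q (Nat.zero_le _) hq,
      hD 1 b q le_rfl hq, add_zero]
  have fa := form_isLowering (F := F) m a
  have fb := form_isLowering (F := F) m b
  have fa' := form_isLowering (F := F) m (a + 1)
  have fb' := form_isLowering (F := F) m (b + 1)
  refine ⟨Ω, isSlMap_of_sl2E_sl2F m (fun u => ?_) (fun u => ?_), hΩ⟩
  · refine tcoord_ext (form F a) (form F b) fun i hi j hj s hs q hq => ?_
    obtain rfl := Nat.le_zero.1 hi
    obtain rfl := Nat.le_zero.1 hj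
    have e1 : (a - s : F) * (form F a).tcoord (form F b) 0 0 (s + 1) q (Ω u) = (a - s : F) *
        ((form F (a + 1)).tcoord (form F (b + 1)) 0 0 (s + 1) (q + 1) u -
          (form F (a + 1)).tcoord (form F (b + 1)) 0 0 (s + 1 + 1) q u) := by
      rcases hs.eq_or_lt with rfl | hs
      · simp
      · rw [hΩ _ _ hs _ hq]
    have e2 : (b - q : F) * (form F a).tcoord (form F b) 0 0 s (q + 1) (Ω u) = (b - q : F) *
        ((form F (a + 1)).tcoord (form F (b + 1)) 0 0 s (q + 1 + 1) u -
          (form F (a + 1)).tcoord (form F (b + 1)) 0 0 (s + 1) (q + 1) u) := by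
      rcases hq.eq_or_lt with rfl | hq
      · simp
      · rw [hΩ _ _ hs _ hq]
    rw [hΩ _ _ hs _ hq, fa.tcoord_lie_e fb, e1, e2, fa'.tcoord_lie_e fb', fa'.tcoord_lie_e fb']
    push_cast; ring
  · refine tcoord_ext (form F a) (form F b) fun i hi j hj s hs q hq => ?_
    obtain rfl := Nat.le_zero.1 hi
    obtain rfl := Nat.le_zero.1 hj
    have e1 : (s : F) * (form F a).tcoord (form F b) 0 0 (s - 1) q (Ω u) = (s : F) *
        ((form F (a + 1)).tcoord (form F (b + 1)) 0 0 (s - 1) (q + 1) u -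
          (form F (a + 1)).tcoord (form F (b + 1)) 0 0 s q u) := by
      rcases s with _ | s
      · simp
      · rw [hΩ _ _ (by omega) _ hq]; rfl
    have e2 : (q : F) * (form F a).tcoord (form F b) 0 0 s (q - 1) (Ω u) = (q : F) *
        ((form F (a + 1)).tcoord (form F (b + 1)) 0 0 s q u -
          (form F (a + 1)).tcoord (form F (b + 1)) 0 0 (s + 1) (q - 1) u) := by
      rcases q with _ | q
      · simp
      · rw [hΩ _ _ hs _ (by omega)]; rfl
    rw [hΩ _ _ hs _ hq, fa.tcoord_lie_f fb hs hq, e1, e2, fa'.tcoord_lie_f fb' (by omega) (by omega),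
      fa'.tcoord_lie_f fb' (by omega) (by omega), Nat.add_sub_cancel, Nat.add_sub_cancel]
    push_cast; ring

/-- `V(a + 1) ⊗ V(b + 1)` is the direct sum of the image of `V(a + b + 2)` under polarization and a
copy of `V(a) ⊗ V(b)`. -/
lemma exists_split (a b : ℕ) :
    ∃ Θ : V F (a + 1) ⊗[F] V F (b + 1) ≃ₗ[F] V F (a + 1 + (b + 1)) × (V F a ⊗[F] V F b),
      ∀ (A : sl2 F) u, Θ ⁅leviIncl F m A, u⁆ =
        (⁅leviIncl F m A, (Θ u).1⁆, ⁅leviIncl F m A, (Θ u).2⁆) := by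
  obtain ⟨Ω, hΩ, hcoord⟩ := exists_cayley (F := F) m a b
  have hR := isSlMap_mulForm (F := F) m (a + 1) (b + 1)
  set R := mulForm F (a + 1) (b + 1)
  -- the coordinates of an element of the kernel of `Ω` only depend on the sum of the indices, so
  -- that this kernel embeds into `V(a + b + 2)`; the image of its intersection `K` with the
  -- kernel of `R` is proper, and hence zero, as `R` does not kill the product of the highest weight
  -- vectors
  let K : LieSubmodule F (𝔤 F m) (V F (a + 1) ⊗[F] V F (b + 1)) :=
    { LinearMap.ker R ⊓ LinearMap.ker Ω with
      lie_mem := by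
        rintro x u ⟨h1, h2⟩
        have h3 : ⁅radIncl F m x.left, u⁆ = 0 := by
          refine tcoord_ext (form F (a + 1)) (form F (b + 1)) fun i _ j _ s _ q _ => ?_
          have h4 := pairing_lie (x := radIncl F m x.left) (f := (form F (a + 1)).coord i s)
            (f' := 0) (g := (form F (b + 1)).coord j q) (g' := 0)
            (fun v => by rw [lie_radIncl_form]; simp) (fun v => by rw [lie_radIncl_form]; simp) u
          rw [map_zero, tcoord, h4]
          simp
        rw [lie_split x u, h3, zero_add]
        refine ⟨?_, ?_⟩
        · have : R u = 0 := h1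
          change R _ = 0
          rw [hR, this, lie_zero]
        · have : Ω u = 0 := h2
          change Ω _ = 0
          rw [hΩ, this, lie_zero] }
  have hK : K = ⊥ := by
    obtain ⟨Φ, hΦ, h1⟩ := (form_isLowering (F := F) m (a + 1)).exists_isSlMap
      (form_isLowering (F := F) m (b + 1)) (i := 0) (j := 0) rfl (P := K) (ι := K.incl)
      (fun A v => rfl) <| by
        intro u s q hs hq
        have h2 := hcoord u.1 s (by omega) q (by omega)
        have h3 : Ω u.1 = 0 := u.2.2
        rw [h3, map_zero] at h2
        exact (sub_eq_zero.1 h2.symm).symm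
    have hzero : Φ = 0 := by
      by_contra hne
      obtain ⟨u, hu⟩ := hΦ.surjective m hne ((form F _).vec 0 0)
      have h2 : u.1 = (form F (a + 1)).vec 0 0 ⊗ₜ[F] (form F (b + 1)).vec 0 0 := by
        refine tcoord_ext (form F (a + 1)) (form F (b + 1)) fun i hi j hj s hs q hq => ?_
        obtain rfl := Nat.le_zero.1 hi
        obtain rfl := Nat.le_zero.1 hj
        have h3 := h1 u s hs q hq
        rw [hu, coord_vec'] at h3
        refine h3.trans ?_
        rw [tcoord, pairing_tmul, coord_vec', coord_vec']
        rcases s with _ | s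
        · rcases q with _ | q <;> simp
        · simp
      have h4 : R u.1 = 0 := u.2.1
      rw [h2] at h4
      refine mulForm_tmul_ne_zero ?_ ?_ h4
      all_goals
        intro h5
        have h6 := (coord_vec' _ 0 0 0 0).symm.trans
          (congrArg (fun v => (form F _).coord 0 0 v) h5)
        simp at h6
    rw [LieSubmodule.eq_bot_iff]
    intro u hu
    refine tcoord_ext (form F (a + 1)) (form F (b + 1)) fun i hi j hj s hs q hq => ?_
    obtain rfl := Nat.le_zero.1 hi
    obtain rfl := Nat.le_zero.1 hj
    have h3 := h1 ⟨u, hu⟩ s hs q hq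
    rw [hzero, LinearMap.zero_apply, map_zero] at h3
    rw [map_zero]
    exact h3
  have hinj : Function.Injective (R.prod Ω) := by
    rw [← LinearMap.ker_eq_bot, LinearMap.ker_prod]
    exact congrArg LieSubmodule.toSubmodule hK
  refine ⟨LinearMap.linearEquivOfInjective (R.prod Ω) hinj ?_, fun A u => ?_⟩
  · rw [Module.finrank_tensorProduct, Module.finrank_prod, Module.finrank_tensorProduct]
    simp only [finrank_form]
    ring
  · rw [LinearMap.linearEquivOfInjective_apply, LinearMap.linearEquivOfInjective_apply]
    change (R _, Ω _) = (⁅_, R u⁆, ⁅_, Ω u⁆)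
    rw [hR, hΩ]

/-- The highest weights occurring in `V(a) ⊗ V(b)`. -/
def cgSet (a b : ℕ) : Set ℕ := {k | ∃ i ≤ min a b, k = a + b - 2 * i}

lemma cgSet_succ (a b : ℕ) : cgSet (a + 1) (b + 1) = insert (a + 1 + (b + 1)) (cgSet a b) := by
  ext k
  constructor
  · rintro ⟨i, hi, rfl⟩
    rcases i with _ | i
    · left; rfl
    · right; exact ⟨i, by omega, by omega⟩
  · rintro (rfl | ⟨i, hi, rfl⟩)
    · exact ⟨0, by omega, rfl⟩
    · exact ⟨i + 1, by omega, by omega⟩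

/-- If `a = 0` or `b = 0`, then multiplication is an isomorphism `V(a) ⊗ V(b) ≃ V(a + b)`. -/
lemma isSumOfForms_of_min_eq_zero {a b : ℕ} (h : min a b = 0) :
    IsSumOfForms (F := F) m (V F a ⊗[F] V F b) (cgSet a b) := by
  have hinj : Function.Injective (mulForm F a b) := by
    refine (LinearMap.injective_iff_surjective_of_finrank_eq_finrank ?_).2 (mulForm_surjective a b)
    rw [Module.finrank_tensorProduct, finrank_form, finrank_form, finrank_form]
    rcases Nat.eq_zero_or_pos a with rfl | ha
    · ring
    · obtain rfl : b = 0 := by omega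
      ring
  let φ := LinearEquiv.ofBijective (mulForm F a b) ⟨hinj, mulForm_surjective a b⟩
  have h1 := IsSumOfForms.of_index (F := F) (m := m) (ι := Unit) (n := fun _ => a + b)
    (g := fun _ => (φ.symm : V F (a + b) →ₗ[F] V F a ⊗[F] V F b))
    (fun _ _ _ => rfl) (fun _ => IsSlMap.symm m (φ := φ) (isSlMap_mulForm m a b))
    (fun _ => φ.symm.injective) (by
      rw [iSup_unique]
      exact LinearEquiv.range φ.symm)
  convert h1 using 1
  ext k
  simp only [cgSet, h, Set.mem_ofPred_eq, Set.mem_range]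
  constructor
  · rintro ⟨i, hi, rfl⟩
    exact ⟨(), by omega⟩
  · rintro ⟨-, rfl⟩
    exact ⟨0, le_rfl, rfl⟩

/-- The Clebsch–Gordan decomposition `V(a) ⊗ V(b) = V(a + b) ⊕ V(a + b - 2) ⊕ ⋯ ⊕ V(|a - b|)`. -/
theorem clebschGordan (a b : ℕ) : IsSumOfForms (F := F) m (V F a ⊗[F] V F b) (cgSet a b) := by
  induction a generalizing b with
  | zero => exact isSumOfForms_of_min_eq_zero m (Nat.zero_min b)
  | succ a ih =>
    rcases b with _ | b
    · exact isSumOfForms_of_min_eq_zero m (Nat.min_zero _)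
    obtain ⟨g, hg, hinj, htop⟩ := ih b
    obtain ⟨Θ, hΘ⟩ := exists_split (F := F) m a b
    let σ₁ : V F (a + 1 + (b + 1)) →ₗ[F] V F (a + 1) ⊗[F] V F (b + 1) :=
      (Θ.symm : _ →ₗ[F] V F (a + 1) ⊗[F] V F (b + 1)) ∘ₗ
        LinearMap.inl F (V F (a + 1 + (b + 1))) (V F a ⊗[F] V F b)
    let σ₂ : V F a ⊗[F] V F b →ₗ[F] V F (a + 1) ⊗[F] V F (b + 1) :=
      (Θ.symm : _ →ₗ[F] V F (a + 1) ⊗[F] V F (b + 1)) ∘ₗ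
        LinearMap.inr F (V F (a + 1 + (b + 1))) (V F a ⊗[F] V F b)
    have hσ₁ : IsSlMap m σ₁ := by
      intro A p
      apply Θ.injective
      rw [hΘ]
      simp [σ₁]
    have hσ₂ : IsSlMap m σ₂ := by
      intro A p
      apply Θ.injective
      rw [hΘ]
      simp [σ₂]
    have hN : ∀ k ∈ cgSet a b, k ≠ a + 1 + (b + 1) := by
      rintro _ ⟨i, hi, rfl⟩
      omega
    let g' : ∀ k, V F k →ₗ[F] V F (a + 1) ⊗[F] V F (b + 1) :=
      Function.update (fun k => σ₂ ∘ₗ g k) (a + 1 + (b + 1)) σ₁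
    have hg'1 : g' (a + 1 + (b + 1)) = σ₁ := Function.update_self _ _ _
    have hg'2 : ∀ k ≠ a + 1 + (b + 1), g' k = σ₂ ∘ₗ g k := fun k hk =>
      Function.update_of_ne hk _ _
    rw [cgSet_succ]
    refine ⟨g', fun k => ?_, ?_, ?_⟩
    · by_cases hk : k = a + 1 + (b + 1)
      · subst hk
        rw [hg'1]; exact hσ₁
      · rw [hg'2 k hk]; exact IsSlMap.comp m hσ₂ (hg k)
    · rintro k (rfl | hk)
      · rw [hg'1]
        exact Θ.symm.injective.comp LinearMap.inl_injective
      · rw [hg'2 k (hN k hk)]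
        exact (Θ.symm.injective.comp LinearMap.inr_injective).comp (hinj k hk)
    · rw [eq_top_iff, iSup_insert]
      intro u _
      have hu : u = σ₁ (Θ u).1 + σ₂ (Θ u).2 := by
        apply Θ.injective
        simp [σ₁, σ₂]
      rw [hu]
      refine Submodule.add_mem_sup ⟨(Θ u).1, by rw [hg'1]⟩ ?_
      have h1 : σ₂ (Θ u).2 ∈ (⨆ k ∈ cgSet a b, LinearMap.range (g k)).map σ₂ := by
        rw [htop]; exact ⟨_, trivial, rfl⟩
      simp only [Submodule.map_iSup] at h1
      refine (iSup₂_mono fun k hk => ?_ : (_ : Submodule F _) ≤ _) h1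
      rw [hg'2 k (hN k hk), LinearMap.range_comp]

end ClebschGordan

/-! ### Socle decompositions in coordinates -/

section SocleDecomposition

open Coords

variable {F : Type*} [Field F] {m : ℕ}
  {M : Type*} [AddCommGroup M] [Module F M]
  {N : Type*} [AddCommGroup N] [Module F N]
  {L L' : ℕ} {n n' : ℕ → ℕ}

/-- The part of degree `i` of a space with coordinates. -/
def Coords.layer (κ : Coords F M L n) (i : ℕ) : Submodule F M where
  carrier := {v | ∀ k s, k ≠ i → κ.coord k s v = 0}
  add_mem' hu hv k s h := by rw [map_add, hu k s h, hv k s h, add_zero]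
  zero_mem' k s _ := map_zero _
  smul_mem' c u hu k s h := by rw [map_smul, hu k s h, smul_zero]

lemma Coords.vec_mem_layer (κ : Coords F M L n) (i s : ℕ) : κ.vec i s ∈ κ.layer i := by
  intro k r hk
  by_cases h : L < i ∨ n i < s
  · rw [κ.vec_eq_zero h, map_zero]
  · push Not at h
    rw [κ.coord_vec h.1 h.2, if_neg fun h' => hk h'.1]

lemma Coords.finrank_layer_le (κ : Coords F M L n) (i : ℕ) :
    Module.finrank F (κ.layer i) ≤ n i + 1 := by
  let Φ : κ.layer i →ₗ[F] (Fin (n i + 1) → F) :=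
    LinearMap.pi fun s => κ.coord i s ∘ₗ (κ.layer i).subtype
  have hΦ : Function.Injective Φ := by
    rw [← LinearMap.ker_eq_bot, LinearMap.ker_eq_bot']
    intro v hv
    refine Subtype.ext (κ.ext v.1 fun k s => ?_)
    by_cases hk : k = i
    · subst hk
      rcases le_or_gt s (n k) with hs | hs
      · exact congrFun hv ⟨s, Nat.lt_succ_of_le hs⟩
      · rw [κ.coord_eq_zero k s (Or.inr hs), LinearMap.zero_apply]
    · exact v.2 k s hk
  have := LinearMap.finrank_le_finrank_of_injective hΦ
  simpa using this

variable [LieRingModule (𝔤 F m) M] [LieModule F (𝔤 F m) M]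
  [LieRingModule (𝔤 F m) N] [LieModule F (𝔤 F m) N]

/-- An isomorphism over the Levi factor with `V(k)` as an equivariant parametrization. -/
lemma exists_isSlMap_of_equiv {P : LieSubmodule F (levi F m) M} {k : ℕ}
    (h : Nonempty (P ≃ₗ⁅F, levi F m⁆ V F k)) :
    ∃ g : V F k →ₗ[F] M, IsSlMap m g ∧ Function.Injective g ∧
      LinearMap.range g = P.toSubmodule := by
  obtain ⟨φ⟩ := h
  let e : V F k ≃ₗ[F] P := φ.symm.toLinearEquiv
  refine ⟨P.toSubmodule.subtype ∘ₗ (e : V F k →ₗ[F] P), fun A p => ?_, ?_, ?_⟩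
  · exact congrArg (fun z : P => (z : M)) (lieModuleEquiv_map_lie φ.symm (leviElt m A) p)
  · exact Subtype.val_injective.comp e.injective
  · rw [LinearMap.range_comp, LinearEquiv.range, Submodule.map_top, Submodule.range_subtype]

variable [CharZero F]

/-- The degrees of a graded module can be told apart by the Casimir operator, and hence each copy of
some `V(k)` is the part of a certain degree. -/
lemma Coords.IsGraded.exists_range_eq_layer {κ : Coords F M L n} (hκ : κ.IsGraded m) (hm : 1 ≤ m)
    {k : ℕ} {g : V F k →ₗ[F] M} (hg : IsSlMap m g) (hinj : Function.Injective g) :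
    ∃ i ≤ L, n i = k ∧ LinearMap.range g = κ.layer i := by
  have key : ∀ p j s, κ.coord j s (g p) ≠ 0 → j ≤ L ∧ n j = k := by
    intro p j s h
    refine ⟨?_, casimirValue_injective (F := F) ?_⟩
    · by_contra hj
      exact h (by rw [κ.coord_eq_zero j s (Or.inl (by omega)), LinearMap.zero_apply])
    · have h1 := hκ.casimir j s (g p)
      rw [← hg.casimir, casimir_form hm, map_smul, map_smul, smul_eq_mul] at h1
      exact (mul_right_cancel₀ h h1).symm
  obtain ⟨p, hp⟩ := exists_ne (0 : V F k)
  have hgp : g p ≠ 0 := fun h => hp (hinj (by rw [h, map_zero]))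
  have : ∃ i s, κ.coord i s (g p) ≠ 0 := by
    by_contra! h
    exact hgp (κ.ext _ h)
  obtain ⟨i, s, his⟩ := this
  obtain ⟨hi, rfl⟩ := key p i s his
  refine ⟨i, hi, rfl, ?_⟩
  have : Module.Finite F M := Module.Finite.of_basis κ.basis
  refine Submodule.eq_of_le_of_finrank_le ?_ ?_
  · rintro _ ⟨q, rfl⟩ j r hj
    by_contra h
    obtain ⟨hj', hn⟩ := key q j r h
    exact hj (hκ.inj j hj' i hi hn)
  · rw [LinearMap.finrank_range_of_inj hinj, finrank_form]
    exact κ.finrank_layer_le i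

/-- The members of a socle decomposition are the parts of the various degrees, in this order. -/
lemma Coords.IsGraded.eq_layer {κ : Coords F M L n} (hκ : κ.IsGraded m) (hm : 1 ≤ m)
    {l : ℕ} {a : ℕ → ℕ} {U : Fin (l + 1) → LieSubmodule F (levi F m) M}
    (hU : IsSocleDecomposition U)
    (hUa : ∀ i : Fin (l + 1), Nonempty (U i ≃ₗ⁅F, levi F m⁆ V F (a i))) :
    l = L ∧ ∀ i : Fin (l + 1), a i = n i ∧ (U i).toSubmodule = κ.layer i := by
  have h1 : ∀ i : Fin (l + 1), ∃ k ≤ L, n k = a i ∧ (U i).toSubmodule = κ.layer k := by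
    intro i
    obtain ⟨g, hg, hinj, hr⟩ := exists_isSlMap_of_equiv (hUa i)
    obtain ⟨k, hk, hn, h⟩ := hκ.exists_range_eq_layer hm hg hinj
    exact ⟨k, hk, hn, hr ▸ h⟩
  choose σ hσL hσn hσU using h1
  -- `σ` is a bijection onto `{0, …, L}` which is forced to be the identity
  have hσinj : Function.Injective σ := by
    intro i j hij
    by_contra hne
    have h2 := hU.isInternal.submodule_iSupIndep.pairwiseDisjoint hne
    simp only [Function.onFun, hσU, hij, disjoint_self] at h2
    have h3 := κ.vec_mem_layer (σ j) 0
    rw [h2, Submodule.mem_bot] at h3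
    have h4 := κ.coord_vec (hσL j) (Nat.zero_le _) (σ j) 0
    rw [h3, map_zero] at h4
    simp at h4
  have hσsurj : ∀ k ≤ L, ∃ i, σ i = k := by
    intro k hk
    by_contra! h
    have h2 : ⨆ i, (U i).toSubmodule ≤ LinearMap.ker (κ.coord k 0) := by
      refine iSup_le fun i v hv => ?_
      rw [hσU] at hv
      exact hv k 0 (h i).symm
    rw [hU.isInternal.submodule_iSup_eq_top] at h2
    have h3 : κ.coord k 0 (κ.vec k 0) = 0 := h2 trivial
    rw [κ.coord_vec hk (Nat.zero_le _)] at h3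
    simp at h3
  -- the radical maps the part of degree `k + 1` nontrivially to the part of degree `k`
  have hσmono : ∀ k i, σ i = k + 1 → ∃ j ≤ i, σ j = k := by
    intro k i hi
    by_contra! h
    obtain ⟨c, -, s, hcs⟩ := hκ.exists_lie_rad k 0
    have hv : κ.vec (k + 1) 0 ∈ U i := by
      rw [← LieSubmodule.mem_toSubmodule, hσU, hi]
      exact κ.vec_mem_layer _ _
    have h2 : ⨆ j : Fin (l + 1), ⨆ _ : j ≤ i, (U j).toSubmodule ≤
        LinearMap.ker (κ.coord k s) := by
      refine iSup₂_le fun j hj v hv => ?_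
      rw [hσU] at hv
      exact hv k s (h j hj).symm
    have h3 := h2 (hU.rad_lie_mem i (radBasis F m c) _ hv)
    rw [LinearMap.mem_ker, hcs, κ.coord_vec (hi ▸ hσL i) (Nat.zero_le _)] at h3
    simp at h3
  have hle : ∀ k i, σ i = k → k ≤ i := by
    intro k
    induction k with
    | zero => intro i _; exact Nat.zero_le _
    | succ k ih =>
      intro i hi
      obtain ⟨j, hji, hj⟩ := hσmono k i hi
      have hne : j ≠ i := by rintro rfl; omega
      have h2 := ih j hj
      have h3 : (j : ℕ) < i := (lt_of_le_of_ne hji hne : j < i)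
      omega
  have hid : ∀ k, ∀ i : Fin (l + 1), (i : ℕ) = k → σ i = k := by
    intro k
    induction k using Nat.strong_induction_on with
    | _ k ih =>
      intro i hi
      rcases (hi ▸ hle _ i rfl : σ i ≤ k).eq_or_lt with h | h
      · exact h
      · have h2 := ih (σ i) h ⟨σ i, by omega⟩ rfl
        have h3 := congrArg Fin.val (hσinj h2)
        have h4 : σ i = i := h3
        omega
  refine ⟨?_, fun i => ?_⟩
  · obtain ⟨i, hi⟩ := hσsurj L le_rfl
    have h2 := hid i i rfl
    have h3 := hid l (Fin.last l) rfl
    have h4 := hσL (Fin.last l)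
    omega
  · have h2 := hid i i rfl
    have h3 := hσn i
    have h4 := hσU i
    rw [h2] at h3 h4
    exact ⟨h3.symm, h4⟩

lemma tmul_mem_homog {κ : Coords F M L n} {κ' : Coords F N L' n'} {i j : ℕ} {v : M} {w : N}
    (hv : v ∈ κ.layer i) (hw : w ∈ κ'.layer j) : v ⊗ₜ[F] w ∈ homog κ κ' (i + j) := by
  intro i' j' s q h
  rw [tcoord, pairing_tmul]
  by_cases hi : i' = i
  · rw [hw j' q (by omega), mul_zero]
  · rw [hv i' s hi, zero_mul]

lemma range_mapIncl_le {κ : Coords F M L n} {κ' : Coords F N L' n'} {P : Submodule F M}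
    {P' : Submodule F N} {i j : ℕ} (hP : P ≤ κ.layer i) (hP' : P' ≤ κ'.layer j) :
    LinearMap.range (TensorProduct.mapIncl P P') ≤ homog κ κ' (i + j) := by
  rintro _ ⟨u, rfl⟩
  induction u with
  | zero => rw [map_zero]; exact Submodule.zero_mem _
  | add u v hu hv => rw [map_add]; exact Submodule.add_mem _ hu hv
  | tmul v w => exact tmul_mem_homog (hP v.2) (hP' w.2)

lemma homog_zero_le {κ : Coords F M L n} {κ' : Coords F N L' n'} {P : Submodule F (M ⊗[F] N)}
    (h : ∀ v ∈ κ.layer 0, ∀ w ∈ κ'.layer 0, v ⊗ₜ[F] w ∈ P) : homog κ κ' 0 ≤ P := by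
  intro u hu
  refine mem_of_tcoord κ κ' fun i j s q h0 => ?_
  have hij : i + j = 0 := by
    by_contra hij
    exact h0 (hu i j s q hij)
  obtain ⟨rfl, rfl⟩ := Nat.add_eq_zero_iff.1 hij
  exact h _ (κ.vec_mem_layer 0 s) _ (κ'.vec_mem_layer 0 q)

lemma diag_eq_homog {κ : Coords F M L n} {κ' : Coords F N L' n'}
    {U : Fin (L + 1) → LieSubmodule F (levi F m) M}
    {U' : Fin (L' + 1) → LieSubmodule F (levi F m) N}
    (hU : ∀ i, (U i).toSubmodule = κ.layer i) (hU' : ∀ j, (U' j).toSubmodule = κ'.layer j)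
    (t : ℕ) : diag U U' t = homog κ κ' t := by
  refine le_antisymm ?_ fun u hu => ?_
  · refine iSup_le fun i => iSup_le fun j => iSup_le fun hij => ?_
    rw [← hij]
    exact range_mapIncl_le (hU i).le (hU' j).le
  · refine mem_of_tcoord κ κ' fun i j s q h0 => ?_
    have hij : i + j = t := by
      by_contra hij
      exact h0 (hu i j s q hij)
    have hle : i ≤ L ∧ j ≤ L' := by
      by_contra hle
      exact h0 (by rw [tcoord_eq_zero κ κ' (by omega), LinearMap.zero_apply])
    have h1 : κ.vec i s ∈ (U ⟨i, by omega⟩).toSubmodule := by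
      rw [hU]; exact κ.vec_mem_layer i s
    have h2 : κ'.vec j q ∈ (U' ⟨j, by omega⟩).toSubmodule := by
      rw [hU']; exact κ'.vec_mem_layer j q
    refine (le_iSup_of_le ⟨i, by omega⟩ (le_iSup_of_le ⟨j, by omega⟩
      (le_iSup_of_le hij le_rfl)) : LinearMap.range (TensorProduct.mapIncl _ _) ≤ diag U U' t) ?_
    exact ⟨⟨_, h1⟩ ⊗ₜ[F] ⟨_, h2⟩, rfl⟩

lemma mem_S_iff {κ : Coords F M L n} {κ' : Coords F N L' n'}
    {U : Fin (L + 1) → LieSubmodule F (levi F m) M}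
    {U' : Fin (L' + 1) → LieSubmodule F (levi F m) N}
    (hU : ∀ i, (U i).toSubmodule = κ.layer i) (hU' : ∀ j, (U' j).toSubmodule = κ'.layer j)
    (t : ℕ) (u : M ⊗[F] N) :
    u ∈ S U U' t ↔ u ∈ homog κ κ' t ∧ u ∈ radInv F m (M ⊗[F] N) := by
  rw [← diag_eq_homog hU hU']
  rfl

/-- The socle of a graded module is its part of degree `0`. -/
lemma Coords.IsGraded.socle_eq_layer {κ : Coords F M L n} (hκ : κ.IsGraded m)
    {g : V F (n 0) →ₗ[F] M} (hg : IsSlMap m g) (hinj : Function.Injective g)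
    (hr : LinearMap.range g = κ.layer 0) :
    (socle F (𝔤 F m) M).toSubmodule = κ.layer 0 := by
  refine le_antisymm (fun v hv k s hk => ?_) ?_
  · obtain ⟨k, rfl⟩ := Nat.exists_eq_succ_of_ne_zero hk
    exact hκ.mem_radInv_iff.1 (hκ.socle_le_radInv hv) k s
  · rw [← hr]
    refine range_le_socle hg hinj fun p => hκ.mem_radInv_iff.2 fun i s => ?_
    have h : g p ∈ κ.layer 0 := hr ▸ ⟨p, rfl⟩
    exact h (i + 1) s (Nat.succ_ne_zero i)

lemma socleTensor_eq_homog {κ : Coords F M L n} {κ' : Coords F N L' n'}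
    (h : (socle F (𝔤 F m) M).toSubmodule = κ.layer 0)
    (h' : (socle F (𝔤 F m) N).toSubmodule = κ'.layer 0) :
    (socleTensor M N : LieSubmodule F (𝔤 F m) (M ⊗[F] N)).toSubmodule = homog κ κ' 0 := by
  refine le_antisymm ?_ (homog_zero_le fun v hv w hw => ?_)
  · exact range_mapIncl_le (i := 0) (j := 0) h.le h'.le
  · rw [← h] at hv
    rw [← h'] at hw
    exact ⟨(⟨v, hv⟩ : socle F (𝔤 F m) M) ⊗ₜ[F] (⟨w, hw⟩ : socle F (𝔤 F m) N), rfl⟩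

lemma Coords.IsGraded.homog_zero_le_radInv {κ : Coords F M L n} {κ' : Coords F N L' n'}
    (hκ : κ.IsGraded m) (hκ' : κ'.IsGraded m) :
    homog κ κ' 0 ≤ (radInv F m (M ⊗[F] N)).toSubmodule := by
  intro u hu
  refine mem_radInv_of_basis fun c hc => κ.tcoord_ext κ' fun i _ j _ s _ q _ => ?_
  obtain ⟨r, r', h⟩ := hκ.tcoord_lie_rad hκ' i j s q hc
  rw [h, hu _ _ _ _ (by omega), hu _ _ _ _ (by omega), map_zero, add_zero]

end SocleDecomposition

/-! ### The socle of a tensor product -/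

section TensorSocle

open Coords

variable {F : Type*} [Field F] [CharZero F] {m : ℕ}

lemma IsSumOfForms.of_submodule {Q : Type*} [AddCommGroup Q] [Module F Q]
    [LieRingModule (𝔤 F m) Q] [LieModule F (𝔤 F m) Q] {P : LieSubmodule F (𝔤 F m) Q}
    {ι : Type*} {n : ι → ℕ} (hn : Function.Injective n)
    {g : ∀ x, V F (n x) →ₗ[F] Q} (hg : ∀ x, IsSlMap m (g x))
    (hinj : ∀ x, Function.Injective (g x))
    (hP : ⨆ x, LinearMap.range (g x) = P.toSubmodule) :
    IsSumOfForms (F := F) m P (Set.range n) := by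
  have hle : ∀ x p, g x p ∈ P.toSubmodule := fun x p =>
    hP ▸ Submodule.mem_iSup_of_mem x ⟨p, rfl⟩
  let g' : ∀ x, V F (n x) →ₗ[F] P := fun x => (g x).codRestrict P.toSubmodule (hle x)
  have hg' : ∀ x, P.toSubmodule.subtype ∘ₗ g' x = g x := fun x => rfl
  refine IsSumOfForms.of_index hn (g := g') (fun x A p => Subtype.ext (hg x A p))
    (fun x p q h => hinj x (congrArg Subtype.val h)) ?_
  apply Submodule.map_injective_of_injective (f := P.toSubmodule.subtype) Subtype.val_injective
  rw [Submodule.map_iSup, Submodule.map_top, Submodule.range_subtype]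
  refine Eq.trans (iSup_congr fun x => ?_) hP
  rw [← LinearMap.range_comp, hg']

variable {M : Type*} [AddCommGroup M] [Module F M] [LieRingModule (𝔤 F m) M]
  [LieModule F (𝔤 F m) M]
  {N : Type*} [AddCommGroup N] [Module F N] [LieRingModule (𝔤 F m) N] [LieModule F (𝔤 F m) N]
  {L L' : ℕ} {n n' : ℕ → ℕ}

lemma isSlMap_map {P Q : Type*} [AddCommGroup P] [Module F P] [LieRingModule (𝔤 F m) P]
    [LieModule F (𝔤 F m) P] [AddCommGroup Q] [Module F Q] [LieRingModule (𝔤 F m) Q]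
    [LieModule F (𝔤 F m) Q] {f : P →ₗ[F] M} {g : Q →ₗ[F] N} (hf : IsSlMap m f)
    (hg : IsSlMap m g) : IsSlMap m (TensorProduct.map f g) := by
  intro A u
  induction u with
  | zero => simp
  | add u v hu hv => rw [lie_add, map_add, map_add, lie_add, hu, hv]
  | tmul p q =>
    rw [TensorProduct.LieModule.lie_tmul_right, map_add, TensorProduct.map_tmul,
      TensorProduct.map_tmul, TensorProduct.map_tmul, TensorProduct.LieModule.lie_tmul_right, hf, hg]

/-- The socle of `M ⊗ N` is the direct sum of `soc(M) ⊗ soc(N)` and the `S_t`, for `t ≥ 1` not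
larger than the lengths `l` and `l'`. The two last conditions say that the sum is direct. -/
def SocleSplits {l l' : ℕ} (U : Fin (l + 1) → LieSubmodule F (levi F m) M)
    (U' : Fin (l' + 1) → LieSubmodule F (levi F m) N) : Prop :=
  socle F (𝔤 F m) (M ⊗[F] N) = socleTensor M N ⊔ ⨆ t : Finset.Icc 1 (min l l'), S U U' t ∧
    Disjoint (socleTensor M N) (⨆ t : Finset.Icc 1 (min l l'), S U U' t) ∧
    iSupIndep (fun t : Finset.Icc 1 (min l l') => S U U' t)

/-- If every `S_t` with `1 ≤ t ≤ min L L'` is zero or a copy of `V(w t)`, the latter for `t ∈ T`,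
where the `w t` are distinct and do not occur in `V(n 0) ⊗ V(n' 0)`, then the socle of `M ⊗ N` is
the direct sum of `V(n 0) ⊗ V(n' 0)` and these `V(w t)`. -/
theorem socle_tensor {κ : Coords F M L n} {κ' : Coords F N L' n'}
    (hκ : κ.IsGraded m) (hκ' : κ'.IsGraded m)
    {U : Fin (L + 1) → LieSubmodule F (levi F m) M}
    {U' : Fin (L' + 1) → LieSubmodule F (levi F m) N}
    (hU : ∀ i, (U i).toSubmodule = κ.layer i) (hU' : ∀ j, (U' j).toSubmodule = κ'.layer j)
    (hU0 : Nonempty (U 0 ≃ₗ⁅F, levi F m⁆ V F (n 0)))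
    (hU0' : Nonempty (U' 0 ≃ₗ⁅F, levi F m⁆ V F (n' 0)))
    {T : Set ℕ} (hT : T ⊆ Set.Icc 1 (min L L')) {w : ℕ → ℕ} (hw : Set.InjOn w T)
    (hwcg : ∀ t ∈ T, w t ∉ cgSet (n 0) (n' 0))
    (hbot : ∀ t ∈ Set.Icc 1 (min L L'), t ∉ T → S U U' t = ⊥)
    (hform : ∀ t ∈ T, ∃ φ : S U U' t ≃ₗ[F] V F (w t),
      IsSlMap m (φ : S U U' t →ₗ[F] V F (w t))) :
    SocleSplits U U' ∧
      IsSumOfForms (F := F) m (socle F (𝔤 F m) (M ⊗[F] N)) (cgSet (n 0) (n' 0) ∪ w '' T) := by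
  obtain ⟨g₁, hg₁, hinj₁, hr₁⟩ := exists_isSlMap_of_equiv hU0
  obtain ⟨g₂, hg₂, hinj₂, hr₂⟩ := exists_isSlMap_of_equiv hU0'
  replace hr₁ : LinearMap.range g₁ = κ.layer 0 := hr₁.trans (hU 0)
  replace hr₂ : LinearMap.range g₂ = κ'.layer 0 := hr₂.trans (hU' 0)
  have h0 := socleTensor_eq_homog (hκ.socle_eq_layer hg₁ hinj₁ hr₁)
    (hκ'.socle_eq_layer hg₂ hinj₂ hr₂)
  have hS : ∀ t, (S U U' t).toSubmodule =
      homog κ κ' t ⊓ (radInv F m (M ⊗[F] N)).toSubmodule := fun t => by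
    ext u
    exact mem_S_iff hU hU' t u
  obtain ⟨gc, hgc, hgcinj, hgctop⟩ := clebschGordan (F := F) m (n 0) (n' 0)
  choose φ hφ using fun t : T => hform t t.2
  -- the copies of the various `V(k)` which make up the socle
  let wt : cgSet (n 0) (n' 0) ⊕ T → ℕ := Sum.elim (fun k => k) (fun t => w t)
  have hwt : Function.Injective wt := by
    rintro (⟨k, hk⟩ | ⟨t, ht⟩) (⟨k', hk'⟩ | ⟨t', ht'⟩) h
    · obtain rfl : k = k' := h
      rfl
    · obtain rfl : k = w t' := h
      exact absurd hk (hwcg t' ht')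
    · obtain rfl : w t = k' := h
      exact absurd hk' (hwcg t ht)
    · obtain rfl := hw ht ht' h
      rfl
  let g : ∀ x, V F (wt x) →ₗ[F] M ⊗[F] N := fun x => match x with
    | Sum.inl k => TensorProduct.map g₁ g₂ ∘ₗ gc k
    | Sum.inr t => (S U U' t).toSubmodule.subtype ∘ₗ ((φ t).symm : V F (w t) →ₗ[F] S U U' t)
  have hg : ∀ x, IsSlMap m (g x) := by
    rintro (k | t)
    · exact IsSlMap.comp m (isSlMap_map hg₁ hg₂) (hgc k)
    · exact fun A p => congrArg Subtype.val (IsSlMap.symm m (hφ t) A p)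
  have hmap : Function.Injective (TensorProduct.map g₁ g₂) :=
    TensorProduct.map_injective_of_flat_flat g₁ g₂ hinj₁ hinj₂
  have hinj : ∀ x, Function.Injective (g x) := by
    rintro (k | t)
    · exact hmap.comp (hgcinj k k.2)
    · exact Subtype.val_injective.comp (φ t).symm.injective
  have hr0 : ⨆ k : cgSet (n 0) (n' 0), LinearMap.range (g (Sum.inl k)) = homog κ κ' 0 := by
    have h1 : ∀ k : cgSet (n 0) (n' 0), LinearMap.range (g (Sum.inl k)) =
        (LinearMap.range (gc k)).map (TensorProduct.map g₁ g₂) := fun k =>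
      LinearMap.range_comp _ _
    simp only [h1]
    rw [← Submodule.map_iSup, iSup_subtype, hgctop, Submodule.map_top]
    refine le_antisymm ?_ (homog_zero_le ?_)
    · rintro _ ⟨u, rfl⟩
      induction u with
      | zero => rw [map_zero]; exact Submodule.zero_mem _
      | add u v hu hv => rw [map_add]; exact Submodule.add_mem _ hu hv
      | tmul p q =>
        exact tmul_mem_homog (i := 0) (j := 0) (hr₁ ▸ ⟨p, rfl⟩) (hr₂ ▸ ⟨q, rfl⟩)
    · rw [← hr₁, ← hr₂]
      rintro _ ⟨p, rfl⟩ _ ⟨q, rfl⟩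
      exact ⟨p ⊗ₜ[F] q, rfl⟩
  have hrt : ∀ t : T, LinearMap.range (g (Sum.inr t)) = (S U U' t).toSubmodule := by
    intro t
    ext u
    constructor
    · rintro ⟨p, rfl⟩
      exact ((φ t).symm p).2
    · intro hu
      exact ⟨φ t ⟨u, hu⟩, congrArg Subtype.val ((φ t).symm_apply_apply ⟨u, hu⟩)⟩
  have hrad : ∀ x p, g x p ∈ radInv F m (M ⊗[F] N) := by
    rintro (k | t) p
    · exact hκ.homog_zero_le_radInv hκ' (hr0 ▸ Submodule.mem_iSup_of_mem k ⟨p, rfl⟩)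
    · have h1 : g (Sum.inr t) p ∈ (S U U' t).toSubmodule := hrt t ▸ ⟨p, rfl⟩
      rw [hS] at h1
      exact h1.2
  have hbot' : ∀ t ≠ 0, t ∉ T →
      homog κ κ' t ⊓ (radInv F m (M ⊗[F] N)).toSubmodule = ⊥ := by
    intro t ht0 ht
    by_cases hmin : t ≤ min L L'
    · rw [← hS, hbot t ⟨by omega, hmin⟩ ht]
      rfl
    · rw [eq_bot_iff]
      rintro u ⟨hu, hu'⟩
      exact hκ.eq_zero_of_min_lt hκ' (by omega) hu' hu
  have htop : ⨆ x, LinearMap.range (g x) =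
      (socle F (𝔤 F m) (M ⊗[F] N)).toSubmodule := by
    refine le_antisymm (iSup_le fun x => range_le_socle (hg x) (hinj x) (hrad x)) ?_
    refine le_trans (show _ ≤ (radInv F m (M ⊗[F] N)).toSubmodule from
      hκ.socle_tensor_le_radInv hκ') ?_
    refine (hκ.radInv_le_iSup hκ').trans (iSup_le fun t => ?_)
    rw [iSup_sum, hr0]
    by_cases ht : t ∈ T
    · refine le_sup_of_le_right (le_iSup_of_le ⟨t, ht⟩ ?_)
      rw [hrt, hS]
    · rcases eq_or_ne t 0 with rfl | ht0
      · exact le_sup_of_le_left inf_le_left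
      · rw [hbot' t ht0 ht]
        exact bot_le
  refine ⟨⟨?_, ?_, ?_⟩, ?_⟩
  · rw [← LieSubmodule.toSubmodule_inj, LieSubmodule.sup_toSubmodule,
      LieSubmodule.iSup_toSubmodule, ← htop, iSup_sum, hr0, h0]
    congr 1
    simp only [hrt]
    refine le_antisymm (iSup_le fun t => ?_) (iSup_le fun t => ?_)
    · exact le_iSup_of_le ⟨t.1, Finset.mem_Icc.2 (hT t.2)⟩ le_rfl
    · by_cases ht : t.1 ∈ T
      · exact le_iSup_of_le ⟨t.1, ht⟩ le_rfl
      · rw [hbot _ (Finset.mem_Icc.1 t.2) ht]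
        exact bot_le
  · rw [← LieSubmodule.disjoint_toSubmodule, LieSubmodule.iSup_toSubmodule, h0]
    refine (iSupIndep_homog κ κ' 0).mono_right (iSup_le fun t => ?_)
    rw [hS]
    exact inf_le_left.trans (le_iSup₂_of_le t.1
      (Nat.one_le_iff_ne_zero.1 (Finset.mem_Icc.1 t.2).1) le_rfl)
  · rw [← LieSubmodule.iSupIndep_toSubmodule]
    refine ((iSupIndep_homog κ κ').comp (f := fun t : Finset.Icc 1 (min L L') => (t : ℕ))
      Subtype.val_injective).mono fun t => ?_
    rw [hS]
    exact inf_le_left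
  · have h1 := IsSumOfForms.of_submodule hwt hg hinj htop
    convert h1 using 1
    rw [Set.Sum.elim_range]
    congr 1
    · exact Subtype.range_coe.symm
    · ext k
      simp

end TensorSocle

/-! ### The four combinations of modules of type `Z` -/

section Combinations

open Coords

variable {F : Type*} [Field F] [CharZero F] {m : ℕ}
  {M : Type*} [AddCommGroup M] [Module F M] [LieRingModule (𝔤 F m) M] [LieModule F (𝔤 F m) M]
  {N : Type*} [AddCommGroup N] [Module F N] [LieRingModule (𝔤 F m) N] [LieModule F (𝔤 F m) N]
  {l l' : ℕ} {n n' : ℕ → ℕ} {a b : ℕ → ℕ}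
  {U : Fin (l + 1) → LieSubmodule F (levi F m) M}
  {U' : Fin (l' + 1) → LieSubmodule F (levi F m) N}

/-- The members of the family `U` are copies of the `V(a i)` and are the parts of the various
degrees with respect to the coordinates `κ`. -/
structure Coords.IsAdapted (κ : Coords F M l n) (U : Fin (l + 1) → LieSubmodule F (levi F m) M)
    (a : ℕ → ℕ) : Prop where
  weight : ∀ i ≤ l, a i = n i
  layer : ∀ i : Fin (l + 1), (U i).toSubmodule = κ.layer i
  equiv : ∀ i : Fin (l + 1), Nonempty (U i ≃ₗ⁅F, levi F m⁆ V F (a i))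

lemma Coords.IsAdapted.equiv_zero {κ : Coords F M l n} (h : κ.IsAdapted U a) :
    Nonempty (U 0 ≃ₗ⁅F, levi F m⁆ V F (n 0)) :=
  h.weight 0 (Nat.zero_le _) ▸ h.equiv 0

lemma Coords.IsGraded.exists_isAdapted {L : ℕ} {κ : Coords F M L n} (hκ : κ.IsGraded m)
    (hm : 1 ≤ m) (hU : IsSocleDecomposition U)
    (hUa : ∀ i : Fin (l + 1), Nonempty (U i ≃ₗ⁅F, levi F m⁆ V F (a i))) :
    ∃ h : L = l, (h ▸ κ : Coords F M l n).IsAdapted U a := by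
  obtain ⟨rfl, h⟩ := hκ.eq_layer hm hU hUa
  exact ⟨rfl, fun i hi => (h ⟨i, Nat.lt_succ_of_le hi⟩).1, fun i => (h i).2, hUa⟩

/-- A module isomorphic to `Z(α, L)` has coordinates which fit a given socle decomposition. -/
lemma exists_isLowering (hm : 1 ≤ m) (hU : IsSocleDecomposition U)
    (hUa : ∀ i : Fin (l + 1), Nonempty (U i ≃ₗ⁅F, levi F m⁆ V F (a i))) {α L : ℕ}
    (h : Nonempty (M ≃ₗ⁅F, 𝔤 F m⁆ Z F m α L)) :
    ∃ (n : ℕ → ℕ) (κ : Coords F M l n), κ.IsLowering m ∧ κ.IsAdapted U a := by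
  obtain ⟨φ⟩ := h
  have hκ := (typeZ_isLowering (F := F) (m := m) (α := α) (l := L)).comap φ
  obtain ⟨rfl, had⟩ := (hκ.isGraded hm).exists_isAdapted hm hU hUa
  exact ⟨_, _, hκ, had⟩

/-- A module isomorphic to `Z(α, L)^*` has coordinates which fit a given socle decomposition. -/
lemma exists_isRaising (hm : 1 ≤ m) (hU : IsSocleDecomposition U)
    (hUa : ∀ i : Fin (l + 1), Nonempty (U i ≃ₗ⁅F, levi F m⁆ V F (a i))) {α L : ℕ}
    (h : Nonempty (M ≃ₗ⁅F, 𝔤 F m⁆ Module.Dual F (Z F m α L))) :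
    ∃ (n : ℕ → ℕ) (κ : Coords F M l n), κ.IsRaising m ∧ κ.IsAdapted U a := by
  obtain ⟨φ⟩ := h
  have hκ := (typeZ_isLowering (F := F) (m := m) (α := α) (l := L)).dual.comap φ
  obtain ⟨rfl, had⟩ := (hκ.isGraded hm).exists_isAdapted hm hU hUa
  exact ⟨_, _, hκ, had⟩

lemma le_of_mem_cgSet {a b k : ℕ} (h : k ∈ cgSet a b) : k ≤ a + b ∧ b ≤ k + a := by
  obtain ⟨i, hi, rfl⟩ := h
  omega

lemma cgSet_comm (a b : ℕ) : cgSet a b = cgSet b a := by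
  ext k
  simp only [cgSet, min_comm a b, add_comm a b]

/-- The socle of `Z ⊗ Z`. -/
theorem Coords.IsLowering.socle_tensor_lowering (hm : 1 ≤ m) {κ : Coords F M l n}
    {κ' : Coords F N l' n'} (hκ : κ.IsLowering m) (hκ' : κ'.IsLowering m)
    (hU : κ.IsAdapted U a) (hU' : κ'.IsAdapted U' b) :
    SocleSplits U U' ∧
      (∀ t ∈ Set.Icc 1 (min l l'), ∃ φ : S U U' t ≃ₗ[F] V F (a 0 + b 0 + m * t),
        IsSlMap m (φ : S U U' t →ₗ[F] V F (a 0 + b 0 + m * t))) ∧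
      IsSumOfForms (F := F) m (socle F (𝔤 F m) (M ⊗[F] N))
        (cgSet (a 0) (b 0) ∪ (fun t => a 0 + b 0 + m * t) '' Set.Icc 1 (min l l')) := by
  rw [hU.weight 0 (Nat.zero_le _), hU'.weight 0 (Nat.zero_le _)]
  have hS : ∀ t ∈ Set.Icc 1 (min l l'), ∃ φ : S U U' t ≃ₗ[F] V F (n 0 + n' 0 + m * t),
      IsSlMap m (φ : S U U' t →ₗ[F] V F (n 0 + n' 0 + m * t)) := by
    rintro t ⟨h1, h2⟩
    have h3 := hκ'.weight_eq (i := t) (by omega)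
    exact hκ.exists_equiv hm hκ' h1 (by omega) (by omega) (by rw [h3]; ring)
      (mem_S_iff hU.layer hU'.layer t)
  have hsoc := socle_tensor (hκ.isGraded hm) (hκ'.isGraded hm) hU.layer hU'.layer hU.equiv_zero
    hU'.equiv_zero Set.Subset.rfl (w := fun t => n 0 + n' 0 + m * t)
    (fun s _ t _ h => Nat.eq_of_mul_eq_mul_left hm (Nat.add_left_cancel h))
    (fun t ht hcg => by
      have h1 := (le_of_mem_cgSet hcg).1
      have h2 : 0 < m * t := Nat.mul_pos hm ht.1
      omega)
    (fun t ht h => absurd ht h) hS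
  exact ⟨hsoc.1, hS, hsoc.2⟩

/-- The socle of `Z ⊗ Z^*`. -/
theorem Coords.IsLowering.socle_tensor_raising (hm : 1 ≤ m) {κ : Coords F M l n}
    {κ' : Coords F N l' n'} (hκ : κ.IsLowering m) (hκ' : κ'.IsRaising m)
    (hU : κ.IsAdapted U a) (hU' : κ'.IsAdapted U' b) :
    SocleSplits U U' ∧
      (∀ t ∈ Set.Icc 1 (min l l'), b t < a 0 → S U U' t = ⊥) ∧
      (∀ t ∈ Set.Icc 1 (min l l'), a 0 ≤ b t →
        ∃ φ : S U U' t ≃ₗ[F] V F (b 0 - a 0 - t * m),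
          IsSlMap m (φ : S U U' t →ₗ[F] V F (b 0 - a 0 - t * m))) ∧
      IsSumOfForms (F := F) m (socle F (𝔤 F m) (M ⊗[F] N)) (cgSet (a 0) (b 0) ∪
        (fun t => b 0 - a 0 - t * m) '' {t ∈ Set.Icc 1 (min l l') | a 0 ≤ b t}) := by
  have hwt : ∀ t ≤ l', b t + t * m = b 0 := fun t ht => by
    rw [hU'.weight t ht, hU'.weight 0 (Nat.zero_le _), hκ'.weight_add ht]
  have h0 := hU.weight 0 (Nat.zero_le _)
  have hbot : ∀ t ∈ Set.Icc 1 (min l l'), b t < a 0 → S U U' t = ⊥ := by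
    rintro t ⟨h1, h2⟩ hlt
    rw [LieSubmodule.eq_bot_iff]
    intro u hu
    obtain ⟨hu1, hu2⟩ := (mem_S_iff hU.layer hU'.layer t u).1 hu
    rw [hU'.weight t (by omega), h0] at hlt
    exact hκ.eq_zero_of_lt hm hκ' h1 hlt hu2 hu1
  have hS : ∀ t ∈ Set.Icc 1 (min l l'), a 0 ≤ b t →
      ∃ φ : S U U' t ≃ₗ[F] V F (b 0 - a 0 - t * m),
        IsSlMap m (φ : S U U' t →ₗ[F] V F (b 0 - a 0 - t * m)) := by
    rintro t ⟨h1, h2⟩ hle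
    have h3 := hwt t (by omega)
    have h4 := hU'.weight t (by omega)
    exact hκ.exists_equiv_raising hm hκ' h1 (by omega) (by omega) (by omega)
      (mem_S_iff hU.layer hU'.layer t)
  have hsoc := socle_tensor (hκ.isGraded hm) (hκ'.isGraded hm) hU.layer hU'.layer hU.equiv_zero
    hU'.equiv_zero (T := {t ∈ Set.Icc 1 (min l l') | a 0 ≤ b t}) (fun t ht => ht.1)
    (w := fun t => b 0 - a 0 - t * m) ?_ ?_
    (fun t ht h => hbot t ht (not_le.1 fun hle => h ⟨ht, hle⟩)) (fun t ht => hS t ht.1 ht.2)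
  · rw [← h0, ← hU'.weight 0 (Nat.zero_le _)] at hsoc
    exact ⟨hsoc.1, hbot, hS, hsoc.2⟩
  · rintro s ⟨⟨-, hs⟩, hs'⟩ t ⟨⟨-, ht⟩, ht'⟩ h
    have h1 := hwt s (by omega)
    have h2 := hwt t (by omega)
    have h3 : b 0 - a 0 - s * m = b 0 - a 0 - t * m := h
    exact Nat.eq_of_mul_eq_mul_right hm (by omega)
  · rintro t ⟨⟨ht1, ht⟩, ht'⟩ hcg
    have h1 := hwt t (by omega)
    have h2 : 0 < t * m := Nat.mul_pos ht1 hm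
    have h3 := (le_of_mem_cgSet hcg).2
    rw [← h0, ← hU'.weight 0 (Nat.zero_le _)] at h3
    omega

/-- The socle of `Z^* ⊗ Z^*`. -/
theorem Coords.IsRaising.socle_tensor_raising (hm : 1 ≤ m) {κ : Coords F M l n}
    {κ' : Coords F N l' n'} (hκ : κ.IsRaising m) (hκ' : κ'.IsRaising m)
    (hU : κ.IsAdapted U a) (hU' : κ'.IsAdapted U' b) :
    SocleSplits U U' ∧ (∀ t, 1 ≤ t → S U U' t = ⊥) ∧
      IsSumOfForms (F := F) m (socle F (𝔤 F m) (M ⊗[F] N)) (cgSet (a 0) (b 0)) := by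
  rw [hU.weight 0 (Nat.zero_le _), hU'.weight 0 (Nat.zero_le _)]
  have hbot : ∀ t, 1 ≤ t → S U U' t = ⊥ := by
    intro t ht
    rw [LieSubmodule.eq_bot_iff]
    intro u hu
    obtain ⟨hu1, hu2⟩ := (mem_S_iff hU.layer hU'.layer t u).1 hu
    exact hκ.eq_zero_of_homog hm hκ' ht hu2 hu1
  have hsoc := socle_tensor (hκ.isGraded hm) (hκ'.isGraded hm) hU.layer hU'.layer hU.equiv_zero
    hU'.equiv_zero (Set.empty_subset _) (w := id) (Set.injOn_empty _)
    (fun t ht => absurd ht (Set.notMem_empty t)) (fun t ht _ => hbot t ht.1)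
    (fun t ht => absurd ht (Set.notMem_empty t))
  rw [Set.image_empty, Set.union_empty] at hsoc
  exact ⟨hsoc.1, hbot, hsoc.2⟩

lemma lie_comm (x : 𝔤 F m) (u : M ⊗[F] N) :
    TensorProduct.comm F M N ⁅x, u⁆ = ⁅x, TensorProduct.comm F M N u⁆ := by
  induction u with
  | zero => simp
  | add u v hu hv => rw [lie_add, map_add, map_add, lie_add, hu, hv]
  | tmul p q =>
    rw [TensorProduct.LieModule.lie_tmul_right, map_add, TensorProduct.comm_tmul,
      TensorProduct.comm_tmul, TensorProduct.comm_tmul, TensorProduct.LieModule.lie_tmul_right,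
      add_comm]

lemma comm_mem_S {κ : Coords F M l n} {κ' : Coords F N l' n'}
    (hU : κ.IsAdapted U a) (hU' : κ'.IsAdapted U' b) {t : ℕ} {u : M ⊗[F] N} (hu : u ∈ S U U' t) :
    TensorProduct.comm F M N u ∈ S U' U t := by
  rw [mem_S_iff hU.layer hU'.layer] at hu
  rw [mem_S_iff hU'.layer hU.layer]
  refine ⟨fun j i q s h => ?_, fun e => ?_⟩
  · rw [tcoord, pairing_comm]
    exact hu.1 i j s q (by omega)
  · rw [← lie_comm, hu.2, map_zero]

/-- Interchanging the factors identifies the two versions of `S_t`. -/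
lemma exists_S_comm {κ : Coords F M l n} {κ' : Coords F N l' n'}
    (hU : κ.IsAdapted U a) (hU' : κ'.IsAdapted U' b) (t : ℕ) :
    ∃ e : S U U' t ≃ₗ[F] S U' U t, IsSlMap m (e : S U U' t →ₗ[F] S U' U t) := by
  let f : S U U' t →ₗ[F] S U' U t :=
    (TensorProduct.comm F M N : M ⊗[F] N →ₗ[F] N ⊗[F] M).restrict
      (p := (S U U' t).toSubmodule) (q := (S U' U t).toSubmodule) fun u => comm_mem_S hU hU'
  let f' : S U' U t →ₗ[F] S U U' t :=
    (TensorProduct.comm F N M : N ⊗[F] M →ₗ[F] M ⊗[F] N).restrict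
      (p := (S U' U t).toSubmodule) (q := (S U U' t).toSubmodule) fun u => comm_mem_S hU' hU
  refine ⟨LinearEquiv.ofLinearMap f f' ?_ ?_, fun A u => Subtype.ext (lie_comm _ u.1)⟩
  · exact LinearMap.ext fun u => Subtype.ext ((TensorProduct.comm F M N).apply_symm_apply u.1)
  · exact LinearMap.ext fun u => Subtype.ext ((TensorProduct.comm F M N).symm_apply_apply u.1)

/-- The socle of `Z^* ⊗ Z`, obtained from `Z ⊗ Z^*` by interchanging the factors. -/
theorem Coords.IsRaising.socle_tensor_lowering (hm : 1 ≤ m) {κ : Coords F M l n}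
    {κ' : Coords F N l' n'} (hκ : κ.IsRaising m) (hκ' : κ'.IsLowering m)
    (hU : κ.IsAdapted U a) (hU' : κ'.IsAdapted U' b) :
    SocleSplits U U' ∧ ∃ A : Set ℕ,
      IsSumOfForms (F := F) m (socle F (𝔤 F m) (M ⊗[F] N)) A := by
  have hwt : ∀ t ≤ l, a t + t * m = a 0 := fun t ht => by
    rw [hU.weight t ht, hU.weight 0 (Nat.zero_le _), hκ.weight_add ht]
  have h0 := hU.weight 0 (Nat.zero_le _)
  have h0' := hU'.weight 0 (Nat.zero_le _)
  obtain ⟨-, hbot, hS, -⟩ := hκ'.socle_tensor_raising hm hκ hU' hU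
  rw [min_comm] at hbot hS
  have hsoc := socle_tensor (hκ.isGraded hm) (hκ'.isGraded hm) hU.layer hU'.layer hU.equiv_zero
    hU'.equiv_zero (T := {t ∈ Set.Icc 1 (min l l') | b 0 ≤ a t}) (fun t ht => ht.1)
    (w := fun t => a 0 - b 0 - t * m) ?_ ?_ ?_ ?_
  · exact ⟨hsoc.1, _, hsoc.2⟩
  · rintro s ⟨⟨-, hs⟩, hs'⟩ t ⟨⟨-, ht⟩, ht'⟩ h
    have h1 := hwt s (by omega)
    have h2 := hwt t (by omega)
    have h3 : a 0 - b 0 - s * m = a 0 - b 0 - t * m := h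
    exact Nat.eq_of_mul_eq_mul_right hm (by omega)
  · rintro t ⟨⟨ht1, ht⟩, ht'⟩ hcg
    have h1 := hwt t (by omega)
    have h2 : 0 < t * m := Nat.mul_pos ht1 hm
    rw [cgSet_comm] at hcg
    have h3 := (le_of_mem_cgSet hcg).2
    rw [← h0, ← h0'] at h3
    omega
  · intro t ht h
    rw [LieSubmodule.eq_bot_iff]
    intro u hu
    have h1 := comm_mem_S hU hU' hu
    rw [hbot t ht (not_le.1 fun hle => h ⟨ht, hle⟩), LieSubmodule.mem_bot] at h1
    exact (LinearEquiv.map_eq_zero_iff _).1 h1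
  · rintro t ⟨ht, ht'⟩
    obtain ⟨φ, hφ⟩ := hS t ht ht'
    obtain ⟨e, he⟩ := exists_S_comm hU hU' t
    exact ⟨e ≪≫ₗ φ, IsSlMap.comp m hφ he⟩

lemma nonempty_equiv_of_isSlMap {Q : Type*} [AddCommGroup Q] [Module F Q]
    [LieRingModule (𝔤 F m) Q] [LieModule F (𝔤 F m) Q] {k : ℕ} {φ : Q ≃ₗ[F] V F k}
    (hφ : IsSlMap m (φ : Q →ₗ[F] V F k)) : Nonempty (Q ≃ₗ⁅F, levi F m⁆ V F k) := by
  refine ⟨{ φ with map_lie' := fun {x v} => ?_ }⟩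
  obtain ⟨A, hA⟩ := levi_exists x
  change φ ⁅x, v⁆ = ⁅x, φ v⁆
  rw [LieSubalgebra.coe_bracket_of_module, LieSubalgebra.coe_bracket_of_module, hA]
  exact hφ A v

lemma range_cgSet (a b : ℕ) :
    Set.range (fun k : Finset.Icc 0 (min a b) => a + b - 2 * (k : ℕ)) = cgSet a b := by
  ext k
  constructor
  · rintro ⟨⟨i, hi⟩, rfl⟩
    exact ⟨i, (Finset.mem_Icc.1 hi).2, rfl⟩
  · rintro ⟨i, hi, rfl⟩
    exact ⟨⟨i, Finset.mem_Icc.2 ⟨Nat.zero_le _, hi⟩⟩, rfl⟩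

/-- The weights in `V(a) ⊗ V(b)` in increasing order, starting with `c = |a - b|`. -/
lemma range_cgSet_rev {a b c d : ℕ} (hc : c = max a b - min a b) (hd : d = min a b) :
    Set.range (fun k : Finset.Icc 0 d => c + 2 * (k : ℕ)) = cgSet a b := by
  subst hc hd
  ext k
  constructor
  · rintro ⟨⟨i, hi⟩, rfl⟩
    have := (Finset.mem_Icc.1 hi).2
    exact ⟨min a b - i, by omega, by dsimp only; omega⟩
  · rintro ⟨i, hi, rfl⟩
    exact ⟨⟨min a b - i, Finset.mem_Icc.2 ⟨Nat.zero_le _, by omega⟩⟩, by dsimp only; omega⟩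

end Combinations

end

end GM

theorem theorem3p5 (F : Type*) [Field F] [CharZero F] (m : ℕ) (hm : 1 ≤ m)
    (M : Type*) [AddCommGroup M] [Module F M] [LieRingModule (𝔤 F m) M] [LieModule F (𝔤 F m) M]
    (N : Type*) [AddCommGroup N] [Module F N] [LieRingModule (𝔤 F m) N] [LieModule F (𝔤 F m) N]
    (hM : IsTypeZ F m M) (hN : IsTypeZ F m N) (l l' : ℕ) (a b : ℕ → ℕ)
    (U : Fin (l + 1) → LieSubmodule F (levi F m) M) (hU : IsSocleDecomposition U)
    (hUa : ∀ i : Fin (l + 1), Nonempty (U i ≃ₗ⁅F, levi F m⁆ V F (a i)))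
    (U' : Fin (l' + 1) → LieSubmodule F (levi F m) N) (hU' : IsSocleDecomposition U')
    (hUb : ∀ j : Fin (l' + 1), Nonempty (U' j ≃ₗ⁅F, levi F m⁆ V F (b j))) :
    -- the socle is the direct sum of `soc(M) ⊗ soc(N)` and the `S_t`, `1 ≤ t ≤ min(l, l')`
    (socle F (𝔤 F m) (M ⊗[F] N) =
        socleTensor M N ⊔ ⨆ t : Finset.Icc 1 (min l l'), S U U' t ∧
      Disjoint (socleTensor M N) (⨆ t : Finset.Icc 1 (min l l'), S U U' t) ∧
      iSupIndep (fun t : Finset.Icc 1 (min l l') => S U U' t)) ∧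
    -- (i) `M = Z(a₀, l)`, `N = Z(b₀, l')`
    (Nonempty (M ≃ₗ⁅F, 𝔤 F m⁆ Z F m (a 0) l) → Nonempty (N ≃ₗ⁅F, 𝔤 F m⁆ Z F m (b 0) l') →
      (∀ t ∈ Finset.Icc 1 (min l l'),
        Nonempty (S U U' t ≃ₗ⁅F, levi F m⁆ V F (a 0 + b 0 + m * t))) ∧
      Nonempty (socle F (𝔤 F m) (M ⊗[F] N) ≃ₗ⁅F, levi F m⁆
        ⨁ x : Finset.Icc 0 (min (a 0) (b 0)) ⊕ Finset.Icc 1 (min l l'),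
          V F (Sum.elim (fun k : Finset.Icc 0 (min (a 0) (b 0)) => a 0 + b 0 - 2 * k)
            (fun t : Finset.Icc 1 (min l l') => a 0 + b 0 + m * t) x))) ∧
    -- (ii) `M = Z(a₀, l)`, `N = Z(b_{l'}, l')^*`
    (Nonempty (M ≃ₗ⁅F, 𝔤 F m⁆ Z F m (a 0) l) →
      Nonempty (N ≃ₗ⁅F, 𝔤 F m⁆ Module.Dual F (Z F m (b l') l')) →
      (∀ t ∈ Finset.Icc 1 (min l l'),
        (b t < a 0 → S U U' t = ⊥) ∧
        (a 0 ≤ b t → Nonempty (S U U' t ≃ₗ⁅F, levi F m⁆ V F (b 0 - a 0 - t * m)))) ∧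
      (b 0 < a 0 → Nonempty (socle F (𝔤 F m) (M ⊗[F] N) ≃ₗ⁅F, levi F m⁆
        ⨁ k : Finset.Icc 0 (b 0), V F (a 0 - b 0 + 2 * k))) ∧
      (a 0 ≤ b 0 → Nonempty (socle F (𝔤 F m) (M ⊗[F] N) ≃ₗ⁅F, levi F m⁆
        ⨁ x : Finset.Icc 0 (a 0) ⊕ Finset.Icc 1 (min (min l l') ((b 0 - a 0) / m)),
          V F (Sum.elim (fun k : Finset.Icc 0 (a 0) => b 0 - a 0 + 2 * k)
            (fun t : Finset.Icc 1 (min (min l l') ((b 0 - a 0) / m)) => b 0 - a 0 - t * m) x)))) ∧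
    -- (iii) `M = Z(a_l, l)^*`, `N = Z(b_{l'}, l')^*`
    (Nonempty (M ≃ₗ⁅F, 𝔤 F m⁆ Module.Dual F (Z F m (a l) l)) →
      Nonempty (N ≃ₗ⁅F, 𝔤 F m⁆ Module.Dual F (Z F m (b l') l')) →
      (∀ t : ℕ, 1 ≤ t → S U U' t = ⊥) ∧
      Nonempty (socle F (𝔤 F m) (M ⊗[F] N) ≃ₗ⁅F, levi F m⁆
        ⨁ k : Finset.Icc 0 (min (a 0) (b 0)),
          V F (max (a 0) (b 0) - min (a 0) (b 0) + 2 * k))) ∧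
    -- the socle is multiplicity free over `sl(2)`
    IsMultiplicityFree F (levi F m) (socle F (𝔤 F m) (M ⊗[F] N)) := by
  have key : SocleSplits U U' ∧
      ∃ A : Set ℕ, IsSumOfForms (F := F) m (socle F (𝔤 F m) (M ⊗[F] N)) A := by
    obtain ⟨α, L, hM | hM⟩ := hM <;> obtain ⟨β, L', hN | hN⟩ := hN
    · obtain ⟨n, κ, hκ, hκU⟩ := exists_isLowering hm hU hUa hM
      obtain ⟨n', κ', hκ', hκU'⟩ := exists_isLowering hm hU' hUb hN
      obtain ⟨h, -, h'⟩ := hκ.socle_tensor_lowering hm hκ' hκU hκU'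
      exact ⟨h, _, h'⟩
    · obtain ⟨n, κ, hκ, hκU⟩ := exists_isLowering hm hU hUa hM
      obtain ⟨n', κ', hκ', hκU'⟩ := exists_isRaising hm hU' hUb hN
      obtain ⟨h, -, -, h'⟩ := hκ.socle_tensor_raising hm hκ' hκU hκU'
      exact ⟨h, _, h'⟩
    · obtain ⟨n, κ, hκ, hκU⟩ := exists_isRaising hm hU hUa hM
      obtain ⟨n', κ', hκ', hκU'⟩ := exists_isLowering hm hU' hUb hN
      exact hκ.socle_tensor_lowering hm hκ' hκU hκU'
    · obtain ⟨n, κ, hκ, hκU⟩ := exists_isRaising hm hU hUa hM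
      obtain ⟨n', κ', hκ', hκU'⟩ := exists_isRaising hm hU' hUb hN
      obtain ⟨h, -, h'⟩ := hκ.socle_tensor_raising hm hκ' hκU hκU'
      exact ⟨h, _, h'⟩
  obtain ⟨hsplit, A, hA⟩ := key
  refine ⟨hsplit, fun hMZ hNZ => ?_, fun hMZ hNZ => ?_, fun hMZ hNZ => ?_,
    hA.isMultiplicityFree hm⟩
  · obtain ⟨n, κ, hκ, hκU⟩ := exists_isLowering hm hU hUa hMZ
    obtain ⟨n', κ', hκ', hκU'⟩ := exists_isLowering hm hU' hUb hNZ
    obtain ⟨-, hS, hsoc⟩ := hκ.socle_tensor_lowering hm hκ' hκU hκU'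
    refine ⟨fun t ht => ?_, hsoc.exists_equiv hm ?_ ?_⟩
    · obtain ⟨φ, hφ⟩ := hS t (Finset.mem_Icc.1 ht)
      exact nonempty_equiv_of_isSlMap hφ
    · have hle : ∀ k : Finset.Icc 0 (min (a 0) (b 0)), (k : ℕ) ≤ min (a 0) (b 0) := fun k =>
        (Finset.mem_Icc.1 k.2).2
      have hpos : ∀ t : Finset.Icc 1 (min l l'), 0 < m * (t : ℕ) := fun t =>
        Nat.mul_pos hm (Finset.mem_Icc.1 t.2).1
      refine Function.Injective.sumElim (fun i j h => Subtype.ext ?_)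
        (fun s t h => Subtype.ext (Nat.eq_of_mul_eq_mul_left hm (Nat.add_left_cancel h)))
        fun k t h => ?_
      · have h1 := hle i
        have h2 := hle j
        omega
      · have h1 := hpos t
        omega
    · rw [Set.Sum.elim_range, range_cgSet]
      congr 1
      ext k
      simp
  · obtain ⟨n, κ, hκ, hκU⟩ := exists_isLowering hm hU hUa hMZ
    obtain ⟨n', κ', hκ', hκU'⟩ := exists_isRaising hm hU' hUb hNZ
    obtain ⟨-, hbot, hS, hsoc⟩ := hκ.socle_tensor_raising hm hκ' hκU hκU'
    have hwt : ∀ t ≤ l', b t + t * m = b 0 := fun t ht => by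
      rw [hκU'.weight t ht, hκU'.weight 0 (Nat.zero_le _), hκ'.weight_add ht]
    refine ⟨fun t ht => ⟨hbot t (Finset.mem_Icc.1 ht), fun hle => ?_⟩, fun hlt => ?_, fun hle => ?_⟩
    · obtain ⟨φ, hφ⟩ := hS t (Finset.mem_Icc.1 ht) hle
      exact nonempty_equiv_of_isSlMap hφ
    · refine hsoc.exists_equiv hm (fun i j h => Subtype.ext (by omega)) ?_
      rw [range_cgSet_rev (a := a 0) (b := b 0) (by omega) (by omega), eq_comm,
        Set.union_eq_left]
      rintro _ ⟨t, ⟨⟨-, ht⟩, ht'⟩, rfl⟩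
      have := hwt t (by omega)
      omega
    · -- the bound `t ≤ (b 0 - a 0) / m` expresses the condition `a 0 ≤ b t`
      have hT : ∀ t, t ∈ Finset.Icc 1 (min (min l l') ((b 0 - a 0) / m)) ↔
          t ∈ {t ∈ Set.Icc 1 (min l l') | a 0 ≤ b t} := by
        intro t
        rw [Finset.mem_Icc, le_min_iff, Nat.le_div_iff_mul_le hm]
        constructor
        · rintro ⟨h1, h2, h3⟩
          have := hwt t (by omega)
          exact ⟨⟨h1, h2⟩, by omega⟩
        · rintro ⟨⟨h1, h2⟩, h3⟩
          have := hwt t (by omega)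
          exact ⟨h1, h2, by omega⟩
      have hmul : ∀ t : Finset.Icc 1 (min (min l l') ((b 0 - a 0) / m)),
          0 < (t : ℕ) * m ∧ (t : ℕ) * m ≤ b 0 - a 0 := fun t =>
        have ht := Finset.mem_Icc.1 t.2
        ⟨Nat.mul_pos ht.1 hm, (Nat.le_div_iff_mul_le hm).1 (ht.2.trans (min_le_right _ _))⟩
      refine hsoc.exists_equiv hm ?_ ?_
      · refine Function.Injective.sumElim (fun i j h => Subtype.ext (by omega))
          (fun s t h => Subtype.ext (Nat.eq_of_mul_eq_mul_right hm ?_)) fun k t h => ?_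
        · have h1 := hmul s
          have h2 := hmul t
          omega
        · have h1 := hmul t
          omega
      · rw [Set.Sum.elim_range, range_cgSet_rev (a := a 0) (b := b 0) (by omega) (by omega)]
        congr 1
        ext k
        constructor
        · rintro ⟨t, rfl⟩
          exact ⟨t, (hT t).1 t.2, rfl⟩
        · rintro ⟨t, ht, rfl⟩
          exact ⟨⟨t, (hT t).2 ht⟩, rfl⟩
  · obtain ⟨n, κ, hκ, hκU⟩ := exists_isRaising hm hU hUa hMZ
    obtain ⟨n', κ', hκ', hκU'⟩ := exists_isRaising hm hU' hUb hNZ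
    obtain ⟨-, hbot, hsoc⟩ := hκ.socle_tensor_raising hm hκ' hκU hκU'
    exact ⟨hbot, hsoc.exists_equiv hm (fun i j h => Subtype.ext (by omega))
      (range_cgSet_rev rfl rfl)⟩
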